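/- Let $\mathbb S^1=[0,2\pi]/_\sim$ and, for a regular closed curve $c:\mathbb S^1\to\mathbb R^2$ of class $H^2$, let $\partial_s=|\partial_x c|^{-1}\partial_x$ be the arclength derivative, $\mathrm ds=|\partial_x c|\,\mathrm dx$, $\tau=\partial_s c$ the unit tangent, $\boldsymbol\kappa=\partial_s^2c$ the curvature vector, $\partial_s^\perp\varphi=\partial_s\varphi-\langle\partial_s\varphi,\tau\rangle\tau$ the normal derivative along $c$, and $$\mathcal E(c)=\int_{\mathbb S^1}|\boldsymbol\kappa|^2\,\mathrm ds+\int_{\mathbb S^1}\mathrm ds$$ the elastic energy. Let $\gamma:\mathbb S^1\to\mathbb R^2$ be a regular smooth closed curve. For $m\in\mathbb N$ let $H^{m,\perp}_\gamma$ be the space of all $\psi\in H^m(\mathbb S^1,\mathbb R^2)$ with $\langle\psi,\tau_\gamma\rangle=0$ a.e., with the $H^m$ norm, let $L^{2,\perp}_\gamma=H^{0,\perp}_\gamma$, and let $(L^{2,\perp}_\gamma)^\star$ be its dual. Call $\rho>0$ admissible if $\gamma+\psi$ is a regular curve for every $\psi\in H^4(\mathbb S^1,\mathbb R^2)$ with $\|\psi\|_{H^4}\le\rho$;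 for such $\rho$ let $B_\rho$ be the open ball of radius $\rho$ about $0$ in $H^{4,\perp}_\gamma$, and put $E(\psi)=\mathcal E(\gamma+\psi)$. Then admissible radii exist, and: 1. For every admissible $\rho$, the function $E:B_\rho\to\mathbb R$ is analytic. For every $\psi\in B_\rho$ the first variation $\delta E(\psi)[\varphi]=\frac{d}{d\varepsilon}E(\psi+\varepsilon\varphi)\big|_{\varepsilon=0}$, $\varphi\in H^{4,\perp}_\gamma$, exists and extends to an element of $(L^{2,\perp}_\gamma)^\star$ (uniquely, as $H^{4,\perp}_\gamma$ is dense in $L^{2,\perp}_\gamma$), and the map $\delta E:B_\rho\to(L^{2,\perp}_\gamma)^\star$ is analytic. 2. The second variation $\delta^2E(0)[\varphi][\zeta]=\frac{d}{d\eta}\frac{d}{d\varepsilon}E(\varepsilon\varphi+\eta\zeta)\big|_{\varepsilon=0}\big|_{\eta=0}$, $\varphi,\zeta\in H^{4,\perp}_\gamma$, exists and extends (uniquely) in $\zeta$ to a bounded linear operator $\delta^2E(0):H^{4,\perp}_\gamma\to(L^{2,\perp}_\gamma)^\star$. This operator is Fredholm of index zero: $\dim\ker\delta^2E(0)=\operatorname{codim}\operatorname{Im}\delta^2E(0)<\infty$.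 3. The operator $\mathrm{id}+(\partial_s^\perp)^4:H^{4,\perp}_\gamma\to L^{2,\perp}_\gamma$, with $\partial_s^\perp$ taken along $\gamma$, is a bounded linear operator with bounded inverse. -/

import Mathlib

open MeasureTheory
open scoped RealInnerProductSpace ContDiff

noncomputable section

namespace ElasticCurve

/-- The period of the parameter circle is positive. -/
instance factTwoPiPos : Fact (0 < 2 * Real.pi) := ⟨Real.two_pi_pos⟩

/-- The parameter circle `[0, 2π]/∼`, carrying the Lebesgue measure `dx` of total mass `2π`. -/
abbrev ParamCircle : Type := AddCircle (2 * Real.pi)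

/-- The Euclidean plane. -/
abbrev Plane : Type := EuclideanSpace ℝ (Fin 2)

/-! ### Curves -/

/-- A map from the circle to the plane that is of class `C^n` (as a `2π`-periodic map on the line)
and whose derivative vanishes nowhere. -/
structure IsRegularCurve (n : ℕ∞) (c : ParamCircle → Plane) : Prop where
  contDiff : ContDiff ℝ n (fun x : ℝ => c (x : ParamCircle))
  deriv_ne_zero : ∀ x : ℝ, deriv (fun y : ℝ => c (y : ParamCircle)) x ≠ 0

/-! ### Weak derivatives on the circle -/

/-- `g` is a weak derivative of `f` on the circle: both are integrable and
`∫ η' f dx = - ∫ η g dx` for every smooth test function `η` on the circle, `η'` being its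
classical derivative. -/
structure HasWeakDeriv (f g : ParamCircle → Plane) : Prop where
  integrable_left : Integrable f
  integrable_right : Integrable g
  integral_eq : ∀ η η' : ParamCircle → ℝ,
    ContDiff ℝ ∞ (fun x : ℝ => η (x : ParamCircle)) →
    (∀ x : ℝ, HasDerivAt (fun y : ℝ => η (y : ParamCircle)) (η' (x : ParamCircle)) x) →
    ∫ x, η' x • f x = - ∫ x, η x • g x

open Classical in
/-- The weak derivative `∂_x f` of `f` (unique up to null sets), and `0` if there is none. -/
def weakDeriv (f : ParamCircle → Plane) : ParamCircle → Plane :=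
  if h : ∃ g, HasWeakDeriv f g then h.choose else 0

/-! ### Geometry of curves and the elastic energy -/

/-- The derivative `∂_s f = |∂_x c|⁻¹ ∂_x f` with respect to the arclength of the curve `c`. -/
def arcDeriv (c f : ParamCircle → Plane) : ParamCircle → Plane :=
  fun x => ‖weakDeriv c x‖⁻¹ • weakDeriv f x

/-- The unit tangent vector `τ = ∂_s c`. -/
def tangent (c : ParamCircle → Plane) : ParamCircle → Plane :=
  arcDeriv c c

/-- The curvature vector `κ = ∂_s² c`. -/
def curvature (c : ParamCircle → Plane) : ParamCircle → Plane :=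
  arcDeriv c (arcDeriv c c)

/-- The normal arclength derivative `∂_s^⊥ φ = ∂_s φ - ⟨∂_s φ, τ⟩ τ` along the curve `c`. -/
def normalArcDeriv (c φ : ParamCircle → Plane) : ParamCircle → Plane :=
  fun x => arcDeriv c φ x - ⟪arcDeriv c φ x, tangent c x⟫ • tangent c x

/-- The elastic energy `∫ |κ|² ds + length`, where `ds = |∂_x c| dx`. -/
def elasticEnergy (c : ParamCircle → Plane) : ℝ :=
  (∫ x, ‖curvature c x‖ ^ 2 * ‖weakDeriv c x‖) + ∫ x, ‖weakDeriv c x‖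

/-! ### Sobolev spaces -/

/-- The Hilbert space `L²(S¹; ℝ²)` with respect to `dx`. -/
abbrev LTwo : Type := Lp Plane 2 (volume : Measure ParamCircle)

lemma LTwo.integrable (u : LTwo) : Integrable u :=
  (Lp.memLp u).integrable (by norm_num)

lemma HasWeakDeriv.congr {f f' g g' : ParamCircle → Plane} (h : HasWeakDeriv f g)
    (hf : f' =ᵐ[volume] f) (hg : g' =ᵐ[volume] g) : HasWeakDeriv f' g' := by
  refine ⟨h.integrable_left.congr hf.symm, h.integrable_right.congr hg.symm, ?_⟩
  intro η η' hη hη'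
  have h1 : ∫ x, η' x • f' x = ∫ x, η' x • f x :=
    integral_congr_ae (hf.mono fun x hx => by simp only [hx])
  have h2 : ∫ x, η x • g' x = ∫ x, η x • g x :=
    integral_congr_ae (hg.mono fun x hx => by simp only [hx])
  rw [h1, h2, h.integral_eq η η' hη hη']

lemma HasWeakDeriv.zero : HasWeakDeriv 0 0 :=
  ⟨integrable_zero _ _ _, integrable_zero _ _ _, by intros; simp⟩

lemma HasWeakDeriv.const_smul {f g : ParamCircle → Plane} (a : ℝ) (h : HasWeakDeriv f g) :
    HasWeakDeriv (a • f) (a • g) := by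
  refine ⟨h.integrable_left.smul a, h.integrable_right.smul a, ?_⟩
  intro η η' hη hη'
  simp only [Pi.smul_apply, smul_comm _ a, integral_smul]
  rw [h.integral_eq η η' hη hη', smul_neg]

lemma continuous_of_continuous_coe {η : ParamCircle → ℝ}
    (hη : Continuous fun x : ℝ => η (x : ParamCircle)) : Continuous η :=
  continuous_coinduced_dom.2 hη

lemma integrable_smul_of_continuous {η : ParamCircle → ℝ} {f : ParamCircle → Plane}
    (hc : Continuous η) (hf : Integrable f) : Integrable fun x => η x • f x := by
  obtain ⟨C, hC⟩ :=
    (isCompact_univ : IsCompact (Set.univ : Set ParamCircle)).exists_bound_of_continuousOn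
      hc.continuousOn
  have hm : AEStronglyMeasurable η volume := hc.aestronglyMeasurable
  have h := hf.bdd_smul C hm (Filter.Eventually.of_forall fun x => hC x (Set.mem_univ x))
  exact h

lemma HasWeakDeriv.add {f g f' g' : ParamCircle → Plane} (h : HasWeakDeriv f g)
    (h' : HasWeakDeriv f' g') : HasWeakDeriv (f + f') (g + g') := by
  refine ⟨h.integrable_left.add h'.integrable_left, h.integrable_right.add h'.integrable_right, ?_⟩
  intro η η' hη hη'
  have hd : (fun x : ℝ => η' (x : ParamCircle)) = deriv (fun x : ℝ => η (x : ParamCircle)) :=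
    funext fun x => (hη' x).deriv.symm
  have c : Continuous η := continuous_of_continuous_coe hη.continuous
  have c' : Continuous η' := by
    apply continuous_of_continuous_coe
    rw [hd]
    exact hη.continuous_deriv (by simp)
  simp only [Pi.add_apply, smul_add]
  rw [integral_add (integrable_smul_of_continuous c' h.integrable_left)
      (integrable_smul_of_continuous c' h'.integrable_left),
    integral_add (integrable_smul_of_continuous c h.integrable_right)
      (integrable_smul_of_continuous c h'.integrable_right),
    h.integral_eq η η' hη hη', h'.integral_eq η η' hη hη', neg_add]

/-- The Sobolev space `H^m(S¹; ℝ²)`. A field `u` of class `H^m` is recorded together with its weak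
derivatives, as `(u, ∂_x u, …, ∂_x^m u)` with all entries in `L²`; since weak derivatives are
unique, the field determines the other entries. The norm inherited from the `ℓ²`-product is
`(∑_{i ≤ m} ‖∂_x^i u‖²_{L²})^{1/2}`. -/
def Sobolev (m : ℕ) : Submodule ℝ (PiLp 2 (fun _ : Fin (m + 1) => LTwo)) where
  carrier := {u | ∀ i : Fin m, HasWeakDeriv (u i.castSucc) (u i.succ)}
  zero_mem' := fun _ => HasWeakDeriv.zero.congr
    (Lp.coeFn_zero Plane 2 volume) (Lp.coeFn_zero Plane 2 volume)
  add_mem' := fun {u v} hu hv i => ((hu i).add (hv i)).congr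
    (Lp.coeFn_add (u i.castSucc) (v i.castSucc)) (Lp.coeFn_add (u i.succ) (v i.succ))
  smul_mem' := fun a u hu i => ((hu i).const_smul a).congr
    (Lp.coeFn_smul a (u i.castSucc)) (Lp.coeFn_smul a (u i.succ))

/-- The continuous inclusion `H^m → L²`, which forgets the derivatives. -/
def Sobolev.toLTwo (m : ℕ) : Sobolev m →L[ℝ] LTwo :=
  (PiLp.proj 2 (fun _ : Fin (m + 1) => LTwo) (0 : Fin (m + 1))).comp (Sobolev m).subtypeL

/-- `L^{2,⊥}_γ`: the square integrable fields that are normal along `γ` almost everywhere. -/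
def LTwoNormal (γ : ParamCircle → Plane) : Submodule ℝ LTwo where
  carrier := {u | ∀ᵐ x, ⟪u x, tangent γ x⟫ = 0}
  zero_mem' := by
    change ∀ᵐ x, ⟪(0 : LTwo) x, tangent γ x⟫ = 0
    filter_upwards [Lp.coeFn_zero Plane 2 (volume : Measure ParamCircle)] with x hx
    rw [hx]; simp
  add_mem' := by
    intro u v hu hv
    change ∀ᵐ x, ⟪(u + v : LTwo) x, tangent γ x⟫ = 0
    filter_upwards [Lp.coeFn_add u v, hu, hv] with x hx h1 h2
    rw [hx, Pi.add_apply, inner_add_left, h1, h2, add_zero]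
  smul_mem' := by
    intro a u hu
    change ∀ᵐ x, ⟪(a • u : LTwo) x, tangent γ x⟫ = 0
    filter_upwards [Lp.coeFn_smul a u, hu] with x hx h1
    rw [hx, Pi.smul_apply, real_inner_smul_left, h1, mul_zero]

/-- `H^{m,⊥}_γ`: the fields of class `H^m` that are normal along `γ` almost everywhere. -/
def SobolevNormal (γ : ParamCircle → Plane) (m : ℕ) : Submodule ℝ (Sobolev m) :=
  (LTwoNormal γ).comap (Sobolev.toLTwo m).toLinearMap

/-- The continuous inclusion `H^{m,⊥}_γ → L^{2,⊥}_γ`. -/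
def SobolevNormal.incl (γ : ParamCircle → Plane) (m : ℕ) :
    SobolevNormal γ m →L[ℝ] LTwoNormal γ :=
  ((Sobolev.toLTwo m).comp (SobolevNormal γ m).subtypeL).codRestrict (LTwoNormal γ)
    (fun u => u.2)

/-! ### The energy near a curve -/

/-- `ρ` is so small that for every field `ψ` of class `H⁴` with `‖ψ‖_{H⁴} ≤ ρ` the curve `γ + ψ`
is regular (that is, its continuously differentiable representative is). -/
def IsAdmissibleRadius (γ : ParamCircle → Plane) (ρ : ℝ) : Prop :=
  ∀ ψ : Sobolev 4, ‖ψ‖ ≤ ρ →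
    ∃ c : ParamCircle → Plane, IsRegularCurve 1 c ∧
      ∀ᵐ x, c x = γ x + Sobolev.toLTwo 4 ψ x

/-- `E(ψ) = 𝓔(γ + ψ)` for `ψ ∈ H^{4,⊥}_γ`. -/
def normalEnergy (γ : ParamCircle → Plane) (ψ : SobolevNormal γ 4) : ℝ :=
  elasticEnergy (fun x => γ x + (SobolevNormal.incl γ 4 ψ : LTwo) x)

/-- The functional `ℓ ∈ (L^{2,⊥}_γ)*` is the first variation `δE(ψ)`: on every `φ ∈ H^{4,⊥}_γ`
it is the derivative of `ε ↦ E(ψ + ε φ)` at `0`. As `H^{4,⊥}_γ` is dense in `L^{2,⊥}_γ`, there is at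
most one such `ℓ`. -/
def IsFirstVariation (γ : ParamCircle → Plane) (ψ : SobolevNormal γ 4)
    (l : StrongDual ℝ (LTwoNormal γ)) : Prop :=
  ∀ φ : SobolevNormal γ 4,
    HasDerivAt (fun ε : ℝ => normalEnergy γ (ψ + ε • φ)) (l (SobolevNormal.incl γ 4 φ)) 0

/-- The operator `D : H^{4,⊥}_γ → (L^{2,⊥}_γ)*` is the second variation `δ²E(0)`: for
`φ, ζ ∈ H^{4,⊥}_γ` the number `D φ ζ` is `d/dη d/dε E(ε φ + η ζ)` at `ε = 0`, `η = 0`. By density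
there is at most one such `D`. -/
def IsSecondVariationAtZero (γ : ParamCircle → Plane)
    (D : SobolevNormal γ 4 →L[ℝ] StrongDual ℝ (LTwoNormal γ)) : Prop :=
  ∀ φ ζ : SobolevNormal γ 4,
    (∀ᶠ η : ℝ in nhds 0,
      DifferentiableAt ℝ (fun ε : ℝ => normalEnergy γ (ε • φ + η • ζ)) 0) ∧
    HasDerivAt (fun η : ℝ => deriv (fun ε : ℝ => normalEnergy γ (ε • φ + η • ζ)) 0)
      (D φ (SobolevNormal.incl γ 4 ζ)) 0

/-- A bounded operator is Fredholm of index zero: it is Fredholm, and the (finite) dimension of its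
kernel equals the (finite) codimension of its range. -/
def IsFredholmIndexZero {V W : Type*} [AddCommGroup V] [Module ℝ V]
    [TopologicalSpace V] [AddCommGroup W] [Module ℝ W] [TopologicalSpace W] (T : V →L[ℝ] W) : Prop :=
  T.IsFredholm ∧ FiniteDimensional ℝ T.ker ∧ FiniteDimensional ℝ (W ⧸ T.range) ∧
    Module.finrank ℝ T.ker = Module.finrank ℝ (W ⧸ T.range)

end ElasticCurve

end

/-! Everything is reduced to scalar functions and the Banach algebra of continuous functions on the
circle. A weak derivative is the same as having a representative that is a primitive
(`HasWeakDeriv.exists_hasPrim`, `HasWeakDeriv.of_hasPrim`). So a field in H⁴ has continuous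
derivatives up to order three (`jet`), and each of these depends compactly on the field
(`isCompactOperator_jet`, by Arzelà-Ascoli). Only the fourth derivative is merely square integrable.

Analyticity: the energy density is a polynomial in the derivatives of order one and two and in the
inverse speed r = |c'|⁻¹ (`elasticEnergy_eq`). The map q ↦ q^(-1/2) is analytic on positive
continuous functions by the binomial series (`analyticAt_invSqrt`), so E is analytic. Two
integrations by parts write δE as the L²-pairing with a gradient (`integral_densityDiff`). In it the
fourth derivatives occur linearly, with coefficients analytic in the lower ones, so δE is analytic
as well.

Invertibility of id + (∂_s^⊥)⁴: a normal field in the plane is f·n with a scalar f. Since n' is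
tangential, ∂_s^⊥(f·n) = (∂_s f)·n (`normalArcDeriv_of_hasPrim`), so the operator becomes f ↦ f +
∂_s⁴f. It is injective, because ∂_s⁴f = -f gives ∫ f² + (∂_s²f)² ds = 0. It is a compact
perturbation of f ↦ mean(f) + ∂_s⁴f, which is inverted by integrating four times, so the Fredholm
alternative makes it bijective (`idAddFour_bijective`).

Index zero: linearizing the gradient at γ, all terms except those with fourth derivatives factor
through the lower derivatives and are compact. The leading term is that of 2(∂_s^⊥)⁴ paired with
respect to ds (`normalDual_normalPrincipal`). Hence δ²E(0) is an isomorphism built from id +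
(∂_s^⊥)⁴ and the Riesz map, plus a compact operator, and `isFredholmIndexZero_add_compact` applies.
-/

noncomputable section

namespace ElasticCurve

/-! ### Absolutely continuous functions on the circle -/

/-- `f` is a primitive of the integrable function `g` on the circle. -/
structure HasPrim (f g : ParamCircle → ℝ) : Prop where
  integrable : Integrable g
  sub_eq : ∀ x y : ℝ, f (y : ParamCircle) - f (x : ParamCircle) = ∫ t in x..y, g (t : ParamCircle)

lemma coe_add_two_pi (x : ℝ) : ((x + 2 * Real.pi : ℝ) : ParamCircle) = (x : ParamCircle) := by
  simp

lemma integral_circle {E : Type*} [NormedAddCommGroup E] [NormedSpace ℝ E] (f : ParamCircle → E)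
    (t : ℝ) : ∫ x, f x = ∫ x in t..t + 2 * Real.pi, f (x : ParamCircle) :=
  (AddCircle.intervalIntegral_preimage (2 * Real.pi) t f).symm

lemma intervalIntegrable_coe {E : Type*} [NormedAddCommGroup E] {g : ParamCircle → E}
    (hg : Integrable g) (a b : ℝ) :
    IntervalIntegrable (fun t : ℝ => g (t : ParamCircle)) volume a b := by
  refine Function.Periodic.intervalIntegrable (T := 2 * Real.pi) (t := 0)
    (fun x => by rw [coe_add_two_pi]) (by positivity) ?_ a b
  rw [intervalIntegrable_iff_integrableOn_Ioc_of_le (by positivity)]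
  exact ((AddCircle.measurePreserving_mk (2 * Real.pi) 0).integrable_comp
    hg.aestronglyMeasurable).2 hg

/-- The line is a countable union of half-open periods, each mapped to the circle preserving
measure. -/
lemma ae_coe_of_ae {p : ParamCircle → Prop} (h : ∀ᵐ x, p x) : ∀ᵐ t : ℝ, p (t : ParamCircle) := by
  have key : ∀ n : ℤ, ∀ᵐ t : ℝ ∂(volume.restrict (Set.Ioc (n * (2 * Real.pi)) (n * (2 * Real.pi)
      + 2 * Real.pi))), p (t : ParamCircle) := fun n =>
    (AddCircle.measurePreserving_mk (2 * Real.pi) (n * (2 * Real.pi))).quasiMeasurePreserving.ae h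
  have hU : (⋃ n : ℤ, Set.Ioc (n * (2 * Real.pi)) (n * (2 * Real.pi) + 2 * Real.pi))
      = Set.univ := by
    have := iUnion_Ioc_zsmul Real.two_pi_pos
    simpa [add_mul] using this
  rw [← Measure.restrict_univ (μ := (volume : Measure ℝ)), ← hU, ae_restrict_iUnion_iff]
  exact key

/-- The period (0, 2π] is a measurable copy of the circle and its endpoint is null. The open
interval is the convenient form, since compactly supported bump functions live there. -/
lemma ae_of_ae_coe_Ioo {p : ParamCircle → Prop}
    (h : ∀ᵐ t : ℝ, t ∈ Set.Ioo 0 (2 * Real.pi) → p (t : ParamCircle)) : ∀ᵐ x, p x := by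
  have h1 : ∀ᵐ t : ℝ ∂(volume.restrict (Set.Ioc 0 (0 + 2 * Real.pi))), p (t : ParamCircle) := by
    rw [zero_add, ← Measure.restrict_congr_set Ioo_ae_eq_Ioc]
    exact (ae_restrict_iff' measurableSet_Ioo).2 h
  have h2 := (AddCircle.measurePreserving_mk (2 * Real.pi) 0)
  have hm := (AddCircle.measurableEquivIoc (2 * Real.pi) 0).symm.measurableEmbedding
  rw [← h2.map_eq]
  have hind : MeasurableEmbedding (Subtype.val : Set.Ioc (0:ℝ) (0 + 2 * Real.pi) → ℝ) :=
    MeasurableEmbedding.subtype_coe measurableSet_Ioc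
  rw [← map_comap_subtype_coe measurableSet_Ioc,
    Measure.map_map AddCircle.measurable_mk' measurable_subtype_coe]
  have : ((fun x : ℝ => (x : ParamCircle)) ∘ Subtype.val : Set.Ioc (0:ℝ) (0 + 2 * Real.pi) → _)
    = (AddCircle.measurableEquivIoc (2 * Real.pi) 0).symm := rfl
  erw [this, hm.ae_map_iff]
  rw [← map_comap_subtype_coe measurableSet_Ioc, hind.ae_map_iff] at h1
  exact h1

/-! ### Calculus of primitives on the circle -/

namespace HasPrim

variable {f g f' g' : ParamCircle → ℝ}

lemma congr_right (h : HasPrim f g) (hg : g' =ᵐ[volume] g) : HasPrim f g' :=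
  ⟨h.integrable.congr hg.symm, fun x y => by
    rw [h.sub_eq]
    refine intervalIntegral.integral_congr_ae ?_
    filter_upwards [ae_coe_of_ae hg] with t ht _ using ht.symm⟩

lemma absolutelyContinuous (h : HasPrim f g) (a b : ℝ) :
    AbsolutelyContinuousOnInterval (fun t : ℝ => f (t : ParamCircle)) a b := by
  have h1 := (intervalIntegrable_coe h.integrable a b).absolutelyContinuousOnInterval_intervalIntegral
    (c := a) (by simp)
  have h2 : AbsolutelyContinuousOnInterval (fun _ : ℝ => f (a : ParamCircle)) a b :=
    (contDiff_const (n := 1)).contDiffOn.absolutelyContinuousOnInterval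
  have h3 : (fun t : ℝ => f (t : ParamCircle))
      = (fun _ => f (a : ParamCircle)) + fun t : ℝ => ∫ v in a..t, g (v : ParamCircle) := by
    funext t
    rw [Pi.add_apply, ← h.sub_eq]
    ring
  rw [h3]
  exact h2.add h1

lemma ae_hasDerivAt (h : HasPrim f g) :
    ∀ᵐ t : ℝ, HasDerivAt (fun t : ℝ => f (t : ParamCircle)) (g (t : ParamCircle)) t := by
  have h1 : LocallyIntegrable (fun t : ℝ => g (t : ParamCircle)) volume := by
    intro x
    refine ⟨Set.Icc (x - 1) (x + 1), Icc_mem_nhds (by linarith) (by linarith), ?_⟩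
    rw [integrableOn_Icc_iff_integrableOn_Ioc,
      ← intervalIntegrable_iff_integrableOn_Ioc_of_le (by linarith)]
    exact intervalIntegrable_coe h.integrable _ _
  filter_upwards [LocallyIntegrable.ae_hasDerivAt_integral h1] with t ht
  have h2 := (ht 0).const_add (f (0 : ℝ))
  refine h2.congr_of_eventuallyEq (Filter.Eventually.of_forall fun y => ?_)
  simp only [← h.sub_eq]
  ring

/-- There are no boundary terms on a circle. Integrations by parts below apply this to a product of
primitives. -/
lemma integral_eq_zero (h : HasPrim f g) : ∫ x, g x = 0 := by
  rw [integral_circle _ 0, ← h.sub_eq, coe_add_two_pi, sub_self]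

lemma continuous (h : HasPrim f g) : Continuous f := by
  refine continuous_coinduced_dom.2 ?_
  change Continuous fun x : ℝ => f (x : ParamCircle)
  have h1 := intervalIntegral.continuous_primitive (fun a b => intervalIntegrable_coe h.integrable a b) 0
  have h3 : (fun t : ℝ => f (t : ParamCircle))
      = fun t : ℝ => f ((0 : ℝ) : ParamCircle) + ∫ v in (0 : ℝ)..t, g (v : ParamCircle) := by
    funext t
    rw [← h.sub_eq]
    ring
  rw [h3]
  exact h1.const_add _

lemma exists_bound {f : ParamCircle → ℝ} (h : Continuous f) : ∃ C, ∀ x, ‖f x‖ ≤ C := by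
  obtain ⟨C, hC⟩ :=
    (isCompact_univ : IsCompact (Set.univ : Set ParamCircle)).exists_bound_of_continuousOn
      h.continuousOn
  exact ⟨C, fun x => hC x (Set.mem_univ x)⟩

lemma integrable_mul (hf : Continuous f) (hg : Integrable g) :
    Integrable fun x => f x * g x := by
  obtain ⟨C, hC⟩ := exists_bound hf
  exact hg.bdd_mul (c := C) hf.aestronglyMeasurable (Filter.Eventually.of_forall hC)

/-- Both factors are absolutely continuous, so the product rule, valid almost everywhere, integrates
back to the product even though the derivatives are only integrable. -/
lemma mul (h : HasPrim f g) (h' : HasPrim f' g') :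
    HasPrim (fun x => f x * f' x) (fun x => g x * f' x + f x * g' x) := by
  refine ⟨?_, fun x y => ?_⟩
  · have h1 := integrable_mul h'.continuous h.integrable
    simp only [mul_comm (f' _)] at h1
    exact h1.add (integrable_mul h.continuous h'.integrable)
  · rw [← (h.absolutelyContinuous x y).integral_deriv_mul_eq_sub (h'.absolutelyContinuous x y)]
    refine intervalIntegral.integral_congr_ae ?_
    filter_upwards [h.ae_hasDerivAt, h'.ae_hasDerivAt] with t ht ht' _
    rw [ht.deriv, ht'.deriv]

lemma add (h : HasPrim f g) (h' : HasPrim f' g') :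
    HasPrim (fun x => f x + f' x) (fun x => g x + g' x) := by
  refine ⟨h.integrable.add h'.integrable, fun x y => ?_⟩
  rw [intervalIntegral.integral_add (intervalIntegrable_coe h.integrable _ _)
    (intervalIntegrable_coe h'.integrable _ _), ← h.sub_eq, ← h'.sub_eq]
  ring

lemma const (c : ℝ) : HasPrim (fun _ => c) (fun _ => 0) :=
  ⟨integrable_zero _ _ _, fun x y => by simp⟩

lemma const_mul (c : ℝ) (h : HasPrim f g) : HasPrim (fun x => c * f x) (fun x => c * g x) := by
  simpa using (const c).mul h

lemma neg (h : HasPrim f g) : HasPrim (fun x => - f x) (fun x => - g x) := by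
  simpa using h.const_mul (-1)

lemma sub (h : HasPrim f g) (h' : HasPrim f' g') :
    HasPrim (fun x => f x - f' x) (fun x => g x - g' x) := by
  simpa [sub_eq_add_neg] using h.add h'.neg

lemma sum {ι : Type*} (s : Finset ι) {f g : ι → ParamCircle → ℝ}
    (h : ∀ i ∈ s, HasPrim (f i) (g i)) :
    HasPrim (fun x => ∑ i ∈ s, f i x) (fun x => ∑ i ∈ s, g i x) := by
  classical
  induction s using Finset.induction_on with
  | empty => simpa using const 0
  | insert i s hi ih =>
    simp only [Finset.sum_insert hi]
    exact (h i (by simp)).add (ih fun j hj => h j (by simp [hj]))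

lemma of_hasDerivAt (hg : Continuous g)
    (h : ∀ x : ℝ, HasDerivAt (fun t : ℝ => f (t : ParamCircle)) (g (x : ParamCircle)) x) :
    HasPrim f g := by
  have hc : Continuous fun t : ℝ => g (t : ParamCircle) :=
    hg.comp (AddCircle.continuous_mk' _)
  refine ⟨(hg.integrable_of_hasCompactSupport (HasCompactSupport.of_compactSpace _)),
    fun x y => ?_⟩
  exact (intervalIntegral.integral_eq_sub_of_hasDerivAt (fun t _ => h t)
    (hc.intervalIntegrable _ _)).symm

lemma hasDerivAt (h : HasPrim f g) (hg : Continuous g) (x : ℝ) :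
    HasDerivAt (fun t : ℝ => f (t : ParamCircle)) (g (x : ParamCircle)) x := by
  have hc : Continuous fun t : ℝ => g (t : ParamCircle) :=
    hg.comp (AddCircle.continuous_mk' _)
  have h2 := (intervalIntegral.integral_hasDerivAt_right (hc.intervalIntegrable 0 x)
    (hc.stronglyMeasurableAtFilter _ _) hc.continuousAt).const_add (f (0 : ℝ))
  refine h2.congr_of_eventuallyEq (Filter.Eventually.of_forall fun y => ?_)
  simp only [← h.sub_eq]
  ring

lemma eq_of_zero (h : HasPrim f fun _ => 0) (x y : ParamCircle) : f x = f y := by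
  induction x using QuotientAddGroup.induction_on with | H x =>
  induction y using QuotientAddGroup.induction_on with | H y =>
  have := h.sub_eq y x
  simp only [intervalIntegral.integral_zero] at this
  linarith

/-- A primitive exists as soon as the integral over the circle vanishes. -/
lemma exists_of_integral_eq_zero (hg : Integrable g) (h : ∫ x, g x = 0) : ∃ f, HasPrim f g := by
  -- Over one period the primitive grows by the total integral, which is zero, so it descends to the
  -- circle.
  have hp : Function.Periodic (fun x : ℝ => ∫ t in (0 : ℝ)..x, g (t : ParamCircle))
      (2 * Real.pi) := by
    intro x
    have h1 := intervalIntegral.integral_add_adjacent_intervals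
      (intervalIntegrable_coe hg 0 x) (intervalIntegrable_coe hg x (x + 2 * Real.pi))
    have h2 := integral_circle g x
    simp only
    rw [← h1, ← h2, h, add_zero]
  refine ⟨hp.lift, hg, fun x y => ?_⟩
  have h1 := intervalIntegral.integral_add_adjacent_intervals
      (intervalIntegrable_coe hg 0 x) (intervalIntegrable_coe hg x y)
  rw [Function.Periodic.lift_coe, Function.Periodic.lift_coe]
  linarith

end HasPrim

end ElasticCurve

end

noncomputable section

namespace ElasticCurve

/-! ### Uniqueness of weak derivatives -/

/-- A bump function supported inside (0, 2π) descends to a continuous function on the circle, so the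
fundamental lemma of the calculus of variations on the interval applies. -/
lemma ae_eq_zero_of_forall_continuous {k : ParamCircle → ℝ} (hk : Integrable k)
    (h : ∀ η : ParamCircle → ℝ, Continuous η → ∫ x, η x * k x = 0) : k =ᵐ[volume] 0 := by
  refine ae_of_ae_coe_Ioo (p := fun x => k x = (0 : ParamCircle → ℝ) x) ?_
  have hloc : LocallyIntegrableOn (fun t : ℝ => k (t : ParamCircle))
      (Set.Ioo 0 (2 * Real.pi)) volume := by
    have h1 := intervalIntegrable_coe hk 0 (2 * Real.pi)
    rw [intervalIntegrable_iff_integrableOn_Ioo_of_le (by positivity)] at h1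
    exact h1.locallyIntegrableOn
  refine isOpen_Ioo.ae_eq_zero_of_integral_contDiff_smul_eq_zero hloc fun θ hθ hc hs => ?_
  have h0 : ∀ t, t ∉ Set.Ioo 0 (2 * Real.pi) → θ t = 0 := fun t ht =>
    image_eq_zero_of_notMem_tsupport fun h' => ht (hs h')
  have hη := AddCircle.liftIco_continuous (p := 2 * Real.pi) (a := 0) (f := θ)
    (by rw [h0 0 (by simp), h0 _ (by simp)]) hθ.continuous.continuousOn
  have h1 := h _ hη
  rw [integral_circle _ 0, intervalIntegral.integral_of_le (by simp; positivity),
    ← Measure.restrict_congr_set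
      (Ioo_ae_eq_Ioc (μ := (volume : Measure ℝ)) (a := 0) (b := 0 + 2 * Real.pi))] at h1
  rw [← setIntegral_eq_integral_of_forall_compl_eq_zero (s := Set.Ioo 0 (2 * Real.pi))
    (fun t ht => by rw [h0 t ht, zero_smul])]
  refine Eq.trans ?_ h1
  rw [zero_add]
  refine setIntegral_congr_fun measurableSet_Ioo fun t ht => ?_
  simp only [smul_eq_mul]
  rw [AddCircle.liftIco_coe_apply (by rw [zero_add]; exact ⟨ht.1.le, ht.2⟩)]

/-- The functional θ ↦ ∫ θ k is bounded for the sup norm, so its kernel is closed. The kernel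
contains every exponential, and these span a dense subspace of the continuous functions. -/
lemma ae_eq_zero_of_forall_fourier {k : ParamCircle → ℝ} (hk : Integrable k)
    (hre : ∀ n : ℤ, ∫ x, (fourier n x : ℂ).re * k x = 0)
    (him : ∀ n : ℤ, ∫ x, (fourier n x : ℂ).im * k x = 0) : k =ᵐ[volume] 0 := by
  have hkc : Integrable fun x => (k x : ℂ) := hk.ofReal
  have hint : ∀ θ : C(ParamCircle, ℂ), Integrable fun x => θ x * (k x : ℂ) := fun θ =>
    hkc.bdd_mul (c := ‖θ‖) θ.continuous.aestronglyMeasurable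
      (Filter.Eventually.of_forall fun x => θ.norm_coe_le_norm x)
  let Φ : C(ParamCircle, ℂ) →L[ℂ] ℂ := LinearMap.mkContinuous
    { toFun := fun θ => ∫ x, θ x * (k x : ℂ)
      map_add' := fun θ θ' => by
        simp only [ContinuousMap.add_apply, add_mul]
        exact integral_add (hint θ) (hint θ')
      map_smul' := fun c θ => by
        simp only [ContinuousMap.smul_apply, smul_eq_mul, mul_assoc, RingHom.id_apply]
        exact integral_const_mul c _ }
    (∫ x, ‖k x‖) (fun θ => by
      refine (norm_integral_le_integral_norm _).trans ?_
      simp only [norm_mul, Complex.norm_real]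
      rw [mul_comm (∫ x, ‖k x‖) ‖θ‖, ← integral_const_mul]
      refine integral_mono_of_nonneg (Filter.Eventually.of_forall fun x => by positivity)
        (hk.norm.const_mul _) (Filter.Eventually.of_forall fun x => ?_)
      exact mul_le_mul_of_nonneg_right (θ.norm_coe_le_norm x) (norm_nonneg _))
  have hΦ : ∀ θ, Φ θ = ∫ x, θ x * (k x : ℂ) := fun θ => rfl
  have hzero : Φ = 0 := by
    have hle : Submodule.span ℂ (Set.range (@fourier (2 * Real.pi))) ≤ LinearMap.ker Φ.toLinearMap := by
      rw [Submodule.span_le]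
      rintro _ ⟨n, rfl⟩
      change Φ (fourier n) = 0
      rw [hΦ]
      have h1 := integral_re (𝕜 := ℂ) (hint (fourier n))
      have h2 := integral_im (𝕜 := ℂ) (hint (fourier n))
      simp only [RCLike.re_eq_complex_re, Complex.re_mul_ofReal, hre n] at h1
      simp only [RCLike.im_eq_complex_im, Complex.im_mul_ofReal, him n] at h2
      exact Complex.ext h1.symm h2.symm
    have hcl : (Submodule.span ℂ (Set.range (@fourier (2 * Real.pi)))).topologicalClosure
        ≤ LinearMap.ker Φ.toLinearMap :=
      Submodule.topologicalClosure_minimal _ hle Φ.isClosed_ker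
    rw [span_fourier_closure_eq_top] at hcl
    ext1 θ
    exact hcl (Submodule.mem_top : θ ∈ ⊤)
  refine ae_eq_zero_of_forall_continuous hk fun η hη => ?_
  have h1 : Φ ⟨fun x => (η x : ℂ), Complex.continuous_ofReal.comp hη⟩ = 0 := by
    rw [hzero]; rfl
  rw [hΦ] at h1
  simp only [ContinuousMap.coe_mk, ← Complex.ofReal_mul] at h1
  rw [integral_complex_ofReal] at h1
  exact_mod_cast h1

lemma hasDerivAt_fourier_circle (n : ℤ) (x : ℝ) :
    HasDerivAt (fun y : ℝ => fourier n (y : ParamCircle))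
      (Complex.I * n * fourier n (x : ParamCircle)) x := by
  have h := hasDerivAt_fourier (2 * Real.pi) n x
  have h2 : (2 * Real.pi * Complex.I * n / ((2 * Real.pi : ℝ) : ℂ)) = Complex.I * n := by
    have : (Real.pi : ℂ) ≠ 0 := by exact_mod_cast Real.pi_ne_zero
    push_cast
    field_simp
  rwa [h2] at h

lemma contDiff_fourier (n : ℤ) :
    ContDiff ℝ ∞ (fun x : ℝ => (fourier n (x : ParamCircle) : ℂ)) := by
  simp only [fourier_coe_apply]
  refine ContDiff.cexp ?_
  refine ContDiff.div_const ?_ _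
  exact contDiff_const.mul Complex.ofRealCLM.contDiff

/-- The lemma of du Bois-Reymond on the circle. -/
lemma ae_eq_const_of_forall_deriv {k : ParamCircle → ℝ} (hk : Integrable k)
    (h : ∀ η η' : ParamCircle → ℝ, ContDiff ℝ ∞ (fun x : ℝ => η (x : ParamCircle)) →
      (∀ x : ℝ, HasDerivAt (fun y : ℝ => η (y : ParamCircle)) (η' (x : ParamCircle)) x) →
      ∫ x, η' x * k x = 0) : ∃ c : ℝ, k =ᵐ[volume] fun _ => c := by
  set c : ℝ := (∫ x, k x) / (2 * Real.pi) with hc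
  have hvol : (volume : Measure ParamCircle).real Set.univ = 2 * Real.pi := by
    rw [measureReal_def, AddCircle.measure_univ, ENNReal.toReal_ofReal (by positivity)]
  -- For n ≠ 0, cos(nx) is the derivative of the test function sin(nx)/n, so the hypothesis kills
  -- this frequency of k. Adding a constant to k does not matter because cos(nx) has integral zero.
  have hre : ∀ n : ℤ, n ≠ 0 → ∀ a : ℝ, ∫ x, (fourier n x : ℂ).re * (k x + a) = 0 := by
    intro n hn a
    have hn' : (n : ℝ) ≠ 0 := by exact_mod_cast hn
    have hs : ContDiff ℝ ∞ (fun x : ℝ => (fourier n (x : ParamCircle) : ℂ).im / n) :=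
      (Complex.imCLM.contDiff.comp (contDiff_fourier n)).div_const _
    have hd : ∀ x : ℝ, HasDerivAt (fun y : ℝ => (fourier n (y : ParamCircle) : ℂ).im / n)
        ((fourier n (x : ParamCircle) : ℂ).re) x := by
      intro x
      have h1 := (Complex.imCLM.hasFDerivAt.comp_hasDerivAt x
        (hasDerivAt_fourier_circle n x)).div_const (n : ℝ)
      refine h1.congr_deriv ?_
      simp
      field_simp
    have h1 := h (fun x => (fourier n x : ℂ).im / n) (fun x => (fourier n x : ℂ).re) hs hd
    have hcont : Continuous fun x : ParamCircle => (fourier n x : ℂ).re :=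
      Complex.continuous_re.comp (fourier n).continuous
    have h2 := (HasPrim.of_hasDerivAt (f := fun x => (fourier n x : ℂ).im / n) hcont hd).integral_eq_zero
    simp only [mul_add]
    rw [integral_add (HasPrim.integrable_mul hcont hk)
      (HasPrim.integrable_mul hcont (integrable_const a)), h1, integral_mul_const, h2]
    simp
  have him : ∀ n : ℤ, n ≠ 0 → ∀ a : ℝ, ∫ x, (fourier n x : ℂ).im * (k x + a) = 0 := by
    intro n hn a
    have hn' : (n : ℝ) ≠ 0 := by exact_mod_cast hn
    have hs : ContDiff ℝ ∞ (fun x : ℝ => (fourier n (x : ParamCircle) : ℂ).re / (-n)) :=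
      (Complex.reCLM.contDiff.comp (contDiff_fourier n)).div_const _
    have hd : ∀ x : ℝ, HasDerivAt (fun y : ℝ => (fourier n (y : ParamCircle) : ℂ).re / (-n))
        ((fourier n (x : ParamCircle) : ℂ).im) x := by
      intro x
      have h1 := (Complex.reCLM.hasFDerivAt.comp_hasDerivAt x
        (hasDerivAt_fourier_circle n x)).div_const (-n : ℝ)
      refine h1.congr_deriv ?_
      simp
      field_simp
    have h1 := h (fun x => (fourier n x : ℂ).re / (-n)) (fun x => (fourier n x : ℂ).im) hs hd
    have hcont : Continuous fun x : ParamCircle => (fourier n x : ℂ).im :=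
      Complex.continuous_im.comp (fourier n).continuous
    have h2 := (HasPrim.of_hasDerivAt (f := fun x => (fourier n x : ℂ).re / (-n)) hcont hd).integral_eq_zero
    simp only [mul_add]
    rw [integral_add (HasPrim.integrable_mul hcont hk)
      (HasPrim.integrable_mul hcont (integrable_const a)), h1, integral_mul_const, h2]
    simp
  -- Only frequency zero is left, and subtracting the mean c removes it.
  have h0 : (fun x => k x + -c) =ᵐ[volume] 0 := by
    refine ae_eq_zero_of_forall_fourier (hk.add (integrable_const (-c))) (fun n => ?_) fun n => ?_
    · rcases eq_or_ne n 0 with rfl | hn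
      · simp only [fourier_zero, Complex.one_re, one_mul]
        rw [integral_add hk (integrable_const (-c)), integral_const, hvol, hc]
        have := Real.pi_pos
        simp only [smul_eq_mul]
        field_simp
        ring
      · exact hre n hn _
    · rcases eq_or_ne n 0 with rfl | hn
      · simp
      · exact him n hn _
  refine ⟨c, h0.mono fun x hx => ?_⟩
  simp only [Pi.zero_apply] at hx
  linarith

/-! ### Weak derivatives and primitives -/

/-- A weak derivative in the scalar sense, coordinate by coordinate. -/
lemma HasWeakDeriv.integral_coord {f g : ParamCircle → Plane} (h : HasWeakDeriv f g) (i : Fin 2)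
    (η η' : ParamCircle → ℝ) (hη : ContDiff ℝ ∞ (fun x : ℝ => η (x : ParamCircle)))
    (hη' : ∀ x : ℝ, HasDerivAt (fun y : ℝ => η (y : ParamCircle)) (η' (x : ParamCircle)) x) :
    ∫ x, η' x * f x i = - ∫ x, η x * g x i := by
  have hd : (fun x : ℝ => η' (x : ParamCircle)) = deriv (fun x : ℝ => η (x : ParamCircle)) :=
    funext fun x => (hη' x).deriv.symm
  have c : Continuous η := continuous_of_continuous_coe hη.continuous
  have c' : Continuous η' := by
    apply continuous_of_continuous_coe
    rw [hd]
    exact hη.continuous_deriv (by simp)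
  have h1 := h.integral_eq η η' hη hη'
  have h2 := congrArg (EuclideanSpace.proj (𝕜 := ℝ) i) h1
  rw [map_neg, ← ContinuousLinearMap.integral_comp_comm _
      (integrable_smul_of_continuous c' h.integrable_left),
    ← ContinuousLinearMap.integral_comp_comm _
      (integrable_smul_of_continuous c h.integrable_right)] at h2
  simpa using h2

lemma integrable_coord {f : ParamCircle → Plane} (h : Integrable f) (i : Fin 2) :
    Integrable fun x => f x i :=
  (EuclideanSpace.proj (𝕜 := ℝ) i).integrable_comp h

lemma integrable_of_coord {f : ParamCircle → Plane} (h : ∀ i, Integrable fun x => f x i) :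
    Integrable f := by
  have h1 : Integrable fun x => ∑ i, (f x i) • (EuclideanSpace.single i (1 : ℝ) : Plane) :=
    integrable_finsetSum _ fun i _ => (h i).smul_const _
  refine h1.congr (Filter.Eventually.of_forall fun x => ?_)
  ext j
  fin_cases j <;> simp

/-- A function with a weak derivative has a representative which is a primitive of it. -/
lemma HasWeakDeriv.exists_hasPrim {f g : ParamCircle → Plane} (h : HasWeakDeriv f g) :
    ∃ F : ParamCircle → Plane, F =ᵐ[volume] f ∧
      ∀ i, HasPrim (fun x => F x i) fun x => g x i := by
  have key : ∀ i : Fin 2, ∃ F : ParamCircle → ℝ, F =ᵐ[volume] (fun x => f x i) ∧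
      HasPrim F fun x => g x i := by
    intro i
    have hgi := integrable_coord h.integrable_right i
    have h0 : ∫ x, g x i = 0 := by
      have := h.integral_coord i (fun _ => 1) (fun _ => 0) contDiff_const
        (fun x => hasDerivAt_const x 1)
      simpa using this.symm
    obtain ⟨G, hG⟩ := HasPrim.exists_of_integral_eq_zero hgi h0
    have hGi : Integrable G := by
      simpa using HasPrim.integrable_mul hG.continuous (integrable_const (1 : ℝ))
    have hfi := integrable_coord h.integrable_left i
    -- With G a primitive of the weak derivative, f - G is orthogonal to all derivatives of test
    -- functions, hence constant by du Bois-Reymond.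
    obtain ⟨c, hc⟩ := ae_eq_const_of_forall_deriv (hfi.sub hGi) (fun η η' hη hη' => by
      have hd : (fun x : ℝ => η' (x : ParamCircle)) = deriv (fun x : ℝ => η (x : ParamCircle)) :=
        funext fun x => (hη' x).deriv.symm
      have c' : Continuous η' := by
        apply continuous_of_continuous_coe
        rw [hd]
        exact hη.continuous_deriv (by simp)
      have h1 := h.integral_coord i η η' hη hη'
      have hp := HasPrim.of_hasDerivAt c' hη'
      have h2 := (hp.mul hG).integral_eq_zero
      rw [integral_add (HasPrim.integrable_mul c' hGi)
        (HasPrim.integrable_mul hp.continuous hgi)] at h2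
      simp only [Pi.sub_apply, mul_sub]
      rw [integral_sub (HasPrim.integrable_mul c' hfi) (HasPrim.integrable_mul c' hGi)]
      linarith)
    refine ⟨fun x => c + G x, hc.mono fun x hx => ?_, ?_⟩
    · simp only [Pi.sub_apply] at hx
      linarith
    · simpa using (HasPrim.const c).add hG
  choose F hF hF' using key
  refine ⟨fun x => WithLp.toLp 2 (fun i => F i x), ?_, fun i => hF' i⟩
  filter_upwards [hF 0, hF 1] with x h0 h1
  ext i
  fin_cases i
  · exact h0
  · exact h1

lemma HasWeakDeriv.of_hasPrim {f g : ParamCircle → Plane}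
    (h : ∀ i, HasPrim (fun x => f x i) fun x => g x i) : HasWeakDeriv f g := by
  have hf : Integrable f := integrable_of_coord fun i => by
    simpa using HasPrim.integrable_mul (h i).continuous (integrable_const (1 : ℝ))
  have hg : Integrable g := integrable_of_coord fun i => (h i).integrable
  refine ⟨hf, hg, fun η η' hη hη' => ?_⟩
  have hd : (fun x : ℝ => η' (x : ParamCircle)) = deriv (fun x : ℝ => η (x : ParamCircle)) :=
    funext fun x => (hη' x).deriv.symm
  have c' : Continuous η' := by
    apply continuous_of_continuous_coe
    rw [hd]
    exact hη.continuous_deriv (by simp)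
  have hp := HasPrim.of_hasDerivAt c' hη'
  ext i
  have h1 := (EuclideanSpace.proj (𝕜 := ℝ) i).integral_comp_comm
    (integrable_smul_of_continuous c' hf)
  have h2 := (EuclideanSpace.proj (𝕜 := ℝ) i).integral_comp_comm
    (integrable_smul_of_continuous hp.continuous hg)
  simp only [PiLp.proj_apply, PiLp.smul_apply, smul_eq_mul] at h1 h2
  rw [PiLp.neg_apply, ← h1, ← h2]
  have h3 := (hp.mul (h i)).integral_eq_zero
  rw [integral_add (HasPrim.integrable_mul c' (integrable_coord hf i))
    (HasPrim.integrable_mul hp.continuous (integrable_coord hg i))] at h3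
  linarith

/-- The real and imaginary parts of the exponentials are admissible test functions, and they already
separate integrable functions. -/
lemma HasWeakDeriv.unique {f g g' : ParamCircle → Plane} (h : HasWeakDeriv f g)
    (h' : HasWeakDeriv f g') : g =ᵐ[volume] g' := by
  have key : ∀ i : Fin 2, (fun x => g x i - g' x i) =ᵐ[volume] 0 := by
    intro i
    have hi := (integrable_coord h.integrable_right i).sub (integrable_coord h'.integrable_right i)
    have hz : ∀ η η' : ParamCircle → ℝ, ContDiff ℝ ∞ (fun x : ℝ => η (x : ParamCircle)) →
      (∀ x : ℝ, HasDerivAt (fun y : ℝ => η (y : ParamCircle)) (η' (x : ParamCircle)) x) →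
      ∫ x, η x * (g x i - g' x i) = 0 := by
      intro η η' hη hη'
      have c : Continuous η := continuous_of_continuous_coe hη.continuous
      have h1 := h.integral_coord i η η' hη hη'
      have h2 := h'.integral_coord i η η' hη hη'
      simp only [mul_sub]
      rw [integral_sub (HasPrim.integrable_mul c (integrable_coord h.integrable_right i))
        (HasPrim.integrable_mul c (integrable_coord h'.integrable_right i))]
      linarith
    refine ae_eq_zero_of_forall_fourier hi (fun n => ?_) fun n => ?_
    · exact hz _ (fun x => (Complex.I * n * fourier n x).re)
        (Complex.reCLM.contDiff.comp (contDiff_fourier n))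
        fun x => Complex.reCLM.hasFDerivAt.comp_hasDerivAt x (hasDerivAt_fourier_circle n x)
    · exact hz _ (fun x => (Complex.I * n * fourier n x).im)
        (Complex.imCLM.contDiff.comp (contDiff_fourier n))
        fun x => Complex.imCLM.hasFDerivAt.comp_hasDerivAt x (hasDerivAt_fourier_circle n x)
  filter_upwards [key 0, key 1] with x h0 h1
  ext i
  fin_cases i
  · simpa [sub_eq_zero] using h0
  · simpa [sub_eq_zero] using h1

lemma HasWeakDeriv.weakDeriv_eq {f g : ParamCircle → Plane} (h : HasWeakDeriv f g) :
    weakDeriv f =ᵐ[volume] g := by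
  have hex : ∃ g, HasWeakDeriv f g := ⟨g, h⟩
  rw [weakDeriv, dif_pos hex]
  exact hex.choose_spec.unique h

/-- The functions chosen in `weakDeriv` need not agree everywhere. Uniqueness makes them agree
almost everywhere, and both are the default 0 if no weak derivative exists. -/
lemma weakDeriv_congr {f f' : ParamCircle → Plane} (h : f =ᵐ[volume] f') :
    weakDeriv f =ᵐ[volume] weakDeriv f' := by
  by_cases hex : ∃ g, HasWeakDeriv f g
  · obtain ⟨g, hg⟩ := hex
    exact hg.weakDeriv_eq.trans (hg.congr h.symm (ae_eq_refl g)).weakDeriv_eq.symm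
  · have hex' : ¬ ∃ g, HasWeakDeriv f' g := fun ⟨g, hg⟩ => hex ⟨g, hg.congr h (ae_eq_refl g)⟩
    rw [weakDeriv, weakDeriv, dif_neg hex, dif_neg hex']

end ElasticCurve

end

noncomputable section

namespace ElasticCurve

/-! ### Compact perturbations of isomorphisms -/

section Fredholm

/-- The identity plus an operator of finite rank has index zero, in the algebraic sense. -/
lemma finrank_ker_eq_finrank_coker_of_finite_range {W : Type*} [AddCommGroup W] [Module ℝ W]
    (N : W →ₗ[ℝ] W) (hN : FiniteDimensional ℝ N.range) :
    FiniteDimensional ℝ (LinearMap.id + N).ker ∧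
    FiniteDimensional ℝ (W ⧸ (LinearMap.id + N).range) ∧
    Module.finrank ℝ (LinearMap.id + N).ker = Module.finrank ℝ (W ⧸ (LinearMap.id + N).range) := by
  set G : W →ₗ[ℝ] W := LinearMap.id + N with hG
  set Y := N.range
  have hGx : ∀ x, G x = x + N x := fun x => rfl
  -- G = id + N maps the finite-dimensional space Y = range N to itself. The kernel of G lies in Y,
  -- and W/range G is isomorphic to Y/range A for the restriction A of G. Rank-nullity for A gives
  -- the claim.
  let A : Y →ₗ[ℝ] Y := (G ∘ₗ Y.subtype).codRestrict Y
    (fun y => Y.add_mem y.2 ⟨y, rfl⟩)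
  have hA : ∀ y : Y, (A y : W) = y + N y := fun y => rfl
  have hker : G.ker = A.ker.map Y.subtype := by
    ext x
    simp only [LinearMap.mem_ker, Submodule.mem_map, Submodule.subtype_apply]
    constructor
    · intro hx
      have hxY : x ∈ Y := ⟨-x, by rw [map_neg, neg_eq_iff_add_eq_zero, add_comm]; exact hx⟩
      exact ⟨⟨x, hxY⟩, Subtype.ext hx, rfl⟩
    · rintro ⟨y, hy, rfl⟩
      exact congrArg Subtype.val hy
  let π : Y →ₗ[ℝ] W ⧸ G.range := G.range.mkQ ∘ₗ Y.subtype
  have hπ : Function.Surjective π := by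
    intro z
    obtain ⟨x, rfl⟩ := G.range.mkQ_surjective z
    refine ⟨⟨N (-x), ⟨-x, rfl⟩⟩, ?_⟩
    change G.range.mkQ (N (-x)) = G.range.mkQ x
    rw [← sub_eq_zero, ← map_sub, Submodule.mkQ_apply, Submodule.Quotient.mk_eq_zero]
    exact ⟨-x, by rw [hGx]; abel⟩
  have hπk : π.ker = A.range := by
    ext y
    simp only [LinearMap.mem_ker, LinearMap.mem_range]
    change G.range.mkQ (y : W) = 0 ↔ _
    rw [Submodule.mkQ_apply, Submodule.Quotient.mk_eq_zero]
    constructor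
    · rintro ⟨x, hx⟩
      have hxY : x ∈ Y := by
        have : x = (y : W) - N x := by rw [← hx, hGx]; abel
        rw [this]
        exact Y.sub_mem y.2 ⟨x, rfl⟩
      exact ⟨⟨x, hxY⟩, Subtype.ext hx⟩
    · rintro ⟨x, rfl⟩
      exact ⟨x, rfl⟩
  let e : (Y ⧸ A.range) ≃ₗ[ℝ] (W ⧸ G.range) :=
    (Submodule.quotEquivOfEq _ _ hπk.symm).trans (π.quotKerEquivOfSurjective hπ)
  refine ⟨?_, Module.Finite.equiv e, ?_⟩
  · rw [hker]; infer_instance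
  · rw [← e.finrank_eq, hker, Submodule.finrank_map_subtype_eq]
    have h1 := A.finrank_range_add_finrank_ker
    have h2 := A.range.finrank_quotient_add_finrank
    omega

/-- An isomorphism plus an operator of finite rank is Fredholm of index zero. -/
lemma isFredholmIndexZero_add_finite_range {V W : Type*} [NormedAddCommGroup V] [NormedSpace ℝ V]
    [NormedAddCommGroup W] [NormedSpace ℝ W] (L : V ≃L[ℝ] W) (F : V →L[ℝ] W)
    (hF : FiniteDimensional ℝ F.range) : IsFredholmIndexZero ((L : V →L[ℝ] W) + F) := by
  set T := (L : V →L[ℝ] W) + F with hT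
  have hfr : F.toLinearMap.HasFiniteRange := (Module.Finite.iff_fg).1 hF
  set N : W →ₗ[ℝ] W := F.toLinearMap ∘ₗ (L.symm : W →L[ℝ] V).toLinearMap with hN
  have hNr : FiniteDimensional ℝ N.range :=
    (Module.Finite.iff_fg).2 (hfr.comp_right _)
  have hTL : ∀ w, T (L.symm w) = w + N w := fun w => by simp [hT, hN]
  obtain ⟨h1, h2, h3⟩ := finrank_ker_eq_finrank_coker_of_finite_range N hNr
  have hrange : T.range = (LinearMap.id + N).range := by
    ext w
    constructor
    · rintro ⟨v, rfl⟩
      exact ⟨L v, by simpa using (hTL (L v)).symm⟩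
    · rintro ⟨v, rfl⟩
      exact ⟨L.symm v, hTL v⟩
  have hker : T.ker = (LinearMap.id + N).ker.map (L.symm : W →L[ℝ] V).toLinearMap := by
    ext v
    simp only [Submodule.mem_map]
    constructor
    · intro hv
      refine ⟨L v, ?_, by simp⟩
      have := hTL (L v)
      rw [ContinuousLinearEquiv.symm_apply_apply] at this
      exact this.symm.trans hv
    · rintro ⟨w, hw, rfl⟩
      exact (hTL w).trans hw
  have hfk : Module.finrank ℝ T.ker = Module.finrank ℝ (LinearMap.id + N).ker := by
    rw [hker]
    exact L.symm.toLinearEquiv.finrank_map_eq _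
  refine ⟨?_, ?_, ?_, ?_⟩
  -- The inverse of L inverts T up to operators of finite rank on both sides.
  · refine ContinuousLinearMap.IsFredholm.of_isQuasiInverse (v := (L.symm : W →L[ℝ] V)) ⟨?_, ?_⟩
    · rw [LinearMap.IsLeftQuasiInverse, LinearMap.FiniteRangeSetoid.equiv_iff_hasFiniteRange]
      have : ((L.symm : W →L[ℝ] V).toLinearMap ∘ₗ T.toLinearMap - LinearMap.id)
        = (L.symm : W →L[ℝ] V).toLinearMap ∘ₗ F.toLinearMap := by
        ext v; simp [hT]
      rw [this]
      exact hfr.comp_left _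
    · rw [LinearMap.IsRightQuasiInverse, LinearMap.FiniteRangeSetoid.equiv_iff_hasFiniteRange]
      have : (T.toLinearMap ∘ₗ (L.symm : W →L[ℝ] V).toLinearMap - LinearMap.id) = N := by
        ext v; simp [hT, hN]
      rw [this]
      exact hfr.comp_right _
  · rw [hker]; infer_instance
  · rw [hrange]; exact h2
  · rw [hfk, hrange]; exact h3

/-- A compact operator on a Hilbert space is close to an operator of finite rank. -/
lemma exists_finite_range_norm_sub_lt_one {V : Type*} [NormedAddCommGroup V]
    [InnerProductSpace ℝ V] (K : V →L[ℝ] V) (hK : IsCompactOperator K) :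
    ∃ F : V →L[ℝ] V, FiniteDimensional ℝ F.range ∧ ‖K - F‖ < 1 := by
  obtain ⟨C, hC, hKC⟩ := hK.image_closedBall_subset_compact (𝕜₁ := ℝ) (f := K.toLinearMap) 1
  obtain ⟨t, -, htf, ht⟩ := hC.finite_cover_balls (e := 1 / 2) (by norm_num)
  -- Y is spanned by a finite 1/2-net of a compact set containing the image of the unit ball.
  -- Orthogonal projection to Y moves a point no further than its distance to the net.
  let Y := Submodule.span ℝ t
  have : FiniteDimensional ℝ Y := FiniteDimensional.span_of_finite ℝ htf
  refine ⟨Y.starProjection ∘L K, ?_, ?_⟩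
  · have : (Y.starProjection ∘L K).range ≤ Y := by
      rintro _ ⟨x, rfl⟩
      exact Y.starProjection_apply_mem _
    exact Submodule.finiteDimensional_of_le this
  · refine lt_of_le_of_lt (b := 1 / 2) ?_ (by norm_num)
    refine ContinuousLinearMap.opNorm_le_of_unit_norm (by norm_num) fun x hx => ?_
    obtain ⟨y, hy, hyx⟩ := Set.mem_iUnion₂.1 (ht (hKC ⟨x, by simp [hx], rfl⟩))
    have h1 : ‖K x - Y.starProjection (K x)‖ ≤ ‖K x - y‖ := by
      rw [Y.starProjection_minimal]
      exact ciInf_le ⟨0, by rintro _ ⟨z, rfl⟩; exact norm_nonneg _⟩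
        (⟨y, Submodule.subset_span hy⟩ : Y)
    refine h1.trans ?_
    rw [Metric.mem_ball, dist_eq_norm] at hyx
    exact hyx.le

/-- An isomorphism plus a compact operator is Fredholm of index zero. -/
theorem isFredholmIndexZero_add_compact {V W : Type*} [NormedAddCommGroup V]
    [InnerProductSpace ℝ V] [CompleteSpace V] [NormedAddCommGroup W] [NormedSpace ℝ W]
    (L : V ≃L[ℝ] W) (K : V →L[ℝ] W) (hK : IsCompactOperator K) :
    IsFredholmIndexZero ((L : V →L[ℝ] W) + K) := by
  obtain ⟨F, hF, hlt⟩ := exists_finite_range_norm_sub_lt_one ((L.symm : W →L[ℝ] V) ∘L K)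
    (hK.clm_comp (L.symm : W →L[ℝ] V))
  set R := (L.symm : W →L[ℝ] V) ∘L K - F with hR
  -- U = 1 + R is invertible by the Neumann series, as ‖R‖ < 1. Then L + K = L U + L F, an
  -- isomorphism plus an operator of finite rank.
  let U : V ≃L[ℝ] V := ContinuousLinearEquiv.unitsEquiv ℝ V
    (Units.oneSub (-R) (by rwa [norm_neg]))
  have hU : ∀ v, U v = v + R v := fun v => by
    have h : (U : V →L[ℝ] V) = 1 - -R := rfl
    have h' := congrArg (fun f : V →L[ℝ] V => f v) h
    simpa using h'
  have h1 : (L : V →L[ℝ] W) + K = ((U.trans L : V ≃L[ℝ] W) : V →L[ℝ] W) + (L : V →L[ℝ] W) ∘L F := by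
    ext v
    simp [hU, hR]
    abel
  rw [h1]
  refine isFredholmIndexZero_add_finite_range _ _ ?_
  have : ((L : V →L[ℝ] W) ∘L F).range = F.range.map (L : V →L[ℝ] W).toLinearMap := by
    rw [← LinearMap.range_comp]; rfl
  rw [this]
  infer_instance

/-- The Fredholm alternative: a trivial kernel forces codimension zero. -/
lemma IsFredholmIndexZero.bijective {V W : Type*} [AddCommGroup V] [Module ℝ V]
    [TopologicalSpace V] [AddCommGroup W] [Module ℝ W] [TopologicalSpace W] {T : V →L[ℝ] W}
    (h : IsFredholmIndexZero T) (hinj : Function.Injective T) : Function.Bijective T := by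
  refine ⟨hinj, ?_⟩
  obtain ⟨-, -, hfin, heq⟩ := h
  have hk : T.ker = ⊥ := LinearMap.ker_eq_bot.2 hinj
  rw [hk, finrank_bot] at heq
  have := Module.finrank_zero_iff.1 heq.symm
  exact LinearMap.range_eq_top.1 (Submodule.Quotient.subsingleton_iff.1 this)

end Fredholm

/-! ### The inverse square root in the algebra of continuous functions -/

section InvSqrt

variable {X : Type*} [TopologicalSpace X]

open Classical in
/-- The function `q^{-1/2}` if `q` is positive, and `0` otherwise. -/
def invSqrt (q : C(X, ℝ)) : C(X, ℝ) :=
  if h : ∀ x, 0 < q x then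
    ⟨fun x => (√(q x))⁻¹, (q.continuous.sqrt).inv₀ fun x => (Real.sqrt_pos.2 (h x)).ne'⟩
  else 0

lemma invSqrt_apply {q : C(X, ℝ)} (h : ∀ x, 0 < q x) (x : X) : invSqrt q x = (√(q x))⁻¹ := by
  rw [invSqrt, dif_pos h]; rfl

lemma invSqrt_sq_mul {q : C(X, ℝ)} (h : ∀ x, 0 < q x) : invSqrt q ^ 2 * q = 1 := by
  ext x
  simp only [ContinuousMap.mul_apply, ContinuousMap.pow_apply, ContinuousMap.one_apply,
    invSqrt_apply h, inv_pow, Real.sq_sqrt (h x).le]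
  exact inv_mul_cancel₀ (h x).ne'

variable [CompactSpace X]

lemma isOpen_positive : IsOpen {q : C(X, ℝ) | ∀ x, 0 < q x} := by
  have := ContinuousMap.isOpen_setOfPred_mapsTo (X := X) (Y := ℝ) isCompact_univ (isOpen_Ioi (a := 0))
  convert this using 1
  ext q
  simp [Set.MapsTo]

variable [Nonempty X]

/-- The terms of the series have the same norms in the algebra C(X, ℝ) as in ℝ, so the two radii
agree. -/
lemma one_le_radius_binomialSeries (a : ℝ) : 1 ≤ (binomialSeries C(X, ℝ) a).radius := by
  have h1 : (binomialSeries C(X, ℝ) a).radius = (binomialSeries ℝ a).radius := by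
    simp only [FormalMultilinearSeries.radius, binomialSeries,
      FormalMultilinearSeries.ofScalars_norm]
  rw [h1]
  exact binomialSeries_radius_ge_one

lemma mem_eball_of_norm_lt_one {E : Type*} [SeminormedAddCommGroup E] {y : E} (hy : ‖y‖ < 1) :
    y ∈ Metric.eball (0 : E) 1 := by
  rw [← ENNReal.ofReal_one, Metric.eball_ofReal]
  simpa using hy

/-- Evaluation at a point is continuous and multiplicative, so it carries the series in C(X, ℝ) to
the real binomial series. -/
lemma sum_binomialSeries_apply (a : ℝ) {h : C(X, ℝ)} (hh : ‖h‖ < 1) (x : X) :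
    (binomialSeries C(X, ℝ) a).sum h x = (1 + h x) ^ a := by
  have hr := one_le_radius_binomialSeries (X := X) a
  have hf := (binomialSeries C(X, ℝ) a).hasFPowerSeriesOnBall (lt_of_lt_of_le one_pos hr)
  have h1 := hf.hasSum (y := h) (Metric.eball_subset_eball hr (mem_eball_of_norm_lt_one hh))
  have h2 := (ContinuousMap.evalCLM ℝ x).hasSum h1
  have h3 := (Real.one_add_rpow_hasFPowerSeriesOnBall_zero (a := a)).hasSum (y := h x)
    (mem_eball_of_norm_lt_one (lt_of_le_of_lt (h.norm_coe_le_norm x) hh))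
  simp only [zero_add] at h2 h3
  refine HasSum.unique ?_ h3
  have heq : (fun n => binomialSeries ℝ a n fun _ => h x)
      = fun n => ContinuousMap.evalCLM ℝ x (binomialSeries C(X, ℝ) a n fun _ => h) := by
    funext n
    rw [binomialSeries_apply, binomialSeries_apply]
    simp
  rw [heq]
  exact h2

/-- For p near q write p = q(1 + h) with h = p/q - 1, so that p^(-1/2) = q^(-1/2)(1 + h)^(-1/2). The
last factor is the binomial series in the Banach algebra, convergent for ‖h‖ < 1. The reciprocal of
q is `invSqrt q ^ 2`. -/
lemma analyticAt_invSqrt {q : C(X, ℝ)} (hq : ∀ x, 0 < q x) : AnalyticAt ℝ invSqrt q := by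
  have hr := one_le_radius_binomialSeries (X := X) (-1 / 2)
  have hf := (binomialSeries C(X, ℝ) (-1 / 2 : ℝ)).hasFPowerSeriesOnBall (lt_of_lt_of_le one_pos hr)
  have hh : AnalyticAt ℝ (fun p : C(X, ℝ) => invSqrt q ^ 2 * p - 1) q := by fun_prop
  have h0 : invSqrt q ^ 2 * q - 1 = 0 := by rw [invSqrt_sq_mul hq, sub_self]
  have hcomp : AnalyticAt ℝ (fun p : C(X, ℝ) => invSqrt q *
      (binomialSeries C(X, ℝ) (-1 / 2 : ℝ)).sum (invSqrt q ^ 2 * p - 1)) q := by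
    refine analyticAt_const.mul (AnalyticAt.fun_comp ?_ hh)
    rw [h0]
    exact hf.analyticAt
  refine hcomp.congr ?_
  have hev : ∀ᶠ p in nhds q, ‖invSqrt q ^ 2 * p - 1‖ < 1 := by
    have h1 := hh.continuousAt.norm
    rw [ContinuousAt, h0, norm_zero] at h1
    exact h1.eventually (gt_mem_nhds one_pos)
  filter_upwards [hev, isOpen_positive.mem_nhds hq] with p hp hpos
  ext x
  have hs : √(q x) ^ 2 = q x := Real.sq_sqrt (hq x).le
  have hs0 : 0 < √(q x) := Real.sqrt_pos.2 (hq x)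
  rw [ContinuousMap.mul_apply, sum_binomialSeries_apply _ hp, invSqrt_apply hpos, invSqrt_apply hq]
  simp only [ContinuousMap.sub_apply, ContinuousMap.mul_apply, ContinuousMap.pow_apply,
    ContinuousMap.one_apply, invSqrt_apply hq, add_sub_cancel]
  rw [inv_pow, hs, show (-1 / 2 : ℝ) = -(1 / 2) by norm_num, Real.rpow_neg
    (mul_nonneg (inv_nonneg.2 (hq x).le) (hpos x).le), ← Real.sqrt_eq_rpow,
    Real.sqrt_mul (inv_nonneg.2 (hq x).le), Real.sqrt_inv]
  have : √(p x) ≠ 0 := (Real.sqrt_pos.2 (hpos x)).ne'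
  field_simp

/-- Analyticity supplies differentiability. The value of the derivative then follows by
differentiating the identity r²q = 1. -/
lemma hasDerivAt_invSqrt {q : ℝ → C(X, ℝ)} {q' : C(X, ℝ)} {t : ℝ} (hq : HasDerivAt q q' t)
    (hpos : ∀ x, 0 < q t x) :
    HasDerivAt (fun s => invSqrt (q s)) (-(1 / 2 : ℝ) • (invSqrt (q t) ^ 3 * q')) t := by
  have hd : DifferentiableAt ℝ (fun s => invSqrt (q s)) t :=
    (analyticAt_invSqrt hpos).differentiableAt.comp t hq.differentiableAt
  set r' := deriv (fun s => invSqrt (q s)) t with hr'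
  have hr : HasDerivAt (fun s => invSqrt (q s)) r' t := hd.hasDerivAt
  have h1 := (hr.fun_pow 2).fun_mul hq
  have h2 : HasDerivAt (fun s => invSqrt (q s) ^ 2 * q s) 0 t := by
    refine (hasDerivAt_const t (1 : C(X, ℝ))).congr_of_eventuallyEq ?_
    filter_upwards [hq.continuousAt.eventually (isOpen_positive.mem_nhds hpos)] with s hs
    exact invSqrt_sq_mul hs
  have h3 := h1.unique h2
  have h4 := invSqrt_sq_mul hpos
  refine hr.congr_deriv ?_
  set r := invSqrt (q t)
  ext x
  have h3x := congrArg (fun f : C(X, ℝ) => f x) h3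
  have h4x := congrArg (fun f : C(X, ℝ) => f x) h4
  have h2x : (2 : C(X, ℝ)) x = 2 := rfl
  simp [h2x] at h3x h4x ⊢
  linear_combination (r x / 2) * h3x - r' x * h4x

end InvSqrt

end ElasticCurve

end

noncomputable section

namespace ElasticCurve

/-! ### Operators between spaces of square integrable functions -/

/-- The Banach algebra of continuous functions on the circle. -/
abbrev CircleFun : Type := C(ParamCircle, ℝ)

/-- The space of square integrable real functions on the circle. -/
abbrev HTwo : Type := Lp ℝ 2 (volume : Measure ParamCircle)

/-- The coordinates of a square integrable field. -/
def coord (c : Fin 2) : LTwo →L[ℝ] HTwo :=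
  (EuclideanSpace.proj (𝕜 := ℝ) c : Plane →L[ℝ] ℝ).compLpL 2 volume

lemma coeFn_coord (c : Fin 2) (u : LTwo) : coord c u =ᵐ[volume] fun x => u x c :=
  ContinuousLinearMap.coeFn_compLpL _ u

/-- The field with one given coordinate, the other coordinate being zero. -/
def vec (c : Fin 2) : HTwo →L[ℝ] LTwo :=
  (ContinuousLinearMap.toSpanSingleton ℝ (EuclideanSpace.single c (1 : ℝ) : Plane)).compLpL 2 volume

lemma coeFn_vec (c : Fin 2) (h : HTwo) :
    vec c h =ᵐ[volume] fun x => h x • (EuclideanSpace.single c (1 : ℝ) : Plane) :=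
  ContinuousLinearMap.coeFn_compLpL _ h

/-- Multiplication of square integrable functions by continuous functions. -/
def mulL : CircleFun →L[ℝ] HTwo →L[ℝ] HTwo :=
  ((ContinuousLinearMap.mul ℝ ℝ).holderL volume ⊤ 2 2) ∘L (ContinuousMap.toLp ⊤ volume ℝ)

lemma coeFn_mulL (a : CircleFun) (h : HTwo) : mulL a h =ᵐ[volume] fun x => a x * h x := by
  have h1 := ContinuousLinearMap.coeFn_holder (r := 2) (ContinuousLinearMap.mul ℝ ℝ)
    (ContinuousMap.toLp ⊤ volume ℝ a) h
  filter_upwards [h1, ContinuousMap.coeFn_toLp (p := ⊤) (𝕜 := ℝ) volume a] with x hx hx'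
  refine hx.trans ?_
  rw [hx']
  rfl

/-- Continuous functions as square integrable functions. -/
def toH : CircleFun →L[ℝ] HTwo := ContinuousMap.toLp 2 volume ℝ

lemma coeFn_toH (a : CircleFun) : toH a =ᵐ[volume] a := ContinuousMap.coeFn_toLp volume a

/-- Two continuous functions equal almost everywhere are equal. Identities between continuous
representatives are therefore proved in L². -/
lemma toH_injective : Function.Injective toH := by
  intro a b h
  have h1 : (a : ParamCircle → ℝ) =ᵐ[volume] b :=
    (coeFn_toH a).symm.trans (h ▸ coeFn_toH b)
  exact DFunLike.coe_injective (Continuous.ae_eq_iff_eq volume a.continuous b.continuous |>.1 h1)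

/-- The scalar product of square integrable functions. -/
def pairH : HTwo →L[ℝ] HTwo →L[ℝ] ℝ := (ContinuousLinearMap.mul ℝ ℝ).lpPairing volume 2 2

lemma pairH_apply (f g : HTwo) : pairH f g = ∫ x, f x * g x :=
  ContinuousLinearMap.lpPairing_eq_integral _ f g

lemma HTwo.integrable (h : HTwo) : Integrable h := (Lp.memLp h).integrable (by norm_num)

lemma HTwo.integrable_mul (f g : HTwo) : Integrable fun x => f x * g x :=
  (Lp.memLp f).integrable_mul (Lp.memLp g)

/-- The integral over the circle as a functional on continuous functions. -/
def integralCLM : CircleFun →L[ℝ] ℝ := (pairH (toH 1)) ∘L toH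

lemma integralCLM_apply (a : CircleFun) : integralCLM a = ∫ x, a x := by
  refine (pairH_apply _ _).trans (integral_congr_ae ?_)
  filter_upwards [coeFn_toH 1, coeFn_toH a] with x h h'
  rw [h]
  change 1 * (toH a) x = a x
  rw [h', one_mul]

/-! ### Completeness of the Sobolev spaces -/

/-- For fixed test functions both sides are continuous in u and v, which makes the Sobolev space
closed, hence complete. -/
lemma hasWeakDeriv_iff_pairH (u v : LTwo) : HasWeakDeriv u v ↔
    ∀ (c : Fin 2) (η η' : CircleFun), ContDiff ℝ ∞ (fun x : ℝ => η (x : ParamCircle)) →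
      (∀ x : ℝ, HasDerivAt (fun y : ℝ => η (y : ParamCircle)) (η' (x : ParamCircle)) x) →
      pairH (toH η') (coord c u) = - pairH (toH η) (coord c v) := by
  have key : ∀ (c : Fin 2) (η : CircleFun) (w : LTwo),
      pairH (toH η) (coord c w) = ∫ x, η x * w x c := by
    intro c η w
    rw [pairH_apply]
    refine integral_congr_ae ?_
    filter_upwards [coeFn_toH η, coeFn_coord c w] with x h h'
    rw [h, h']
  constructor
  · intro h c η η' hη hη'
    rw [key, key]
    exact h.integral_coord c η η' hη hη'
  · intro h
    refine ⟨LTwo.integrable u, LTwo.integrable v, fun η η' hη hη' => ?_⟩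
    have hd : (fun x : ℝ => η' (x : ParamCircle)) = deriv (fun x : ℝ => η (x : ParamCircle)) :=
      funext fun x => (hη' x).deriv.symm
    have hc : Continuous η := continuous_of_continuous_coe hη.continuous
    have hc' : Continuous η' := by
      apply continuous_of_continuous_coe
      rw [hd]
      exact hη.continuous_deriv (by simp)
    ext c
    have h0 := h c ⟨η, hc⟩ ⟨η', hc'⟩ hη hη'
    rw [key, key] at h0
    have h1 := (EuclideanSpace.proj (𝕜 := ℝ) c).integral_comp_comm
      (integrable_smul_of_continuous hc' (LTwo.integrable u))
    have h2 := (EuclideanSpace.proj (𝕜 := ℝ) c).integral_comp_comm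
      (integrable_smul_of_continuous hc (LTwo.integrable v))
    simp only [PiLp.proj_apply, PiLp.smul_apply, smul_eq_mul] at h1 h2
    rw [PiLp.neg_apply, ← h1, ← h2]
    exact h0

/-- The `i`-th entry of a tuple of square integrable fields. -/
def entry (m : ℕ) (i : Fin (m + 1)) : PiLp 2 (fun _ : Fin (m + 1) => LTwo) →L[ℝ] LTwo :=
  PiLp.proj 2 (fun _ : Fin (m + 1) => LTwo) i

lemma isClosed_sobolev (m : ℕ) :
    IsClosed (Sobolev m : Set (PiLp 2 (fun _ : Fin (m + 1) => LTwo))) := by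
  have : (Sobolev m : Set (PiLp 2 (fun _ : Fin (m + 1) => LTwo))) =
      {u | ∀ i : Fin m, HasWeakDeriv (u i.castSucc) (u i.succ)} := rfl
  rw [this]
  simp only [hasWeakDeriv_iff_pairH, Set.ofPred_forall]
  refine isClosed_iInter fun i => isClosed_iInter fun c => isClosed_iInter fun η =>
    isClosed_iInter fun η' => isClosed_iInter fun _ => isClosed_iInter fun _ => ?_
  exact isClosed_eq
    (((pairH (toH η')) ∘L (coord c) ∘L entry m i.castSucc).continuous)
    (((pairH (toH η)) ∘L (coord c) ∘L entry m i.succ).continuous.neg)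

instance (m : ℕ) : CompleteSpace (Sobolev m) := (isClosed_sobolev m).completeSpace_coe

/-! ### Continuous representatives -/

/-- The `i`-th weak derivative of a field of class `H^m`. -/
def Sobolev.der {m : ℕ} (i : Fin (m + 1)) : Sobolev m →L[ℝ] LTwo :=
  (entry m i).comp (Sobolev m).subtypeL

lemma Sobolev.hasWeakDeriv_der {m : ℕ} (u : Sobolev m) (i : Fin m) :
    HasWeakDeriv (der i.castSucc u) (der i.succ u) := u.2 i

lemma exists_jet {m : ℕ} (i : Fin m) (c : Fin 2) (u : Sobolev m) :
    ∃ F : CircleFun, toH F = coord c (Sobolev.der i.castSucc u) ∧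
      HasPrim F (coord c (Sobolev.der i.succ u)) := by
  obtain ⟨F, hF, hp⟩ := (Sobolev.hasWeakDeriv_der u i).exists_hasPrim
  refine ⟨⟨fun x => F x c, (hp c).continuous⟩, Lp.ext ?_, (hp c).congr_right (coeFn_coord c _)⟩
  filter_upwards [coeFn_toH ⟨fun x => F x c, (hp c).continuous⟩,
    coeFn_coord c (Sobolev.der i.castSucc u), hF] with x h1 h2 h3
  rw [h1, h2, ← h3]
  rfl

/-- The coordinate `c` of the continuous representative of the `i`-th derivative of a field
of class `H^m`, where `i < m`. -/
def jetFun {m : ℕ} (i : Fin m) (c : Fin 2) (u : Sobolev m) : CircleFun := (exists_jet i c u).choose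

lemma toH_jetFun {m : ℕ} (i : Fin m) (c : Fin 2) (u : Sobolev m) :
    toH (jetFun i c u) = coord c (Sobolev.der i.castSucc u) := (exists_jet i c u).choose_spec.1

/-- `jetFun` as a continuous linear map. -/
def jet {m : ℕ} (i : Fin m) (c : Fin 2) : Sobolev m →L[ℝ] CircleFun :=
  let L : Sobolev m →ₗ[ℝ] CircleFun :=
    { toFun := jetFun i c
      map_add' := fun u v => toH_injective (by
        rw [map_add toH, toH_jetFun, toH_jetFun, toH_jetFun, map_add, map_add])
      map_smul' := fun a u => toH_injective (by
        rw [map_smul toH, toH_jetFun, toH_jetFun, map_smul, map_smul, RingHom.id_apply]) }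
  -- Closed graph theorem: a uniform limit of representatives is also their limit in L², where it is
  -- the derivative of the limit field.
  ⟨L, L.continuous_of_seq_closed_graph fun u x y hu hy => toH_injective (by
    have h1 := (toH.continuous.tendsto y).comp hy
    have h2 := (((coord c).continuous.comp (Sobolev.der i.castSucc).continuous).tendsto x).comp hu
    change toH y = toH (jetFun i c x)
    rw [toH_jetFun]
    refine tendsto_nhds_unique h1 (h2.congr fun n => ?_)
    exact (toH_jetFun i c (u n)).symm)⟩

lemma toH_jet {m : ℕ} (i : Fin m) (c : Fin 2) (u : Sobolev m) :
    toH (jet i c u) = coord c (Sobolev.der i.castSucc u) := toH_jetFun i c u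

lemma hasPrim_jet {m : ℕ} (i : Fin m) (c : Fin 2) (u : Sobolev m) :
    HasPrim (jet i c u) (coord c (Sobolev.der i.succ u)) := (exists_jet i c u).choose_spec.2

lemma jet_ae_eq {m : ℕ} (i : Fin m) (c : Fin 2) (u : Sobolev m) :
    jet i c u =ᵐ[volume] fun x => Sobolev.der i.castSucc u x c := by
  refine (coeFn_toH _).symm.trans ?_
  rw [toH_jet]
  exact coeFn_coord c _

lemma hasPrim_jet_jet {m : ℕ} {i j : Fin m} (hij : i.succ = j.castSucc) (c : Fin 2)
    (u : Sobolev m) : HasPrim (jet i c u) (jet j c u) := by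
  refine (hasPrim_jet i c u).congr_right ?_
  rw [hij, ← toH_jet]
  exact (coeFn_toH _).symm

/-! ### Compactness -/

/-- Integrate Young's inequality |g| ≤ ε g²/2 + 1/(2ε). This replaces the Hölder-1/2 bound and gives
equicontinuity. As |y - x| is at most one period, the integral of g² is bounded by that over the
circle. -/
lemma HasPrim.abs_sub_le {f : ParamCircle → ℝ} {g : HTwo} (h : HasPrim f g) {ε : ℝ} (hε : 0 < ε)
    {x y : ℝ} (hxy : |y - x| ≤ 2 * Real.pi) :
    |f y - f x| ≤ ε / 2 * pairH g g + |y - x| / (2 * ε) := by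
  wlog hle : x ≤ y generalizing x y
  · have := this (by rwa [abs_sub_comm]) (le_of_not_ge hle)
    rwa [abs_sub_comm, abs_sub_comm x y] at this
  rw [abs_of_nonneg (sub_nonneg.2 hle)] at hxy ⊢
  rw [h.sub_eq]
  have hg2 : Integrable fun x => g x * g x := HTwo.integrable_mul g g
  have hi := intervalIntegrable_coe h.integrable x y
  have hi2 := intervalIntegrable_coe hg2
  calc |∫ t in x..y, g (t : ParamCircle)|
      ≤ ∫ t in x..y, |g (t : ParamCircle)| := intervalIntegral.abs_integral_le_integral_abs hle
    _ ≤ ∫ t in x..y, (ε / 2 * (g (t : ParamCircle) * g (t : ParamCircle)) + 1 / (2 * ε)) := by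
        refine intervalIntegral.integral_mono hle hi.abs
          (((hi2 x y).const_mul _).add intervalIntegrable_const) fun t => ?_
        simp only
        set a := g (t : ParamCircle)
        have h1 : 0 ≤ (ε * |a| - 1) ^ 2 / (2 * ε) := by positivity
        have h2 : (ε * |a| - 1) ^ 2 / (2 * ε) = ε / 2 * (|a| * |a|) + 1 / (2 * ε) - |a| := by
          field_simp
          ring
        rw [abs_mul_abs_self] at h2
        linarith
    _ = ε / 2 * (∫ t in x..y, g (t : ParamCircle) * g (t : ParamCircle)) + (y - x) / (2 * ε) := by
        rw [intervalIntegral.integral_add ((hi2 x y).const_mul _) intervalIntegrable_const,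
          intervalIntegral.integral_const_mul, intervalIntegral.integral_const]
        simp only [smul_eq_mul]
        ring
    _ ≤ ε / 2 * pairH g g + (y - x) / (2 * ε) := by
        have h1 : ∫ t in x..y, g (t : ParamCircle) * g (t : ParamCircle) ≤ pairH g g := by
          rw [pairH_apply, integral_circle (fun x => g x * g x) x]
          refine intervalIntegral.integral_mono_interval le_rfl hle (by linarith)
            (Filter.Eventually.of_forall fun t => mul_self_nonneg _) (hi2 _ _)
        gcongr

/-- The embedding of `H^m` into continuous functions, in terms of derivatives of order less
than `m`, is compact. -/
lemma isCompactOperator_jet {m : ℕ} (i : Fin m) (c : Fin 2) :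
    IsCompactOperator (jet i c : Sobolev m → CircleFun) := by
  have h0 := isCompactOperator_iff_isCompact_closure_image_closedBall
    (f := (jet (m := m) i c).toLinearMap) one_pos
  refine h0.2 ?_
  set S : Set CircleFun := (jet (m := m) i c).toLinearMap '' Metric.closedBall 0 1 with hS
  let e := ContinuousMap.isometryEquivBoundedOfCompact ParamCircle ℝ
  have hcomp : IsCompact (closure (e '' S)) := by
    refine BoundedContinuousFunction.arzela_ascoli (Metric.closedBall 0 ‖jet (m := m) i c‖)
      (isCompact_closedBall _ _) _ ?_ ?_
    · rintro _ x ⟨_, ⟨u, hu, rfl⟩, rfl⟩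
      rw [mem_closedBall_zero_iff] at hu ⊢
      refine ((jet i c u).norm_coe_le_norm x).trans (((jet i c).le_opNorm u).trans ?_)
      exact mul_le_of_le_one_right (jet i c).opNorm_nonneg hu
    · intro x₀
      rw [Metric.equicontinuousAt_iff_right]
      intro ε hε
      induction x₀ using QuotientAddGroup.induction_on with | H t₀ =>
      set L : Sobolev m →L[ℝ] HTwo := (coord c) ∘L (Sobolev.der i.succ) with hL
      set M : ℝ := ‖pairH‖ * ‖L‖ * ‖L‖ + 1 with hM
      have hM0 : 0 < M := by positivity
      -- M exceeds ∫ g² on the unit ball, so this choice bounds the first term of the estimate by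
      -- ε/2. The radius δ bounds the second by ε/4 and keeps t within one period of t₀.
      set ε' := ε / M with hε'
      have hε'0 : 0 < ε' := by positivity
      set δ := min (ε' * ε / 2) (2 * Real.pi) with hδ
      have hδ0 : 0 < δ := by have := Real.pi_pos; positivity
      have hopen := QuotientAddGroup.isOpenMap_coe (N := AddSubgroup.zmultiples (2 * Real.pi))
      filter_upwards [hopen.image_mem_nhds (Metric.ball_mem_nhds t₀ hδ0)]
      rintro _ ⟨t, ht, rfl⟩ ⟨_, ⟨_, ⟨u, hu, rfl⟩, rfl⟩⟩
      rw [Metric.mem_ball, Real.dist_eq] at ht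
      rw [mem_closedBall_zero_iff] at hu
      rw [dist_comm, Real.dist_eq]
      have h1 := (hasPrim_jet i c u).abs_sub_le hε'0 (x := t₀) (y := t)
        (ht.le.trans (min_le_right _ _))
      refine lt_of_le_of_lt h1 ?_
      have h2 : pairH (L u) (L u) < M := by
        have h3 : pairH (L u) (L u) ≤ ‖pairH‖ * ‖L u‖ * ‖L u‖ :=
          (le_abs_self _).trans (pairH.le_opNorm₂ _ _)
        have h4 : ‖L u‖ ≤ ‖L‖ :=
          (L.le_opNorm u).trans (mul_le_of_le_one_right L.opNorm_nonneg hu)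
        have h5 : ‖pairH‖ * ‖L u‖ * ‖L u‖ ≤ ‖pairH‖ * ‖L‖ * ‖L‖ := by gcongr
        linarith
      have h6 : |t - t₀| / (2 * ε') < ε / 4 := by
        rw [div_lt_iff₀ (by positivity)]
        have := ht.trans_le (min_le_left _ _)
        linarith
      have h7 : ε' / 2 * pairH (L u) (L u) < ε / 2 := by
        have : ε' / 2 * pairH (L u) (L u) < ε' / 2 * M := by gcongr
        have h8 : ε' / 2 * M = ε / 2 := by rw [hε']; field_simp
        linarith
      change ε' / 2 * pairH (L u) (L u) + _ < ε
      linarith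
  have hcl : closure S = e.symm '' closure (e '' S) := by
    have h := e.toHomeomorph.image_closure S
    change e '' closure S = closure (e '' S) at h
    rw [← h, Set.image_image]
    simp
  rw [hcl]
  exact hcomp.image e.symm.continuous

end ElasticCurve

end

noncomputable section

namespace ElasticCurve

/-! ### Smooth functions on the circle -/

/-- Smoothness of a function on the circle, as a periodic function on the line. -/
def IsSmooth (f : ParamCircle → ℝ) : Prop := ContDiff ℝ ∞ (fun x : ℝ => f (x : ParamCircle))

lemma periodic_deriv_coe (f : ParamCircle → ℝ) :
    Function.Periodic (deriv fun t : ℝ => f (t : ParamCircle)) (2 * Real.pi) := by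
  intro x
  have h := deriv_comp_add_const (fun t : ℝ => f (t : ParamCircle)) (2 * Real.pi) x
  simp only [coe_add_two_pi] at h
  exact h.symm

/-- The derivative of a function on the circle. -/
def circleDeriv (f : ParamCircle → ℝ) : ParamCircle → ℝ := (periodic_deriv_coe f).lift

lemma circleDeriv_coe (f : ParamCircle → ℝ) (x : ℝ) :
    circleDeriv f x = deriv (fun t : ℝ => f (t : ParamCircle)) x :=
  (periodic_deriv_coe f).lift_coe x

lemma circleDeriv_zero : circleDeriv 0 = 0 := by
  funext x
  induction x using QuotientAddGroup.induction_on with | H x =>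
  rw [circleDeriv_coe]
  simp

namespace IsSmooth

variable {f g : ParamCircle → ℝ}

lemma circleDeriv (hf : IsSmooth f) : IsSmooth (circleDeriv f) := by
  unfold IsSmooth
  simp only [circleDeriv_coe]
  exact ((contDiff_infty_iff_deriv).1 hf).2

lemma hasDerivAt (hf : IsSmooth f) (x : ℝ) :
    HasDerivAt (fun t : ℝ => f (t : ParamCircle)) (ElasticCurve.circleDeriv f x) x := by
  rw [circleDeriv_coe]
  exact ((hf.differentiable (by simp)) x).hasDerivAt

lemma continuous (hf : IsSmooth f) : Continuous f := continuous_of_continuous_coe (ContDiff.continuous hf)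

lemma hasPrim (hf : IsSmooth f) : HasPrim f (ElasticCurve.circleDeriv f) :=
  HasPrim.of_hasDerivAt hf.circleDeriv.continuous hf.hasDerivAt

lemma const (c : ℝ) : IsSmooth fun _ => c := contDiff_const

lemma add (hf : IsSmooth f) (hg : IsSmooth g) : IsSmooth fun x => f x + g x := ContDiff.add hf hg

lemma mul (hf : IsSmooth f) (hg : IsSmooth g) : IsSmooth fun x => f x * g x := ContDiff.mul hf hg

lemma neg (hf : IsSmooth f) : IsSmooth fun x => - f x := ContDiff.neg hf

lemma inv (hf : IsSmooth f) (h : ∀ x, f x ≠ 0) : IsSmooth fun x => (f x)⁻¹ :=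
  ContDiff.inv hf fun x => h x

lemma sqrt (hf : IsSmooth f) (h : ∀ x, f x ≠ 0) : IsSmooth fun x => √(f x) :=
  ContDiff.sqrt hf fun x => h x

end IsSmooth

open Classical in
/-- A continuous function on the circle as an element of `CircleFun`. -/
def toC (f : ParamCircle → ℝ) : CircleFun := if h : Continuous f then ⟨f, h⟩ else 0

lemma toC_apply {f : ParamCircle → ℝ} (h : Continuous f) (x : ParamCircle) : toC f x = f x := by
  rw [toC, dif_pos h]; rfl

/-! ### The frame along a smooth regular curve -/

/-- The coordinates of the velocity. -/
def vel (γ : ParamCircle → Plane) (c : Fin 2) : ParamCircle → ℝ := circleDeriv fun x => γ x c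

/-- The speed. -/
def speed (γ : ParamCircle → Plane) (x : ParamCircle) : ℝ := √(vel γ 0 x ^ 2 + vel γ 1 x ^ 2)

/-- The coordinates of the unit normal. -/
def nrm (γ : ParamCircle → Plane) (c : Fin 2) (x : ParamCircle) : ℝ :=
  if c = 0 then -((speed γ x)⁻¹ * vel γ 1 x) else (speed γ x)⁻¹ * vel γ 0 x

/-- The field with the coordinates `f`. -/
def field (f : Fin 2 → ParamCircle → ℝ) (x : ParamCircle) : Plane := WithLp.toLp 2 fun c => f c x

lemma hasDerivAt_plane {f : ℝ → Plane} {f' : Plane} {x : ℝ}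
    (h : ∀ c, HasDerivAt (fun t => f t c) (f' c) x) : HasDerivAt f f' x :=
  (PiLp.continuousLinearEquiv 2 ℝ (fun _ : Fin 2 => ℝ)).symm.hasFDerivAt.comp_hasDerivAt x
    (hasDerivAt_pi.2 h)

lemma norm_field (f : Fin 2 → ParamCircle → ℝ) (x : ParamCircle) :
    ‖field f x‖ = √(f 0 x ^ 2 + f 1 x ^ 2) := by
  rw [EuclideanSpace.norm_eq]
  simp [field]

section Frame

variable {γ : ParamCircle → Plane} (hγ : IsRegularCurve (⊤ : ℕ∞) γ)

include hγ

lemma isSmooth_coord (c : Fin 2) : IsSmooth fun x => γ x c :=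
  (EuclideanSpace.proj (𝕜 := ℝ) c : Plane →L[ℝ] ℝ).contDiff.comp hγ.contDiff

lemma isSmooth_vel (c : Fin 2) : IsSmooth (vel γ c) := (isSmooth_coord hγ c).circleDeriv

lemma hasPrim_vel (c : Fin 2) : HasPrim (fun x => γ x c) (vel γ c) := (isSmooth_coord hγ c).hasPrim

lemma velSq_pos (x : ParamCircle) : 0 < vel γ 0 x ^ 2 + vel γ 1 x ^ 2 := by
  induction x using QuotientAddGroup.induction_on with | H x =>
  have h1 := hγ.deriv_ne_zero x
  have hd : HasDerivAt (fun y : ℝ => γ (y : ParamCircle)) (field (vel γ) (x : ParamCircle)) x := by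
    exact hasDerivAt_plane fun c => (isSmooth_coord hγ c).hasDerivAt x
  rw [hd.deriv] at h1
  by_contra hcon
  refine h1 ?_
  have h0 : vel γ 0 x = 0 := by nlinarith [sq_nonneg (vel γ 0 x), sq_nonneg (vel γ 1 x)]
  have h2 : vel γ 1 x = 0 := by nlinarith [sq_nonneg (vel γ 0 x), sq_nonneg (vel γ 1 x)]
  ext c
  fin_cases c
  · exact h0
  · exact h2

lemma speed_pos (x : ParamCircle) : 0 < speed γ x := Real.sqrt_pos.2 (velSq_pos hγ x)

lemma speed_sq (x : ParamCircle) : speed γ x ^ 2 = vel γ 0 x ^ 2 + vel γ 1 x ^ 2 :=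
  Real.sq_sqrt (velSq_pos hγ x).le

lemma isSmooth_speed : IsSmooth (speed γ) := by
  refine IsSmooth.sqrt ?_ fun x => (velSq_pos hγ x).ne'
  simp only [pow_two]
  exact ((isSmooth_vel hγ 0).mul (isSmooth_vel hγ 0)).add
    ((isSmooth_vel hγ 1).mul (isSmooth_vel hγ 1))

lemma isSmooth_speed_inv : IsSmooth fun x => (speed γ x)⁻¹ :=
  (isSmooth_speed hγ).inv fun x => (speed_pos hγ x).ne'

lemma isSmooth_nrm (c : Fin 2) : IsSmooth (nrm γ c) := by
  fin_cases c
  · exact ((isSmooth_speed_inv hγ).mul (isSmooth_vel hγ 1)).neg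
  · exact (isSmooth_speed_inv hγ).mul (isSmooth_vel hγ 0)

lemma nrm_sq (x : ParamCircle) : nrm γ 0 x ^ 2 + nrm γ 1 x ^ 2 = 1 := by
  have h := speed_sq hγ x
  have h0 := (speed_pos hγ x).ne'
  simp only [nrm]
  simp
  field_simp
  linarith

lemma hasWeakDeriv_curve : HasWeakDeriv γ (field (vel γ)) :=
  HasWeakDeriv.of_hasPrim fun c => hasPrim_vel hγ c

lemma tangent_ae_eq : tangent γ =ᵐ[volume] fun x => (speed γ x)⁻¹ • field (vel γ) x := by
  filter_upwards [(hasWeakDeriv_curve hγ).weakDeriv_eq] with x hx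
  rw [tangent, arcDeriv, hx, norm_field]
  rfl

lemma vel_eq_nrm (x : ParamCircle) :
    vel γ 0 x = speed γ x * nrm γ 1 x ∧ vel γ 1 x = - (speed γ x * nrm γ 0 x) := by
  have h0 := (speed_pos hγ x).ne'
  simp only [nrm]
  simp
  constructor <;> field_simp

lemma tangent_ae_eq_nrm : ∀ᵐ x, tangent γ x 0 = nrm γ 1 x ∧ tangent γ x 1 = - nrm γ 0 x := by
  filter_upwards [tangent_ae_eq hγ] with x hx
  rw [hx]
  have h0 := (speed_pos hγ x).ne'
  obtain ⟨h1, h2⟩ := vel_eq_nrm hγ x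
  simp only [PiLp.smul_apply, field, smul_eq_mul, h1, h2]
  constructor <;> field_simp

/-- The normal derivative of a normal field. -/
lemma normalArcDeriv_of_hasPrim {φ : ParamCircle → Plane} {f h : ParamCircle → ℝ}
    (hφ : φ =ᵐ[volume] field fun c x => f x * nrm γ c x)
    (hf : HasPrim f fun x => speed γ x * h x) :
    normalArcDeriv γ φ =ᵐ[volume] field fun c x => h x * nrm γ c x := by
  have h1 : HasWeakDeriv (field fun c x => f x * nrm γ c x)
      (field fun c x => speed γ x * h x * nrm γ c x + f x * circleDeriv (nrm γ c) x) :=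
    HasWeakDeriv.of_hasPrim fun c => hf.mul (isSmooth_nrm hγ c).hasPrim
  have hn : HasPrim (fun _ => (1 : ℝ)) fun x =>
      circleDeriv (nrm γ 0) x * nrm γ 0 x + nrm γ 0 x * circleDeriv (nrm γ 0) x +
      (circleDeriv (nrm γ 1) x * nrm γ 1 x + nrm γ 1 x * circleDeriv (nrm γ 1) x) := by
    have h2 := ((isSmooth_nrm hγ 0).hasPrim.mul (isSmooth_nrm hγ 0).hasPrim).add
      ((isSmooth_nrm hγ 1).hasPrim.mul (isSmooth_nrm hγ 1).hasPrim)
    have h3 : (fun _ : ParamCircle => (1 : ℝ)) =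
        fun x => nrm γ 0 x * nrm γ 0 x + nrm γ 1 x * nrm γ 1 x := by
      funext x
      have := nrm_sq hγ x
      linarith
    rwa [h3]
  -- Differentiating |n|² = 1 shows that n' is orthogonal to n, hence tangential in the plane. The
  -- projection in `normalArcDeriv` removes exactly the term f n'.
  have horth : ∀ x, nrm γ 0 x * circleDeriv (nrm γ 0) x + nrm γ 1 x * circleDeriv (nrm γ 1) x
      = 0 := by
    intro x
    induction x using QuotientAddGroup.induction_on with | H x =>
    have c0 := (isSmooth_nrm hγ 0).continuous
    have c1 := (isSmooth_nrm hγ 1).continuous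
    have d0 := (isSmooth_nrm hγ 0).circleDeriv.continuous
    have d1 := (isSmooth_nrm hγ 1).circleDeriv.continuous
    have h2 := (hn.hasDerivAt (by fun_prop) x).unique (hasDerivAt_const x (1 : ℝ))
    linarith
  filter_upwards [(weakDeriv_congr hφ).trans h1.weakDeriv_eq,
    (hasWeakDeriv_curve hγ).weakDeriv_eq, tangent_ae_eq_nrm hγ] with x hx hc ⟨ht0, ht1⟩
  have hsp : ‖weakDeriv γ x‖ = speed γ x := by rw [hc, norm_field]; rfl
  have hs := (speed_pos hγ x).ne'
  have hq := nrm_sq hγ x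
  have ho := horth x
  set s := speed γ x
  set n0 := nrm γ 0 x
  set n1 := nrm γ 1 x
  set d0 := circleDeriv (nrm γ 0) x
  set d1 := circleDeriv (nrm γ 1) x
  have e0 : arcDeriv γ φ x 0 = s⁻¹ * (s * h x * n0 + f x * d0) := by
    rw [arcDeriv, hsp, hx]; rfl
  have e1 : arcDeriv γ φ x 1 = s⁻¹ * (s * h x * n1 + f x * d1) := by
    rw [arcDeriv, hsp, hx]; rfl
  have hin : ⟪arcDeriv γ φ x, tangent γ x⟫ = s⁻¹ * f x * (d0 * n1 - d1 * n0) := by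
    rw [PiLp.inner_apply]
    simp only [Fin.sum_univ_two, RCLike.inner_apply, conj_trivial, e0, e1, ht0, ht1]
    ring
  ext c
  fin_cases c
  · change arcDeriv γ φ x 0 - ⟪arcDeriv γ φ x, tangent γ x⟫ * tangent γ x 0 = h x * n0
    rw [hin, e0, ht0]
    field_simp
    linear_combination f x * n0 * ho - f x * d0 * hq
  · change arcDeriv γ φ x 1 - ⟪arcDeriv γ φ x, tangent γ x⟫ * tangent γ x 1 = h x * n1
    rw [hin, e1, ht1]
    field_simp
    linear_combination f x * n1 * ho - f x * d1 * hq

end Frame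

/-! ### Coefficients of the iterated normal derivative -/

/-- The coefficients of the `k`-th arclength derivative of the normal component of a field: it is
the sum of the products of `normalCoeff γ k i c` with the coordinate `c` of the `i`-th derivative. -/
def normalCoeff (γ : ParamCircle → Plane) : ℕ → ℕ → Fin 2 → ParamCircle → ℝ
  | 0, 0, c => nrm γ c
  | 0, _ + 1, _ => 0
  | k + 1, 0, c => fun x => (speed γ x)⁻¹ * circleDeriv (normalCoeff γ k 0 c) x
  | k + 1, i + 1, c => fun x =>
      (speed γ x)⁻¹ * (circleDeriv (normalCoeff γ k (i + 1) c) x + normalCoeff γ k i c x)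

lemma normalCoeff_eq_zero (γ : ParamCircle → Plane) {k i : ℕ} (h : k < i) (c : Fin 2) :
    normalCoeff γ k i c = 0 := by
  induction k generalizing i with
  | zero =>
    obtain ⟨j, rfl⟩ := Nat.exists_eq_succ_of_ne_zero h.ne'
    rfl
  | succ k ih =>
    obtain ⟨j, rfl⟩ := Nat.exists_eq_succ_of_ne_zero (Nat.ne_zero_of_lt h)
    funext x
    simp only [normalCoeff]
    rw [ih (i := j + 1) (by omega), ih (i := j) (by omega), circleDeriv_zero]
    simp

/-- The leading coefficient comes from letting every derivative fall on the field, each contributing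
one inverse speed. For k = 4 it gives the principal part of (∂_s^⊥)⁴. -/
lemma normalCoeff_self (γ : ParamCircle → Plane) (k : ℕ) (c : Fin 2) (x : ParamCircle) :
    normalCoeff γ k k c x = (speed γ x)⁻¹ ^ k * nrm γ c x := by
  induction k with
  | zero => simp [normalCoeff]
  | succ k ih =>
    simp only [normalCoeff]
    rw [normalCoeff_eq_zero γ (Nat.lt_succ_self k), circleDeriv_zero, ih, pow_succ]
    simp
    ring

lemma isSmooth_normalCoeff {γ : ParamCircle → Plane} (hγ : IsRegularCurve (⊤ : ℕ∞) γ) (k i : ℕ)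
    (c : Fin 2) : IsSmooth (normalCoeff γ k i c) := by
  induction k generalizing i with
  | zero =>
    rcases i with _ | i
    · exact isSmooth_nrm hγ c
    · exact IsSmooth.const 0
  | succ k ih =>
    rcases i with _ | i
    · exact (isSmooth_speed_inv hγ).mul (ih 0).circleDeriv
    · exact (isSmooth_speed_inv hγ).mul ((ih (i + 1)).circleDeriv.add (ih i))

end ElasticCurve

end

noncomputable section

namespace ElasticCurve

/-! ### Normal and tangential components -/

lemma coord_vec (c d : Fin 2) (h : HTwo) : coord c (vec d h) = if c = d then h else 0 := by
  refine Lp.ext ?_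
  filter_upwards [coeFn_coord c (vec d h), coeFn_vec d h,
    Lp.coeFn_zero ℝ 2 (volume : Measure ParamCircle)] with x h1 h2 h3
  rw [h1, h2]
  split_ifs with hcd
  · subst hcd; simp
  · rw [h3]; simp [hcd]

/-- The scalar product of a field with a continuous field. -/
def dotL (a : Fin 2 → CircleFun) : LTwo →L[ℝ] HTwo := ∑ c, mulL (a c) ∘L coord c

lemma coeFn_dotL (a : Fin 2 → CircleFun) (u : LTwo) :
    dotL a u =ᵐ[volume] fun x => a 0 x * u x 0 + a 1 x * u x 1 := by
  have h : dotL a u = mulL (a 0) (coord 0 u) + mulL (a 1) (coord 1 u) := by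
    simp [dotL]
  rw [h]
  filter_upwards [Lp.coeFn_add (mulL (a 0) (coord 0 u)) (mulL (a 1) (coord 1 u)),
    coeFn_mulL (a 0) (coord 0 u), coeFn_mulL (a 1) (coord 1 u), coeFn_coord 0 u, coeFn_coord 1 u]
    with x h1 h2 h3 h4 h5
  rw [h1, Pi.add_apply, h2, h3, h4, h5]

/-- The multiples of a continuous field. -/
def smulField (a : Fin 2 → CircleFun) : HTwo →L[ℝ] LTwo := ∑ c, vec c ∘L mulL (a c)

lemma coord_smulField (a : Fin 2 → CircleFun) (c : Fin 2) (h : HTwo) :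
    coord c (smulField a h) = mulL (a c) h := by
  simp only [smulField, Fin.sum_univ_two, add_apply,
    ContinuousLinearMap.comp_apply, map_add, coord_vec]
  fin_cases c <;> simp

lemma coeFn_smulField (a : Fin 2 → CircleFun) (h : HTwo) :
    smulField a h =ᵐ[volume] field fun c x => h x * a c x := by
  filter_upwards [coeFn_coord 0 (smulField a h), coeFn_coord 1 (smulField a h),
    coeFn_mulL (a 0) h, coeFn_mulL (a 1) h] with x h0 h1 h2 h3
  rw [coord_smulField] at h0 h1
  ext c
  fin_cases c
  · exact h0.symm.trans (h2.trans (mul_comm _ _))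
  · exact h1.symm.trans (h3.trans (mul_comm _ _))

/-! ### Normal fields as scalar functions, and the operator (∂_s^⊥)⁴ -/

section Operator

variable {γ : ParamCircle → Plane}

/-- The unit normal, as a pair of continuous functions. -/
def nrmC (γ : ParamCircle → Plane) (c : Fin 2) : CircleFun := toC (nrm γ c)

/-- The velocity, as a pair of continuous functions. -/
def velC (γ : ParamCircle → Plane) (c : Fin 2) : CircleFun := toC (vel γ c)

/-- The speed, as a continuous function. -/
def speedC (γ : ParamCircle → Plane) : CircleFun := toC (speed γ)

variable (hγ : IsRegularCurve (⊤ : ℕ∞) γ)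

include hγ

lemma nrmC_apply (c : Fin 2) (x : ParamCircle) : nrmC γ c x = nrm γ c x :=
  toC_apply (isSmooth_nrm hγ c).continuous x

lemma velC_apply (c : Fin 2) (x : ParamCircle) : velC γ c x = vel γ c x :=
  toC_apply (isSmooth_vel hγ c).continuous x

lemma speedC_apply (x : ParamCircle) : speedC γ x = speed γ x :=
  toC_apply (isSmooth_speed hγ).continuous x

/-- The tangent, known only almost everywhere, is replaced by the continuous velocity, a nonzero
multiple of it. The condition becomes the kernel of a bounded operator. -/
lemma mem_LTwoNormal_iff (u : LTwo) : u ∈ LTwoNormal γ ↔ dotL (velC γ) u = 0 := by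
  have h1 : ∀ᵐ x, (⟪u x, tangent γ x⟫ = 0 ↔ dotL (velC γ) u x = 0) := by
    filter_upwards [coeFn_dotL (velC γ) u, tangent_ae_eq hγ] with x hx ht
    rw [hx, ht, PiLp.inner_apply, velC_apply hγ, velC_apply hγ]
    have hs := (speed_pos hγ x).ne'
    simp only [Fin.sum_univ_two, RCLike.inner_apply, conj_trivial, PiLp.smul_apply, smul_eq_mul,
      field]
    rw [show (speed γ x)⁻¹ * vel γ 0 x * u x 0 + (speed γ x)⁻¹ * vel γ 1 x * u x 1
      = (speed γ x)⁻¹ * (vel γ 0 x * u x 0 + vel γ 1 x * u x 1) by ring]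
    simp [hs]
  change (∀ᵐ x, ⟪u x, tangent γ x⟫ = 0) ↔ _
  rw [Lp.eq_zero_iff_ae_eq_zero]
  constructor
  · intro h
    filter_upwards [h, h1] with x hx hx' using hx'.1 hx
  · intro h
    filter_upwards [h, h1] with x hx hx' using hx'.2 hx

lemma isClosed_LTwoNormal : IsClosed (LTwoNormal γ : Set LTwo) := by
  have : (LTwoNormal γ : Set LTwo) = {u | dotL (velC γ) u = 0} :=
    Set.ext fun u => mem_LTwoNormal_iff hγ u
  rw [this]
  exact isClosed_eq (dotL (velC γ)).continuous continuous_const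

lemma completeSpace_LTwoNormal : CompleteSpace (LTwoNormal γ) :=
  (isClosed_LTwoNormal hγ).completeSpace_coe

lemma completeSpace_SobolevNormal (m : ℕ) : CompleteSpace (SobolevNormal γ m) := by
  have : IsClosed (SobolevNormal γ m : Set (Sobolev m)) :=
    (isClosed_LTwoNormal hγ).preimage (Sobolev.toLTwo m).continuous
  exact this.completeSpace_coe

lemma smulField_mem (h : HTwo) : smulField (nrmC γ) h ∈ LTwoNormal γ := by
  rw [mem_LTwoNormal_iff hγ, Lp.eq_zero_iff_ae_eq_zero]
  filter_upwards [coeFn_dotL (velC γ) (smulField (nrmC γ) h), coeFn_smulField (nrmC γ) h]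
    with x h1 h2
  obtain ⟨h3, h4⟩ := vel_eq_nrm hγ x
  rw [h1, h2, velC_apply hγ, velC_apply hγ, h3, h4]
  simp only [field, nrmC_apply hγ, Pi.zero_apply]
  ring

/-- The normal field with a given normal component. -/
def normalVec : HTwo →L[ℝ] LTwoNormal γ :=
  (smulField (nrmC γ)).codRestrict (LTwoNormal γ) (smulField_mem hγ)

lemma coe_normalVec (h : HTwo) : (normalVec hγ h : LTwo) = smulField (nrmC γ) h := rfl

lemma dotL_smulField (h : HTwo) : dotL (nrmC γ) (smulField (nrmC γ) h) = h := by
  refine Lp.ext ?_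
  filter_upwards [coeFn_dotL (nrmC γ) (smulField (nrmC γ) h), coeFn_smulField (nrmC γ) h]
    with x h1 h2
  have h3 := nrm_sq hγ x
  rw [h1, h2]
  simp only [field, nrmC_apply hγ]
  linear_combination h x * h3

/-- In the plane the normal line is spanned by n, so a normal field is determined by its normal
component. With `dotL_smulField` this identifies the normal L²-fields with scalar functions in L².
-/
lemma smulField_dotL {u : LTwo} (hu : u ∈ LTwoNormal γ) :
    smulField (nrmC γ) (dotL (nrmC γ) u) = u := by
  rw [mem_LTwoNormal_iff hγ, Lp.eq_zero_iff_ae_eq_zero] at hu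
  refine Lp.ext ?_
  filter_upwards [hu, coeFn_dotL (velC γ) u, coeFn_dotL (nrmC γ) u,
    coeFn_smulField (nrmC γ) (dotL (nrmC γ) u)] with x h0 h1 h2 h3
  obtain ⟨h4, h5⟩ := vel_eq_nrm hγ x
  have h6 := nrm_sq hγ x
  rw [h0, velC_apply hγ, velC_apply hγ, h4, h5, Pi.zero_apply] at h1
  have h7 : nrm γ 1 x * u x 0 - nrm γ 0 x * u x 1 = 0 := by
    have h8 := (speed_pos hγ x).ne'
    have : speed γ x * (nrm γ 1 x * u x 0 - nrm γ 0 x * u x 1) = 0 := by linarith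
    exact (mul_eq_zero.1 this).resolve_left h8
  rw [h3]
  ext c
  simp only [field, h2, nrmC_apply hγ]
  fin_cases c
  · change (nrm γ 0 x * u x 0 + nrm γ 1 x * u x 1) * nrm γ 0 x = u x 0
    linear_combination u x 0 * h6 - nrm γ 1 x * h7
  · change (nrm γ 0 x * u x 0 + nrm γ 1 x * u x 1) * nrm γ 1 x = u x 1
    linear_combination u x 1 * h6 + nrm γ 0 x * h7

omit hγ in
/-- The arclength derivatives of order less than four of the normal component of a field. -/
def normalJet (γ : ParamCircle → Plane) (k : ℕ) : Sobolev 4 →L[ℝ] CircleFun :=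
  ∑ i : Fin 4, ∑ c, (ContinuousLinearMap.mul ℝ CircleFun (toC (normalCoeff γ k i c))) ∘L jet i c

omit hγ in
/-- The fourth arclength derivative of the normal component of a field. -/
def normalTop (γ : ParamCircle → Plane) : Sobolev 4 →L[ℝ] HTwo :=
  ∑ i : Fin 5, ∑ c, mulL (toC (normalCoeff γ 4 i c)) ∘L coord c ∘L Sobolev.der i

lemma normalJet_apply (k : ℕ) (u : Sobolev 4) (x : ParamCircle) : normalJet γ k u x =
    ∑ i : Fin 4, ∑ c, normalCoeff γ k i c x * jet i c u x := by
  simp only [normalJet, sum_apply, ContinuousMap.sum_apply,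
    ContinuousLinearMap.comp_apply, ContinuousLinearMap.mul_apply', ContinuousMap.mul_apply,
    toC_apply (isSmooth_normalCoeff hγ _ _ _).continuous]

lemma coeFn_normalTop (u : Sobolev 4) : normalTop γ u =ᵐ[volume] fun x =>
    ∑ i : Fin 5, ∑ c, normalCoeff γ 4 i c x * coord c (Sobolev.der i u) x := by
  have h0 : normalTop γ u = ∑ p : Fin 5 × Fin 2,
      mulL (toC (normalCoeff γ 4 p.1 p.2)) (coord p.2 (Sobolev.der p.1 u)) := by
    rw [Fintype.sum_prod_type]
    simp [normalTop]
  rw [h0]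
  have h1 : ∀ᵐ x, ∀ p : Fin 5 × Fin 2,
      mulL (toC (normalCoeff γ 4 p.1 p.2)) (coord p.2 (Sobolev.der p.1 u)) x =
      normalCoeff γ 4 p.1 p.2 x * coord p.2 (Sobolev.der p.1 u) x := by
    rw [ae_all_iff]
    intro p
    filter_upwards [coeFn_mulL (toC (normalCoeff γ 4 p.1 p.2)) (coord p.2 (Sobolev.der p.1 u))]
      with x hx
    rw [hx, toC_apply (isSmooth_normalCoeff hγ _ _ _).continuous]
  filter_upwards [Lp.coeFn_finsetSum Finset.univ fun p : Fin 5 × Fin 2 =>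
      mulL (toC (normalCoeff γ 4 p.1 p.2)) (coord p.2 (Sobolev.der p.1 u)), h1] with x hx hx'
  rw [hx, Finset.sum_apply, Fintype.sum_prod_type]
  exact Finset.sum_congr rfl fun i _ => Finset.sum_congr rfl fun c _ => hx' (i, c)

/-- The recursion defining `normalCoeff` is the product rule. Since k < 4, the coefficient of the
fourth derivative vanishes at stage k, and only derivatives that possess a primitive relation are
differentiated. -/
lemma hasPrim_normalJet_aux {k : ℕ} (hk : k < 4) (u : Sobolev 4) :
    HasPrim (normalJet γ k u) fun x => speed γ x *
      ∑ i : Fin 5, ∑ c, normalCoeff γ (k + 1) i c x * coord c (Sobolev.der i u) x := by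
  have h1 := HasPrim.sum (Finset.univ : Finset (Fin 4)) fun i _ =>
    HasPrim.sum (Finset.univ : Finset (Fin 2)) fun c _ =>
      (isSmooth_normalCoeff hγ k i c).hasPrim.mul (hasPrim_jet i c u)
  have h2 : ⇑(normalJet γ k u) = fun x =>
      ∑ i : Fin 4, ∑ c, normalCoeff γ k i c x * jet i c u x :=
    funext fun x => normalJet_apply hγ k u x
  rw [h2]
  refine h1.congr_right ?_
  have h3 : ∀ᵐ x, ∀ (i : Fin 4) (c : Fin 2),
      coord c (Sobolev.der i.castSucc u) x = jet i c u x := by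
    rw [ae_all_iff]
    intro i
    rw [ae_all_iff]
    intro c
    rw [← toH_jet]
    exact coeFn_toH _
  filter_upwards [h3] with x hx
  have hs := (speed_pos hγ x).ne'
  have e0 : ∀ c, normalCoeff γ (k + 1) 0 c x =
    (speed γ x)⁻¹ * circleDeriv (normalCoeff γ k 0 c) x := fun c => rfl
  have e1 : ∀ i c, normalCoeff γ (k + 1) (i + 1) c x =
    (speed γ x)⁻¹ * (circleDeriv (normalCoeff γ k (i + 1) c) x + normalCoeff γ k i c x) :=
    fun i c => rfl
  have e4 : ∀ c, circleDeriv (normalCoeff γ k 4 c) x = 0 := fun c => by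
    rw [normalCoeff_eq_zero γ hk, circleDeriv_zero]; rfl
  have e5 : ∀ c, circleDeriv (normalCoeff γ k (3 + 1) c) x = 0 := e4
  rw [Fin.sum_univ_succ]
  simp only [Fin.val_zero, Fin.val_succ, e0, e1]
  simp only [← hx]
  simp only [Fin.sum_univ_four, Fin.sum_univ_two]
  simp only [Fin.val_zero, Fin.val_one, Fin.val_two, show ((3 : Fin 4) : ℕ) = 3 from rfl,
    e5, zero_add, show (0 : Fin 4).castSucc = 0 from rfl,
    show (1 : Fin 4).castSucc = (0 : Fin 4).succ from rfl,
    show (2 : Fin 4).castSucc = (1 : Fin 4).succ from rfl,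
    show (3 : Fin 4).castSucc = (2 : Fin 4).succ from rfl]
  norm_num only
  field_simp
  ring

/-- For k < 3 the new order k + 1 is still below four, so the square integrable fourth derivative
does not enter and the result is continuous. -/
lemma hasPrim_normalJet {k : ℕ} (hk : k < 3) (u : Sobolev 4) :
    HasPrim (normalJet γ k u) fun x => speed γ x * normalJet γ (k + 1) u x := by
  refine (hasPrim_normalJet_aux hγ (by omega) u).congr_right ?_
  have h3 : ∀ᵐ x, ∀ (i : Fin 4) (c : Fin 2),
      coord c (Sobolev.der i.castSucc u) x = jet i c u x := by
    rw [ae_all_iff]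
    intro i
    rw [ae_all_iff]
    intro c
    rw [← toH_jet]
    exact coeFn_toH _
  filter_upwards [h3] with x hx
  rw [normalJet_apply hγ, Fin.sum_univ_castSucc (n := 4)]
  simp only [Fin.val_last, normalCoeff_eq_zero γ (show k + 1 < 4 by omega), hx, Fin.val_castSucc]
  simp

lemma hasPrim_normalJet_three (u : Sobolev 4) :
    HasPrim (normalJet γ 3 u) fun x => speed γ x * normalTop γ u x := by
  refine (hasPrim_normalJet_aux hγ (by omega) u).congr_right ?_
  filter_upwards [coeFn_normalTop hγ u] with x hx
  rw [hx]

lemma toH_normalJet_zero (u : Sobolev 4) :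
    toH (normalJet γ 0 u) = dotL (nrmC γ) (Sobolev.toLTwo 4 u) := by
  refine Lp.ext ?_
  filter_upwards [coeFn_toH (normalJet γ 0 u), coeFn_dotL (nrmC γ) (Sobolev.toLTwo 4 u),
    jet_ae_eq 0 0 u, jet_ae_eq 0 1 u] with x h1 h2 h3 h4
  rw [h1, h2, normalJet_apply hγ, nrmC_apply hγ, nrmC_apply hγ, Fin.sum_univ_succ]
  have h5 : ∀ (i : Fin 3) (c : Fin 2), normalCoeff γ 0 (i.succ : Fin 4) c = 0 := fun i c =>
    normalCoeff_eq_zero γ (by simp) c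
  simp only [h5, Fin.sum_univ_two, h3, h4]
  simp only [Pi.zero_apply, zero_mul, add_zero, Finset.sum_const_zero]
  rfl

lemma coe_incl_ae_eq (φ : SobolevNormal γ 4) : (SobolevNormal.incl γ 4 φ : LTwo) =ᵐ[volume]
    field fun c x => normalJet γ 0 (φ : Sobolev 4) x * nrm γ c x := by
  have h0 : (SobolevNormal.incl γ 4 φ : LTwo) =
      smulField (nrmC γ) (toH (normalJet γ 0 (φ : Sobolev 4))) := by
    rw [toH_normalJet_zero hγ]
    exact (smulField_dotL hγ (SobolevNormal.incl γ 4 φ).2).symm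
  rw [h0]
  filter_upwards [coeFn_smulField (nrmC γ) (toH (normalJet γ 0 (φ : Sobolev 4))),
    coeFn_toH (normalJet γ 0 (φ : Sobolev 4))] with x h1 h2
  rw [h1]
  simp only [field, h2, nrmC_apply hγ]

/-- Each normal derivative acts on f·n as the arclength derivative on f, so the iteration runs
through `normalJet γ 1`, `normalJet γ 2`, `normalJet γ 3` and ends in `normalTop γ`. -/
lemma normalArcDeriv_iterate_four (φ : SobolevNormal γ 4) :
    (normalArcDeriv γ)^[4] (fun y => (SobolevNormal.incl γ 4 φ : LTwo) y) =ᵐ[volume]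
      smulField (nrmC γ) (normalTop γ (φ : Sobolev 4)) := by
  set u : Sobolev 4 := φ.1
  have h0 := coe_incl_ae_eq hγ φ
  have h1 := normalArcDeriv_of_hasPrim hγ h0 (hasPrim_normalJet hγ (by norm_num) u)
  have h2 := normalArcDeriv_of_hasPrim hγ h1 (hasPrim_normalJet hγ (by norm_num) u)
  have h3 := normalArcDeriv_of_hasPrim hγ h2 (hasPrim_normalJet hγ (by norm_num) u)
  have h4 := normalArcDeriv_of_hasPrim hγ h3 (hasPrim_normalJet_three hγ u)
  refine h4.trans ?_
  filter_upwards [coeFn_smulField (nrmC γ) (normalTop γ u)] with x hx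
  rw [hx]
  simp only [field, nrmC_apply hγ]

end Operator

end ElasticCurve

end

noncomputable section

namespace ElasticCurve

/-! ### Construction of Sobolev fields -/

lemma HasPrim.unique {f g g' : ParamCircle → ℝ} (h : HasPrim f g) (h' : HasPrim f g') :
    g =ᵐ[volume] g' := by
  refine ae_of_ae_coe_Ioo (p := fun x => g x = g' x) ?_
  filter_upwards [h.ae_hasDerivAt, h'.ae_hasDerivAt] with t ht ht' _ using ht.unique ht'

lemma memLp_of_continuous {f : ParamCircle → ℝ} (h : Continuous f) : MemLp f 2 volume := by
  obtain ⟨C, hC⟩ := HasPrim.exists_bound h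
  exact MemLp.of_bound h.aestronglyMeasurable C (Filter.Eventually.of_forall hC)

lemma ae_eq_field {u : LTwo} {f : Fin 2 → ParamCircle → ℝ}
    (h : ∀ c, coord c u =ᵐ[volume] f c) : u =ᵐ[volume] field f := by
  filter_upwards [coeFn_coord 0 u, coeFn_coord 1 u, h 0, h 1] with x h0 h1 h2 h3
  ext c
  fin_cases c
  · exact h0.symm.trans h2
  · exact h1.symm.trans h3

/-- Uniqueness of weak derivatives, applied successively to all orders. -/
lemma Sobolev.ext_toLTwo {m : ℕ} {u v : Sobolev m} (h : toLTwo m u = toLTwo m v) : u = v := by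
  have key : ∀ i : Fin (m + 1), der i u = der i v := by
    intro i
    induction i using Fin.induction with
    | zero => exact h
    | succ i ih =>
      have h1 := hasWeakDeriv_der u i
      rw [ih] at h1
      exact Lp.ext (h1.unique (hasWeakDeriv_der v i))
  exact Subtype.ext (PiLp.ext key)

/-- A function on the circle of class `H^k`. -/
def IsSob : ℕ → (ParamCircle → ℝ) → Prop
  | 0, f => MemLp f 2 volume
  | k + 1, f => ∃ g, HasPrim f g ∧ IsSob k g

namespace IsSob

lemma of_succ {k : ℕ} {f : ParamCircle → ℝ} (h : IsSob (k + 1) f) : IsSob k f := by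
  induction k generalizing f with
  | zero =>
    obtain ⟨g, hg, -⟩ := h
    exact memLp_of_continuous hg.continuous
  | succ k ih =>
    obtain ⟨g, hg, hg'⟩ := h
    exact ⟨g, hg, ih hg'⟩

lemma add {k : ℕ} {f f' : ParamCircle → ℝ} (h : IsSob k f) (h' : IsSob k f') :
    IsSob k fun x => f x + f' x := by
  induction k generalizing f f' with
  | zero => exact MemLp.add h h'
  | succ k ih =>
    obtain ⟨g, hg, hg2⟩ := h
    obtain ⟨g', hg', hg2'⟩ := h'
    exact ⟨_, hg.add hg', ih hg2 hg2'⟩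

lemma smooth_mul {k : ℕ} {a f : ParamCircle → ℝ} (ha : IsSmooth a) (h : IsSob k f) :
    IsSob k fun x => a x * f x := by
  induction k generalizing a f with
  | zero =>
    obtain ⟨C, hC⟩ := HasPrim.exists_bound ha.continuous
    exact MemLp.of_bilin (p := ⊤) (q := 2) (fun x y => x * y) 1
      (memLp_top_of_bound ha.continuous.aestronglyMeasurable C (Filter.Eventually.of_forall hC)) h
      (ha.continuous.aestronglyMeasurable.mul h.1)
      (Filter.Eventually.of_forall fun x => by simp)
  | succ k ih =>
    have hk := h.of_succ
    obtain ⟨g, hg, hg2⟩ := h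
    exact ⟨_, ha.hasPrim.mul hg, (ih ha.circleDeriv hk).add (ih ha hg2)⟩

lemma exists_seq {m : ℕ} {f : ParamCircle → ℝ} (h : IsSob m f) :
    ∃ d : ℕ → ParamCircle → ℝ, d 0 = f ∧ (∀ i < m, HasPrim (d i) (d (i + 1))) ∧
      ∀ i ≤ m, MemLp (d i) 2 volume := by
  induction m generalizing f with
  | zero => exact ⟨fun _ => f, rfl, by simp, fun i _ => h⟩
  | succ m ih =>
    obtain ⟨g, hg, hg2⟩ := h
    obtain ⟨d, h0, h1, h2⟩ := ih hg2
    refine ⟨fun i => Nat.casesOn i f d, rfl, fun i hi => ?_, fun i hi => ?_⟩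
    · rcases i with _ | i
      · change HasPrim f (d 0)
        rwa [h0]
      · exact h1 i (by omega)
    · rcases i with _ | i
      · exact memLp_of_continuous hg.continuous
      · exact h2 i (by omega)

lemma exists_sobolev {m : ℕ} {f : Fin 2 → ParamCircle → ℝ} (h : ∀ c, IsSob m (f c)) :
    ∃ u : Sobolev m, ∀ c, coord c (Sobolev.toLTwo m u) =ᵐ[volume] f c := by
  choose d h0 h1 h2 using fun c => (h c).exists_seq
  let w : Fin (m + 1) → LTwo := fun i => ∑ c, vec c ((h2 c i (Nat.lt_succ_iff.1 i.2)).toLp)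
  have hw : ∀ i c, coord c (w i) =ᵐ[volume] d c i := by
    intro i c
    have : coord c (w i) = (h2 c i (Nat.lt_succ_iff.1 i.2)).toLp := by
      fin_cases c <;> simp [w, coord_vec]
    rw [this]
    exact MemLp.coeFn_toLp _
  refine ⟨⟨WithLp.toLp 2 w, fun i => ?_⟩, fun c => ?_⟩
  · exact (HasWeakDeriv.of_hasPrim (f := field fun c => d c i) (g := field fun c => d c (i + 1))
      fun c => h1 c i i.2).congr (ae_eq_field fun c => hw _ c) (ae_eq_field fun c => hw _ c)
  · have := hw 0 c
    rw [Fin.val_zero, h0] at this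
    exact this

end IsSob

/-! ### Invertibility of `id + (∂_s^⊥)⁴` -/

lemma isCompactOperator_sum {ι V W : Type*} [NormedAddCommGroup V] [NormedSpace ℝ V]
    [NormedAddCommGroup W] [NormedSpace ℝ W] (s : Finset ι) (f : ι → V →L[ℝ] W)
    (h : ∀ i ∈ s, IsCompactOperator (f i)) : IsCompactOperator (∑ i ∈ s, f i : V →L[ℝ] W) := by
  classical
  induction s using Finset.induction_on with
  | empty => simpa using isCompactOperator_zero
  | insert i s hi ih =>
    rw [Finset.sum_insert hi]
    exact (h i (by simp)).add (ih fun j hj => h j (by simp [hj]))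

lemma isCompactOperator_normalJet (γ : ParamCircle → Plane) (k : ℕ) :
    IsCompactOperator (normalJet γ k) := by
  rw [normalJet]
  exact isCompactOperator_sum _ _ fun i _ => isCompactOperator_sum _ _ fun c _ =>
    (isCompactOperator_jet i c).clm_comp
      (ContinuousLinearMap.mul ℝ CircleFun (toC (normalCoeff γ k i c)))

scoped instance instNormedAddCommGroupLTwoNormal (γ : ParamCircle → Plane) :
    NormedAddCommGroup (LTwoNormal γ) := Submodule.normedAddCommGroup _

scoped instance instNormedSpaceLTwoNormal (γ : ParamCircle → Plane) :
    NormedSpace ℝ (LTwoNormal γ) := Submodule.normedSpace _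

scoped instance instNormedAddCommGroupSobolevNormal (γ : ParamCircle → Plane) (m : ℕ) :
    NormedAddCommGroup (SobolevNormal γ m) := Submodule.normedAddCommGroup _

scoped instance instNormedSpaceSobolevNormal (γ : ParamCircle → Plane) (m : ℕ) :
    NormedSpace ℝ (SobolevNormal γ m) := Submodule.normedSpace _

scoped instance instInnerProductSpaceLTwoNormal (γ : ParamCircle → Plane) :
    InnerProductSpace ℝ (LTwoNormal γ) := Submodule.innerProductSpace _

scoped instance instInnerProductSpaceSobolevNormal (γ : ParamCircle → Plane) (m : ℕ) :
    InnerProductSpace ℝ (SobolevNormal γ m) := Submodule.innerProductSpace _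

scoped instance instNormedAddCommGroupStrongDualLTwoNormal (γ : ParamCircle → Plane) :
    NormedAddCommGroup (StrongDual ℝ (LTwoNormal γ)) := ContinuousLinearMap.toNormedAddCommGroup

scoped instance instNormedSpaceStrongDualLTwoNormal (γ : ParamCircle → Plane) :
    NormedSpace ℝ (StrongDual ℝ (LTwoNormal γ)) := ContinuousLinearMap.toNormedSpace

section Invertible

variable {γ : ParamCircle → Plane} (hγ : IsRegularCurve (⊤ : ℕ∞) γ)

include hγ

lemma integrable_speed_mul {f : ParamCircle → ℝ} (hf : Integrable f) :
    Integrable fun x => speed γ x * f x :=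
  HasPrim.integrable_mul (isSmooth_speed hγ).continuous hf

lemma integrable_speed : Integrable (speed γ) := by
  simpa using integrable_speed_mul hγ (integrable_const (1 : ℝ))

lemma integral_speed_pos : 0 < ∫ x, speed γ x := by
  rw [integral_pos_iff_support_of_nonneg (fun x => (speed_pos hγ x).le) (integrable_speed hγ)]
  have : Function.support (speed γ) = Set.univ :=
    Set.eq_univ_of_forall fun x => (speed_pos hγ x).ne'
  rw [this]
  simp [AddCircle.measure_univ, Real.pi_pos]

/-- The integral of a derivative over the closed curve vanishes, while that of the constant c is c
times the positive length. -/
lemma eq_zero_of_hasPrim_speed_mul_const {f : ParamCircle → ℝ} {c : ℝ}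
    (h : HasPrim f fun x => speed γ x * c) : c = 0 ∧ ∃ b : ℝ, ∀ x, f x = b := by
  have h1 := h.integral_eq_zero
  rw [integral_mul_const] at h1
  have hc : c = 0 := (mul_eq_zero.1 h1).resolve_left (integral_speed_pos hγ).ne'
  subst hc
  simp only [mul_zero] at h
  exact ⟨rfl, f 0, fun x => h.eq_of_zero x 0⟩

/-- The constant of integration is spent on making the primitive mean-free, so that the construction
can be repeated. -/
lemma exists_primitive_mean_zero {g : ParamCircle → ℝ} (hg : Integrable g)
    (h : ∫ x, speed γ x * g x = 0) :
    ∃ f : ParamCircle → ℝ, (HasPrim f fun x => speed γ x * g x) ∧ ∫ x, speed γ x * f x = 0 := by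
  obtain ⟨f, hf⟩ := HasPrim.exists_of_integral_eq_zero (integrable_speed_mul hγ hg) h
  have hfi : Integrable f := by
    simpa using HasPrim.integrable_mul hf.continuous (integrable_const (1 : ℝ))
  set b := (∫ x, speed γ x * f x) / ∫ x, speed γ x with hb
  refine ⟨fun x => f x + -b, by simpa using hf.add (HasPrim.const (-b)), ?_⟩
  simp only [mul_add]
  rw [integral_add (integrable_speed_mul hγ hfi)
    (integrable_speed_mul hγ (integrable_const (-b))), integral_mul_const, hb]
  have := (integral_speed_pos hγ).ne'
  field_simp
  ring

omit hγ in
/-- The mean value with respect to arclength. -/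
def arcMean (γ : ParamCircle → Plane) : HTwo →L[ℝ] ℝ :=
  (∫ x, speed γ x)⁻¹ • pairH (toH (speedC γ))

lemma arcMean_apply (h : HTwo) :
    arcMean γ h = (∫ x, speed γ x)⁻¹ * ∫ x, speed γ x * h x := by
  rw [arcMean, smul_apply, pairH_apply, smul_eq_mul]
  congr 1
  refine integral_congr_ae ?_
  filter_upwards [coeFn_toH (speedC γ)] with x hx
  rw [hx, speedC_apply hγ]

/-- The operator `id + (∂_s^⊥)⁴`. -/
def idAddFour : SobolevNormal γ 4 →L[ℝ] LTwoNormal γ :=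
  normalVec hγ ∘L (toH ∘L normalJet γ 0 + normalTop γ) ∘L (SobolevNormal γ 4).subtypeL

/-- The sum of `(∂_s^⊥)⁴` and the mean value of the normal component. -/
def meanAddFour : SobolevNormal γ 4 →L[ℝ] LTwoNormal γ :=
  normalVec hγ ∘L (ContinuousLinearMap.toSpanSingleton ℝ (toH 1) ∘L arcMean γ ∘L
    toH ∘L normalJet γ 0 + normalTop γ) ∘L (SobolevNormal γ 4).subtypeL

lemma normalVec_injective : Function.Injective (normalVec hγ) := by
  intro h h' heq
  have := congrArg (fun u : LTwoNormal γ => dotL (nrmC γ) (u : LTwo)) heq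
  simpa [coe_normalVec, dotL_smulField hγ] using this

lemma eq_zero_of_normalJet_eq_zero {φ : SobolevNormal γ 4}
    (h : normalJet γ 0 (φ : Sobolev 4) = 0) : φ = 0 := by
  refine Subtype.ext (Sobolev.ext_toLTwo ?_)
  have h1 := smulField_dotL hγ (SobolevNormal.incl γ 4 φ).2
  have h2 : Sobolev.toLTwo 4 (φ : Sobolev 4) = (SobolevNormal.incl γ 4 φ : LTwo) := rfl
  rw [h2, ← h1]
  change smulField (nrmC γ) (dotL (nrmC γ) (Sobolev.toLTwo 4 (φ : Sobolev 4))) = _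
  rw [← toH_normalJet_zero hγ, h]
  simp

/-- If ∂_s⁴f = -m with m the mean of f, periodicity gives m = 0 and makes ∂_s³f constant.
Descending, each lower derivative is constant too, and finally f = m = 0. -/
lemma meanAddFour_injective : Function.Injective (meanAddFour hγ) := by
  refine (injective_iff_map_eq_zero (meanAddFour hγ)).2 fun φ hφ => ?_
  refine eq_zero_of_normalJet_eq_zero hγ ?_
  set u : Sobolev 4 := φ.1
  have h1 := normalVec_injective hγ (hφ.trans (map_zero (normalVec hγ)).symm)
  set m := arcMean γ (toH (normalJet γ 0 u)) with hm
  have h2 : m • toH 1 + normalTop γ u = 0 := h1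
  have h3 : normalTop γ u =ᵐ[volume] fun _ => -m := by
    have h4 : normalTop γ u = toH (algebraMap ℝ CircleFun (-m)) := by
      rw [Algebra.algebraMap_eq_smul_one, map_smul, neg_smul, eq_neg_iff_add_eq_zero, add_comm]
      exact h2
    rw [h4]
    refine (coeFn_toH _).trans (Filter.Eventually.of_forall fun x => ?_)
    simp
  have p3 : HasPrim (normalJet γ 3 u) fun x => speed γ x * (-m) := by
    refine (hasPrim_normalJet_three hγ u).congr_right ?_
    filter_upwards [h3] with x hx
    rw [hx]
  obtain ⟨hm0, b3, hb3⟩ := eq_zero_of_hasPrim_speed_mul_const hγ p3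
  have step : ∀ k < 3, ∀ b : ℝ, (∀ x, normalJet γ (k + 1) u x = b) →
      b = 0 ∧ ∃ b' : ℝ, ∀ x, normalJet γ k u x = b' := by
    intro k hk b hb
    have p := hasPrim_normalJet hγ hk u
    simp only [hb] at p
    exact eq_zero_of_hasPrim_speed_mul_const hγ p
  obtain ⟨-, b2, hb2⟩ := step 2 (by norm_num) b3 hb3
  obtain ⟨-, b1, hb1⟩ := step 1 (by norm_num) b2 hb2
  obtain ⟨-, b0, hb0⟩ := step 0 (by norm_num) b1 hb1
  have h5 : m = b0 := by
    rw [hm, arcMean_apply hγ]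
    have h6 : ∫ x, speed γ x * toH (normalJet γ 0 u) x = ∫ x, speed γ x * b0 := by
      refine integral_congr_ae ?_
      filter_upwards [coeFn_toH (normalJet γ 0 u)] with x hx
      rw [hx, hb0]
    rw [h6, integral_mul_const, inv_mul_cancel_left₀ (integral_speed_pos hγ).ne']
  ext x
  rw [hb0, ← h5]
  simpa using hm0

/-- For a datum h of mean m, integrate h - m four times, keeping mean zero, and call the result f0.
Then f0 + m has mean m and fourth derivative h - m, so it is mapped to h. -/
lemma meanAddFour_surjective : Function.Surjective (meanAddFour hγ) := by
  intro w
  set h : HTwo := dotL (nrmC γ) (w : LTwo) with hh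
  set m := arcMean γ h with hm
  have hhi : Integrable fun x => h x + -m := (HTwo.integrable h).add (integrable_const _)
  have hz : ∫ x, speed γ x * (h x + -m) = 0 := by
    simp only [mul_add]
    rw [integral_add (integrable_speed_mul hγ (HTwo.integrable h))
      (integrable_speed_mul hγ (integrable_const (-m))), integral_mul_const, hm,
      arcMean_apply hγ]
    have := (integral_speed_pos hγ).ne'
    field_simp
    ring
  have hcont : ∀ {f g : ParamCircle → ℝ}, HasPrim f g → Integrable f := fun hf => by
    simpa using HasPrim.integrable_mul hf.continuous (integrable_const (1 : ℝ))
  obtain ⟨f3, hf3, z3⟩ := exists_primitive_mean_zero hγ hhi hz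
  obtain ⟨f2, hf2, z2⟩ := exists_primitive_mean_zero hγ (hcont hf3) z3
  obtain ⟨f1, hf1, z1⟩ := exists_primitive_mean_zero hγ (hcont hf2) z2
  obtain ⟨f0, hf0, z0⟩ := exists_primitive_mean_zero hγ (hcont hf1) z1
  have hF : HasPrim (fun x => f0 x + m) fun x => speed γ x * f1 x := by
    simpa using hf0.add (HasPrim.const m)
  have hs := isSmooth_speed hγ
  have s0 : IsSob 0 fun x => h x + -m := (Lp.memLp h).add (memLp_const _)
  have s1 : IsSob 1 f3 := ⟨_, hf3, s0.smooth_mul hs⟩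
  have s2 : IsSob 2 f2 := ⟨_, hf2, s1.smooth_mul hs⟩
  have s3 : IsSob 3 f1 := ⟨_, hf1, s2.smooth_mul hs⟩
  have s4 : IsSob 4 fun x => f0 x + m := ⟨_, hF, s3.smooth_mul hs⟩
  obtain ⟨u, hu⟩ := IsSob.exists_sobolev fun c => s4.smooth_mul (isSmooth_nrm hγ c)
  have hcoe : Sobolev.toLTwo 4 u =ᵐ[volume] field fun c x => nrm γ c x * (f0 x + m) :=
    ae_eq_field hu
  have hmem : Sobolev.toLTwo 4 u ∈ LTwoNormal γ := by
    rw [mem_LTwoNormal_iff hγ, Lp.eq_zero_iff_ae_eq_zero]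
    filter_upwards [hcoe, coeFn_dotL (velC γ) (Sobolev.toLTwo 4 u)] with x hx hx'
    obtain ⟨h3, h4⟩ := vel_eq_nrm hγ x
    rw [hx', hx, velC_apply hγ, velC_apply hγ, h3, h4]
    simp only [field, Pi.zero_apply]
    ring
  have cont_eq : ∀ {a : CircleFun} {f : ParamCircle → ℝ}, Continuous f → a =ᵐ[volume] f →
      ∀ x, a x = f x := fun {a f} hf hae => congrFun
    ((Continuous.ae_eq_iff_eq volume a.continuous hf).1 hae)
  have j0 : ∀ x, normalJet γ 0 u x = f0 x + m := by
    refine cont_eq hF.continuous ?_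
    have h1 := coeFn_toH (normalJet γ 0 u)
    rw [toH_normalJet_zero hγ] at h1
    filter_upwards [h1, coeFn_dotL (nrmC γ) (Sobolev.toLTwo 4 u), hcoe] with x h1 h2 h3
    rw [← h1, h2, h3, nrmC_apply hγ, nrmC_apply hγ]
    simp only [field]
    linear_combination (f0 x + m) * nrm_sq hγ x
  -- Derivatives are unique and the speed is nonzero, so the normal jets of u are identified with
  -- f1, f2, f3 and h - m one after another.
  have cancel : ∀ {f a b : ParamCircle → ℝ}, (HasPrim f fun x => speed γ x * a x) →
      (HasPrim f fun x => speed γ x * b x) → a =ᵐ[volume] b := by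
    intro f a b ha hb
    filter_upwards [ha.unique hb] with x hx
    exact mul_left_cancel₀ (speed_pos hγ x).ne' hx
  have p0 := hasPrim_normalJet hγ (show 0 < 3 by norm_num) u
  rw [show ⇑(normalJet γ 0 u) = fun x => f0 x + m from funext j0] at p0
  have j1 := cont_eq hf1.continuous (cancel p0 hF)
  have p1 := hasPrim_normalJet hγ (show 1 < 3 by norm_num) u
  rw [show ⇑(normalJet γ 1 u) = f1 from funext j1] at p1
  have j2 := cont_eq hf2.continuous (cancel p1 hf1)
  have p2 := hasPrim_normalJet hγ (show 2 < 3 by norm_num) u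
  rw [show ⇑(normalJet γ 2 u) = f2 from funext j2] at p2
  have j3 := cont_eq hf3.continuous (cancel p2 hf2)
  have p3 := hasPrim_normalJet_three hγ u
  rw [show ⇑(normalJet γ 3 u) = f3 from funext j3] at p3
  have j4 := cancel p3 hf3
  have hmean : arcMean γ (toH (normalJet γ 0 u)) = m := by
    rw [arcMean_apply hγ]
    have h1 : ∫ x, speed γ x * toH (normalJet γ 0 u) x = (∫ x, speed γ x) * m := by
      have h2 : ∫ x, speed γ x * toH (normalJet γ 0 u) x
          = ∫ x, (speed γ x * f0 x + speed γ x * m) := by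
        refine integral_congr_ae ?_
        filter_upwards [coeFn_toH (normalJet γ 0 u)] with x hx
        rw [hx, j0, mul_add]
      rw [h2, integral_add (integrable_speed_mul hγ (hcont hf0))
        (integrable_speed_mul hγ (integrable_const m)), z0, integral_mul_const, zero_add]
    rw [h1, inv_mul_cancel_left₀ (integral_speed_pos hγ).ne']
  refine ⟨⟨u, hmem⟩, Subtype.ext ?_⟩
  rw [← smulField_dotL hγ w.2]
  change smulField (nrmC γ) (arcMean γ (toH (normalJet γ 0 u)) • toH 1 + normalTop γ u) =
    smulField (nrmC γ) h
  congr 1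
  rw [hmean]
  refine Lp.ext ?_
  filter_upwards [Lp.coeFn_add (m • toH 1) (normalTop γ u), Lp.coeFn_smul m (toH 1),
    coeFn_toH 1, j4] with x h1 h2 h3 h4
  rw [h1, Pi.add_apply, h2, Pi.smul_apply, h3, h4]
  simp

/-- Multiply ∂_s⁴f = -f by f and integrate by parts twice: ∫ f² + (∂_s²f)² ds = 0. -/
lemma idAddFour_injective : Function.Injective (idAddFour hγ) := by
  refine (injective_iff_map_eq_zero (idAddFour hγ)).2 fun φ hφ => ?_
  refine eq_zero_of_normalJet_eq_zero hγ ?_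
  set u : Sobolev 4 := φ.1
  have h1 := normalVec_injective hγ (hφ.trans (map_zero (normalVec hγ)).symm)
  have h2 : toH (normalJet γ 0 u) + normalTop γ u = 0 := h1
  have h3 : normalTop γ u =ᵐ[volume] fun x => - normalJet γ 0 u x := by
    have h4 : normalTop γ u = toH (- normalJet γ 0 u) := by
      rw [map_neg, eq_neg_iff_add_eq_zero, add_comm]
      exact h2
    rw [h4]
    exact coeFn_toH _
  have p3 := hasPrim_normalJet_three hγ u
  have p0 := hasPrim_normalJet hγ (show 0 < 3 by norm_num) u
  have p1 := hasPrim_normalJet hγ (show 1 < 3 by norm_num) u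
  have p2 := hasPrim_normalJet hγ (show 2 < 3 by norm_num) u
  -- The derivative of f‴f - f″f′ along the curve is f⁗f - (f″)², with no boundary terms.
  have h5 := ((p3.mul p0).sub (p2.mul p1)).integral_eq_zero
  have h6 : ∫ x, speed γ x * (normalJet γ 0 u x ^ 2 + normalJet γ 2 u x ^ 2) = 0 := by
    rw [← neg_eq_zero, ← integral_neg, ← h5]
    refine integral_congr_ae ?_
    filter_upwards [h3] with x hx
    simp only [hx]
    ring
  have hcont : Continuous fun x =>
      speed γ x * (normalJet γ 0 u x ^ 2 + normalJet γ 2 u x ^ 2) := by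
    have := (isSmooth_speed hγ).continuous
    fun_prop
  have hnn : ∀ x, 0 ≤ speed γ x * (normalJet γ 0 u x ^ 2 + normalJet γ 2 u x ^ 2) := fun x =>
    mul_nonneg (speed_pos hγ x).le (by positivity)
  rw [integral_eq_zero_iff_of_nonneg hnn
    (hcont.integrable_of_hasCompactSupport (HasCompactSupport.of_compactSpace _))] at h6
  have h7 := (Continuous.ae_eq_iff_eq volume hcont continuous_const).1 h6
  ext x
  have h8 := congrFun h7 x
  have h9 := (mul_eq_zero.1 h8).resolve_left (speed_pos hγ x).ne'
  have h10 : normalJet γ 0 u x ^ 2 = 0 := by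
    nlinarith [sq_nonneg (normalJet γ 0 u x), sq_nonneg (normalJet γ 2 u x)]
  simpa using h10

/-- The difference from the isomorphism `meanAddFour` involves only f and its mean, so it is
compact. Injectivity then suffices by the Fredholm alternative. -/
lemma idAddFour_bijective : Function.Bijective (idAddFour hγ) := by
  have := completeSpace_LTwoNormal hγ
  have := completeSpace_SobolevNormal hγ 4
  let e : SobolevNormal γ 4 ≃L[ℝ] LTwoNormal γ := ContinuousLinearEquiv.ofBijective
    (meanAddFour hγ) (LinearMap.ker_eq_bot.2 (meanAddFour_injective hγ))
    (LinearMap.range_eq_top.2 (meanAddFour_surjective hγ))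
  let K : SobolevNormal γ 4 →L[ℝ] LTwoNormal γ :=
    (normalVec hγ ∘L (ContinuousLinearMap.id ℝ HTwo -
      ContinuousLinearMap.toSpanSingleton ℝ (toH 1) ∘L arcMean γ) ∘L toH) ∘L
        (normalJet γ 0 ∘L (SobolevNormal γ 4).subtypeL)
  have hK : IsCompactOperator K :=
    ((isCompactOperator_normalJet γ 0).comp_clm (SobolevNormal γ 4).subtypeL).clm_comp
      (normalVec hγ ∘L (ContinuousLinearMap.id ℝ HTwo -
        ContinuousLinearMap.toSpanSingleton ℝ (toH 1) ∘L arcMean γ) ∘L toH)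
  have hT : idAddFour hγ = (e : SobolevNormal γ 4 →L[ℝ] LTwoNormal γ) + K := by
    ext1 φ
    change normalVec hγ (toH (normalJet γ 0 φ) + normalTop γ φ) =
      normalVec hγ (arcMean γ (toH (normalJet γ 0 φ)) • toH 1 + normalTop γ φ) +
      normalVec hγ (toH (normalJet γ 0 φ) - arcMean γ (toH (normalJet γ 0 φ)) • toH 1)
    rw [← map_add]
    congr 1
    abel
  have h := isFredholmIndexZero_add_compact e K hK
  rw [← hT] at h
  exact h.bijective (idAddFour_injective hγ)

/-- The operator `id + (∂_s^⊥)⁴` as an isomorphism. -/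
def idAddFourEquiv : SobolevNormal γ 4 ≃L[ℝ] LTwoNormal γ :=
  haveI := completeSpace_LTwoNormal hγ
  haveI := completeSpace_SobolevNormal hγ 4
  ContinuousLinearEquiv.ofBijective (idAddFour hγ)
    (LinearMap.ker_eq_bot.2 (idAddFour_bijective hγ).1)
    (LinearMap.range_eq_top.2 (idAddFour_bijective hγ).2)

lemma idAddFourEquiv_apply (φ : SobolevNormal γ 4) : idAddFourEquiv hγ φ =
    normalVec hγ (toH (normalJet γ 0 (φ : Sobolev 4)) + normalTop γ (φ : Sobolev 4)) := rfl

lemma idAddFourEquiv_ae_eq (φ : SobolevNormal γ 4) :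
    ∀ᵐ x, (idAddFourEquiv hγ φ : LTwo) x = (SobolevNormal.incl γ 4 φ : LTwo) x +
      (normalArcDeriv γ)^[4] (fun y => (SobolevNormal.incl γ 4 φ : LTwo) y) x := by
  have h0 : (SobolevNormal.incl γ 4 φ : LTwo) =
      smulField (nrmC γ) (toH (normalJet γ 0 (φ : Sobolev 4))) := by
    rw [toH_normalJet_zero hγ]
    exact (smulField_dotL hγ (SobolevNormal.incl γ 4 φ).2).symm
  have h1 : (idAddFourEquiv hγ φ : LTwo) = (SobolevNormal.incl γ 4 φ : LTwo) +
      smulField (nrmC γ) (normalTop γ (φ : Sobolev 4)) := by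
    rw [idAddFourEquiv_apply, coe_normalVec, map_add, ← h0]
  filter_upwards [normalArcDeriv_iterate_four hγ φ, Lp.coeFn_add
    (SobolevNormal.incl γ 4 φ : LTwo) (smulField (nrmC γ) (normalTop γ (φ : Sobolev 4)))]
    with x h2 h3
  rw [h1, h3, h2]
  rfl

end Invertible

end ElasticCurve

end

noncomputable section

namespace ElasticCurve

/-! ### The jets of the curve `γ + u` -/

/-- Four derivatives (of order `0` to `3`) of the two coordinates of a curve. -/
abbrev JetSpace : Type := Fin 4 → Fin 2 → CircleFun

/-- The derivative of order `i` of a coordinate of `γ`. -/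
def coordDeriv (γ : ParamCircle → Plane) (i : ℕ) (c : Fin 2) : ParamCircle → ℝ :=
  circleDeriv^[i] fun x => γ x c

lemma coordDeriv_succ (γ : ParamCircle → Plane) (i : ℕ) (c : Fin 2) :
    coordDeriv γ (i + 1) c = circleDeriv (coordDeriv γ i c) := Function.iterate_succ_apply' _ _ _

/-- The derivatives of order less than four of a field of class `H⁴`. -/
def jets : Sobolev 4 →L[ℝ] JetSpace :=
  ContinuousLinearMap.pi fun i => ContinuousLinearMap.pi fun c => jet i c

lemma isCompactOperator_pi {ι V : Type*} [Fintype ι] {W : ι → Type*} [NormedAddCommGroup V]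
    [NormedSpace ℝ V] [∀ i, NormedAddCommGroup (W i)] [∀ i, NormedSpace ℝ (W i)]
    (f : ∀ i, V →L[ℝ] W i) (h : ∀ i, IsCompactOperator (f i)) :
    IsCompactOperator (ContinuousLinearMap.pi f) := by
  classical
  have : ContinuousLinearMap.pi f = ∑ i, ContinuousLinearMap.single ℝ W i ∘L f i := by
    ext v i
    simp [Finset.sum_apply]
  rw [this]
  exact isCompactOperator_sum _ _ fun i _ =>
    (h i).clm_comp (ContinuousLinearMap.single ℝ W i)

lemma isCompactOperator_jets : IsCompactOperator jets :=
  isCompactOperator_pi _ fun i => isCompactOperator_pi _ fun c => isCompactOperator_jet i c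

/-- The derivatives of `γ + u` of order less than four. -/
def curveJet (γ : ParamCircle → Plane) (u : Sobolev 4) : JetSpace :=
  (fun (i : Fin 4) (c : Fin 2) => toC (coordDeriv γ i c)) + jets u

/-- The derivative of `γ + u` of order four. -/
def curveTop (γ : ParamCircle → Plane) (c : Fin 2) (u : Sobolev 4) : HTwo :=
  toH (toC (coordDeriv γ 4 c)) + coord c (Sobolev.der 4 u)

/-- The squared speed. -/
def speedSq (ξ : JetSpace) : CircleFun := ξ 1 0 ^ 2 + ξ 1 1 ^ 2

/-- The inverse speed. -/
def invSpeed (ξ : JetSpace) : CircleFun := invSqrt (speedSq ξ)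

/-- The speed vanishes nowhere. -/
def IsImmersed (ξ : JetSpace) : Prop := ∀ x, 0 < speedSq ξ x

lemma speedSq_apply (ξ : JetSpace) (x : ParamCircle) :
    speedSq ξ x = ξ 1 0 x ^ 2 + ξ 1 1 x ^ 2 := rfl

lemma isOpen_isImmersed : IsOpen {ξ | IsImmersed ξ} := by
  have : Continuous speedSq := by unfold speedSq; fun_prop
  exact isOpen_positive.preimage this

lemma continuous_curveJet (γ : ParamCircle → Plane) : Continuous (curveJet γ) :=
  continuous_const.add jets.continuous

namespace IsImmersed

variable {ξ : JetSpace} (h : IsImmersed ξ) (x : ParamCircle)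

include h

lemma invSpeed_apply : invSpeed ξ x = (√(speedSq ξ x))⁻¹ := invSqrt_apply h x

lemma invSpeed_sq_mul : invSpeed ξ x ^ 2 * (ξ 1 0 x ^ 2 + ξ 1 1 x ^ 2) = 1 :=
  congrArg (fun f : CircleFun => f x) (invSqrt_sq_mul h)

lemma sqrt_speedSq : √(speedSq ξ x) = speedSq ξ x * invSpeed ξ x := by
  rw [h.invSpeed_apply, ← div_eq_mul_inv, Real.div_sqrt]

end IsImmersed

section CommRing

variable {R : Type*} [CommRing R]

/-- The integrand `|κ|² |∂_x c| + |∂_x c|` of the elastic energy in terms of derivatives of the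
coordinates `a`, `b` and of the inverse speed `r`. -/
def elasticDensity (a₁ b₁ a₂ b₂ r : R) : R :=
  (a₁ * b₂ - b₁ * a₂) ^ 2 * r ^ 5 + (a₁ ^ 2 + b₁ ^ 2) * r

end CommRing

/-- The integrand of the elastic energy. -/
def density (ξ : JetSpace) : CircleFun :=
  elasticDensity (ξ 1 0) (ξ 1 1) (ξ 2 0) (ξ 2 1) (invSpeed ξ)

/-! ### Regularity and energy of γ + u in terms of jets -/

section Jets

variable {γ : ParamCircle → Plane} (hγ : IsRegularCurve (⊤ : ℕ∞) γ)

include hγ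

lemma isSmooth_coordDeriv (i : ℕ) (c : Fin 2) : IsSmooth (coordDeriv γ i c) := by
  induction i with
  | zero => exact isSmooth_coord hγ c
  | succ i ih => rw [coordDeriv_succ]; exact ih.circleDeriv

lemma curveJet_apply (u : Sobolev 4) (i : Fin 4) (c : Fin 2) (x : ParamCircle) :
    curveJet γ u i c x = coordDeriv γ i c x + jet i c u x := by
  rw [← toC_apply (isSmooth_coordDeriv hγ i c).continuous]
  rfl

lemma isImmersed_curveJet_zero : IsImmersed (curveJet γ 0) := by
  intro x
  have := velSq_pos hγ x
  rw [speedSq_apply, curveJet_apply hγ, curveJet_apply hγ, map_zero, map_zero]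
  simpa [coordDeriv, vel] using this

lemma hasPrim_curveJet (u : Sobolev 4) {i j : Fin 4} (hij : i.succ = j.castSucc) (c : Fin 2) :
    HasPrim (curveJet γ u i c) (curveJet γ u j c) := by
  have h := (isSmooth_coordDeriv hγ i c).hasPrim
  rw [← coordDeriv_succ] at h
  have hj : (i : ℕ) + 1 = j := by simpa [Fin.ext_iff] using hij
  rw [hj] at h
  have h2 := h.add (hasPrim_jet_jet hij c u)
  rwa [show ⇑(curveJet γ u i c) = _ from funext (curveJet_apply hγ u i c),
    show ⇑(curveJet γ u j c) = _ from funext (curveJet_apply hγ u j c)]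

lemma coeFn_curveTop (u : Sobolev 4) (c : Fin 2) : curveTop γ c u =ᵐ[volume]
    fun x => coordDeriv γ 4 c x + coord c (Sobolev.der 4 u) x := by
  filter_upwards [Lp.coeFn_add (toH (toC (coordDeriv γ 4 c))) (coord c (Sobolev.der 4 u)),
    coeFn_toH (toC (coordDeriv γ 4 c))] with x h1 h2
  rw [curveTop, h1, Pi.add_apply, h2, toC_apply (isSmooth_coordDeriv hγ 4 c).continuous]

lemma hasPrim_curveJet_three (u : Sobolev 4) (c : Fin 2) :
    HasPrim (curveJet γ u 3 c) (curveTop γ c u) := by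
  have h := (isSmooth_coordDeriv hγ 3 c).hasPrim
  rw [← coordDeriv_succ] at h
  rw [show ⇑(curveJet γ u 3 c) = _ from funext (curveJet_apply hγ u 3 c)]
  exact (h.add (hasPrim_jet 3 c u)).congr_right (coeFn_curveTop hγ u c)

lemma add_ae_eq_field (u : Sobolev 4) :
    (fun x => γ x + Sobolev.toLTwo 4 u x) =ᵐ[volume] field fun c => curveJet γ u 0 c := by
  filter_upwards [jet_ae_eq 0 0 u, jet_ae_eq 0 1 u] with x h0 h1
  ext c
  have h : ∀ c, curveJet γ u 0 c x = γ x c + jet 0 c u x := fun c =>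
    curveJet_apply hγ u 0 c x
  fin_cases c
  · simp [field, h, h0]; rfl
  · simp [field, h, h1]; rfl

lemma hasDerivAt_curveJet (u : Sobolev 4) {i j : Fin 4} (hij : i.succ = j.castSucc) (c : Fin 2)
    (x : ℝ) : HasDerivAt (fun t : ℝ => curveJet γ u i c t) (curveJet γ u j c x) x :=
  (hasPrim_curveJet hγ u hij c).hasDerivAt (curveJet γ u j c).continuous x

lemma hasDerivAt_field_curveJet (u : Sobolev 4) (x : ℝ) :
    HasDerivAt (fun t : ℝ => field (fun c => curveJet γ u 0 c) t)
      (field (fun c => curveJet γ u 1 c) x) x :=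
  hasDerivAt_plane fun c => hasDerivAt_curveJet hγ u (by decide) c x

lemma isRegularCurve_of_isImmersed {u : Sobolev 4} (h : IsImmersed (curveJet γ u)) :
    IsRegularCurve 1 (field fun c => curveJet γ u 0 c) := by
  have hd : deriv (fun t : ℝ => field (fun c => curveJet γ u 0 c) t) =
      fun t : ℝ => field (fun c => curveJet γ u 1 c) t :=
    funext fun x => (hasDerivAt_field_curveJet hγ u x).deriv
  refine ⟨contDiff_one_iff_deriv.2
    ⟨fun x => (hasDerivAt_field_curveJet hγ u x).differentiableAt, ?_⟩, fun x hx => ?_⟩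
  · rw [hd]
    refine (PiLp.continuous_toLp 2 _).comp (continuous_pi fun c => ?_)
    exact (curveJet γ u 1 c).continuous.comp (AddCircle.continuous_mk' _)
  · rw [hd] at hx
    have h1 : ‖field (fun c => curveJet γ u 1 c) (x : ParamCircle)‖ = 0 := by
      simpa using hx
    rw [norm_field, ← speedSq_apply] at h1
    exact (Real.sqrt_pos.2 (h x)).ne' h1

/-- The regular curve c and the representative of γ + u are continuous and agree almost everywhere,
hence everywhere. The classical derivative of c is therefore the first jet. -/
lemma isImmersed_of_isRegularCurve {u : Sobolev 4} {c : ParamCircle → Plane}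
    (hc : IsRegularCurve 1 c) (h : ∀ᵐ x, c x = γ x + Sobolev.toLTwo 4 u x) :
    IsImmersed (curveJet γ u) := by
  have hcont : Continuous c := continuous_coinduced_dom.2 hc.contDiff.continuous
  have h0 : Continuous (field fun c => curveJet γ u 0 c) :=
    (PiLp.continuous_toLp 2 _).comp (continuous_pi fun c => (curveJet γ u 0 c).continuous)
  have h1 : c =ᵐ[volume] field fun c => curveJet γ u 0 c :=
    Filter.EventuallyEq.trans h (add_ae_eq_field hγ u)
  have heq := (Continuous.ae_eq_iff_eq volume hcont h0).1 h1
  intro x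
  induction x using QuotientAddGroup.induction_on with | H x =>
  have h2 := hc.deriv_ne_zero x
  rw [heq, (hasDerivAt_field_curveJet hγ u x).deriv] at h2
  have h3 := norm_pos_iff.2 h2
  rw [norm_field, ← speedSq_apply] at h3
  exact Real.sqrt_pos.1 h3

/-- Nonvanishing speed is an open condition on the jets, which depend continuously on the field in
H⁴, and it holds for γ itself. -/
lemma exists_isAdmissibleRadius : ∃ ρ : ℝ, 0 < ρ ∧ IsAdmissibleRadius γ ρ := by
  have hopen : IsOpen {u | IsImmersed (curveJet γ u)} :=
    isOpen_isImmersed.preimage (continuous_curveJet γ)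
  obtain ⟨ρ, hρ, hb⟩ := Metric.nhds_basis_closedBall.mem_iff.1
    (hopen.mem_nhds (isImmersed_curveJet_zero hγ))
  refine ⟨ρ, hρ, fun u hu => ⟨_, isRegularCurve_of_isImmersed hγ (hb (by simpa using hu)), ?_⟩⟩
  exact (add_ae_eq_field hγ u).symm

lemma IsAdmissibleRadius.isImmersed {ρ : ℝ} (h : IsAdmissibleRadius γ ρ) {u : Sobolev 4}
    (hu : ‖u‖ ≤ ρ) : IsImmersed (curveJet γ u) := by
  obtain ⟨c, hc, hae⟩ := h u hu
  exact isImmersed_of_isRegularCurve hγ hc hae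

lemma hasPrim_invSpeed {u : Sobolev 4} (h : IsImmersed (curveJet γ u)) :
    HasPrim (invSpeed (curveJet γ u)) fun x => -(invSpeed (curveJet γ u) x ^ 3 *
      (curveJet γ u 1 0 x * curveJet γ u 2 0 x + curveJet γ u 1 1 x * curveJet γ u 2 1 x)) := by
  set ξ := curveJet γ u
  refine HasPrim.of_hasDerivAt (by fun_prop) fun x => ?_
  have ha : ∀ c, HasDerivAt (fun t : ℝ => ξ 1 c t) (ξ 2 c x) x := fun c =>
    hasDerivAt_curveJet hγ u (by decide) c x
  have hq : HasDerivAt (fun t : ℝ => speedSq ξ t)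
      (2 * ξ 1 0 x * ξ 2 0 x + 2 * ξ 1 1 x * ξ 2 1 x) x := by
    refine (((ha 0).pow 2).add ((ha 1).pow 2)).congr_deriv ?_
    simp
  have hpos := h (x : ParamCircle)
  have := (hq.sqrt hpos.ne').inv (Real.sqrt_pos.2 hpos).ne'
  simp only [h.invSpeed_apply]
  refine this.congr_deriv ?_
  have h0 := (Real.sqrt_pos.2 hpos).ne'
  field_simp

/-- In the plane |κ|² = det(c', c″)² r⁶. Writing |c'| = |c'|² r leaves a polynomial in the jets and
r, the form needed for analyticity. -/
lemma elasticEnergy_eq {u : Sobolev 4} (h : IsImmersed (curveJet γ u)) :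
    elasticEnergy (fun x => γ x + Sobolev.toLTwo 4 u x) =
      integralCLM (density (curveJet γ u)) := by
  set ξ := curveJet γ u with hξ
  set c : ParamCircle → Plane := fun x => γ x + Sobolev.toLTwo 4 u x
  set r := invSpeed ξ with hr
  have p : ∀ k, HasPrim (ξ 1 k) (ξ 2 k) := hasPrim_curveJet hγ u (by decide)
  have pr := hasPrim_invSpeed hγ h
  have d1 : weakDeriv c =ᵐ[volume] field fun k => ξ 1 k :=
    (weakDeriv_congr (add_ae_eq_field hγ u)).trans
      (HasWeakDeriv.of_hasPrim fun k => hasPrim_curveJet hγ u (by decide) k).weakDeriv_eq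
  have hn : ∀ x, ‖field (fun k => ξ 1 k) x‖ = speedSq ξ x * r x := fun x => by
    rw [norm_field, ← speedSq_apply, h.sqrt_speedSq]
  have hni : ∀ x, ‖field (fun k => ξ 1 k) x‖⁻¹ = r x := fun x => by
    rw [norm_field, ← speedSq_apply, hr, h.invSpeed_apply]
  have d2 : arcDeriv c c =ᵐ[volume] field fun k x => r x * ξ 1 k x := by
    filter_upwards [d1] with x hx
    rw [arcDeriv, hx, hni]
    ext k
    simp [field]
  have d3 := (weakDeriv_congr d2).trans
    (HasWeakDeriv.of_hasPrim (g := field fun k x => _) fun k => pr.mul (p k)).weakDeriv_eq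
  have e1 : ∀ᵐ x, ‖curvature c x‖ ^ 2 * ‖weakDeriv c x‖ =
      (ξ 1 0 x * ξ 2 1 x - ξ 1 1 x * ξ 2 0 x) ^ 2 * r x ^ 5 := by
    filter_upwards [d1, d3] with x h1 h3
    rw [curvature, arcDeriv, h3, h1, hni, norm_smul, mul_pow, norm_field,
      Real.sq_sqrt (by positivity), hn, speedSq_apply, Real.norm_eq_abs, sq_abs]
    have h2 := h.invSpeed_sq_mul x
    rw [← hr] at h2
    generalize r x = r at *
    generalize ξ 1 0 x = a1 at *
    generalize ξ 2 0 x = a2 at *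
    generalize ξ 1 1 x = b1 at *
    generalize ξ 2 1 x = b2 at *
    -- Modulo r²|c'|² = 1 this is Lagrange's identity |c'|²|c″|² = ⟨c', c″⟩² + det(c', c″)².
    have e : r ^ 2 * ((-(r ^ 3 * (a1 * a2 + b1 * b2)) * a1 + r * a2) ^ 2 +
        (-(r ^ 3 * (a1 * a2 + b1 * b2)) * b1 + r * b2) ^ 2) = r ^ 6 * (a1 * b2 - b1 * a2) ^ 2 := by
      linear_combination (r ^ 6 * (a1 * a2 + b1 * b2) ^ 2 -
        r ^ 4 * (a2 ^ 2 + b2 ^ 2)) * h2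
    rw [e]
    linear_combination (r ^ 5 * (a1 * b2 - b1 * a2) ^ 2) * h2
  have e2 : ∀ᵐ x, ‖weakDeriv c x‖ = (ξ 1 0 x ^ 2 + ξ 1 1 x ^ 2) * r x := by
    filter_upwards [d1] with x h1
    rw [h1, hn, speedSq_apply]
  rw [elasticEnergy, integral_congr_ae e1, integral_congr_ae e2, integralCLM_apply,
    ← integral_add]
  · rfl
  all_goals
    refine Continuous.integrable_of_hasCompactSupport ?_ (HasCompactSupport.of_compactSpace _)
    fun_prop

end Jets

end ElasticCurve

end

noncomputable section

namespace ElasticCurve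

/-! ### The first variation of the elastic energy -/

section CommRing

variable {R : Type*} [CommRing R]

/-- The derivative of the elastic density with respect to `p₁`, for a curve with coordinates
`p`, `t` and inverse speed `r`. -/
def densityFst (p₁ p₂ t₁ t₂ r : R) : R :=
  2 * (p₁ * t₂ - t₁ * p₂) * t₂ * r ^ 5 - 5 * (p₁ * t₂ - t₁ * p₂) ^ 2 * r ^ 7 * p₁ + r * p₁

/-- The derivative of the elastic density with respect to `p₂`. -/
def densitySnd (p₁ p₂ t₁ t₂ r : R) : R :=
  -(2 * (p₁ * t₂ - t₁ * p₂) * t₁ * r ^ 5)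

/-- The difference of `densityFst` and of the derivative of `densitySnd` along the curve. -/
def flux (p₁ p₂ p₃ t₁ t₂ t₃ r : R) : R :=
  4 * (p₁ * t₂ - t₁ * p₂) * t₂ * r ^ 5 - 5 * (p₁ * t₂ - t₁ * p₂) ^ 2 * r ^ 7 * p₁ + r * p₁
    + 2 * (p₁ * t₃ - t₁ * p₃) * t₁ * r ^ 5
    - 10 * (p₁ * t₂ - t₁ * p₂) * t₁ * r ^ 7 * (p₁ * p₂ + t₁ * t₂)

/-- The part of the `L²`-gradient of the elastic energy without derivatives of order four. -/
def gradRest (p₁ p₂ p₃ t₁ t₂ t₃ r : R) : R :=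
  -(4 * (p₁ * t₃ - t₁ * p₃) * t₂ * r ^ 5 + 4 * (p₁ * t₂ - t₁ * p₂) * t₃ * r ^ 5
    - 20 * (p₁ * t₂ - t₁ * p₂) * t₂ * r ^ 7 * (p₁ * p₂ + t₁ * t₂)
    - 10 * (p₁ * t₂ - t₁ * p₂) * (p₁ * t₃ - t₁ * p₃) * r ^ 7 * p₁
    + 35 * (p₁ * t₂ - t₁ * p₂) ^ 2 * r ^ 9 * (p₁ * p₂ + t₁ * t₂) * p₁
    - 5 * (p₁ * t₂ - t₁ * p₂) ^ 2 * r ^ 7 * p₂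
    - r ^ 3 * (p₁ * p₂ + t₁ * t₂) * p₁ + r * p₂
    + 2 * (p₂ * t₃ - t₂ * p₃) * t₁ * r ^ 5
    + 2 * (p₁ * t₃ - t₁ * p₃) * t₂ * r ^ 5
    - 20 * (p₁ * t₃ - t₁ * p₃) * t₁ * r ^ 7 * (p₁ * p₂ + t₁ * t₂)
    - 10 * (p₁ * t₂ - t₁ * p₂) * t₂ * r ^ 7 * (p₁ * p₂ + t₁ * t₂)
    + 70 * (p₁ * t₂ - t₁ * p₂) * t₁ * r ^ 9 * (p₁ * p₂ + t₁ * t₂) ^ 2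
    - 10 * (p₁ * t₂ - t₁ * p₂) * t₁ * r ^ 7 * (p₂ ^ 2 + t₂ ^ 2 + p₁ * p₃ + t₁ * t₃))

end CommRing

section HasPrim

variable {p₁ p₂ p₃ p₄ t₁ t₂ t₃ t₄ r : ParamCircle → ℝ}

/-- This is the first integration by parts: it moves one derivative off the term with φ″ and turns
the coefficient of φ' into `flux`. -/
lemma hasPrim_densitySnd (hp₁ : HasPrim p₁ p₂) (hp₂ : HasPrim p₂ p₃) (ht₁ : HasPrim t₁ t₂)
    (ht₂ : HasPrim t₂ t₃) (hr : HasPrim r fun x => -(r x ^ 3 * (p₁ x * p₂ x + t₁ x * t₂ x))) :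
    HasPrim (fun x => densitySnd (p₁ x) (p₂ x) (t₁ x) (t₂ x) (r x)) fun x =>
      densityFst (p₁ x) (p₂ x) (t₁ x) (t₂ x) (r x) -
        flux (p₁ x) (p₂ x) (p₃ x) (t₁ x) (t₂ x) (t₃ x) (r x) := by
  have hw := (hp₁.mul ht₂).sub (ht₁.mul hp₂)
  have hr2 := hr.mul hr
  have hr5 := (hr2.mul hr2).mul hr
  convert ((hw.mul ht₁).mul hr5).const_mul (-2) using 2 with x x
  · simp only [densitySnd]; ring
  · simp only [densityFst, flux]; ring

/-- The second integration by parts: minus this derivative is the gradient. The fourth derivatives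
enter linearly, so they need only be square integrable. -/
lemma hasPrim_flux (hp₁ : HasPrim p₁ p₂) (hp₂ : HasPrim p₂ p₃) (hp₃ : HasPrim p₃ p₄)
    (ht₁ : HasPrim t₁ t₂) (ht₂ : HasPrim t₂ t₃) (ht₃ : HasPrim t₃ t₄)
    (hr : HasPrim r fun x => -(r x ^ 3 * (p₁ x * p₂ x + t₁ x * t₂ x))) :
    HasPrim (fun x => flux (p₁ x) (p₂ x) (p₃ x) (t₁ x) (t₂ x) (t₃ x) (r x)) fun x =>
      -(2 * t₁ x ^ 2 * r x ^ 5 * p₄ x + -(2 * p₁ x * t₁ x * r x ^ 5) * t₄ x +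
        gradRest (p₁ x) (p₂ x) (p₃ x) (t₁ x) (t₂ x) (t₃ x) (r x)) := by
  have hw := (hp₁.mul ht₂).sub (ht₁.mul hp₂)
  have hw' := (hp₁.mul ht₃).sub (ht₁.mul hp₃)
  have hs := (hp₁.mul hp₂).add (ht₁.mul ht₂)
  have hr2 := hr.mul hr
  have hr5 := (hr2.mul hr2).mul hr
  have hr7 := hr5.mul hr2
  convert ((((((hw.mul ht₂).mul hr5).const_mul 4).sub
    ((((hw.mul hw).mul hr7).mul hp₁).const_mul 5)).add (hr.mul hp₁)).add
    (((hw'.mul ht₁).mul hr5).const_mul 2)).sub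
    ((((hw.mul ht₁).mul hr7).mul hs).const_mul 10) using 2 with x x
  · simp only [flux]; ring
  · simp only [gradRest]; ring

end HasPrim

lemma densityFst_apply (p₁ p₂ t₁ t₂ r : CircleFun) (x : ParamCircle) :
    densityFst p₁ p₂ t₁ t₂ r x = densityFst (p₁ x) (p₂ x) (t₁ x) (t₂ x) (r x) := rfl

lemma densitySnd_apply (p₁ p₂ t₁ t₂ r : CircleFun) (x : ParamCircle) :
    densitySnd p₁ p₂ t₁ t₂ r x = densitySnd (p₁ x) (p₂ x) (t₁ x) (t₂ x) (r x) := rfl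

/-- The coefficient of the derivative of order four of the same coordinate in the gradient. -/
def gradSelf (k : Fin 2) (ξ : JetSpace) : CircleFun := 2 * ξ 1 k.rev ^ 2 * invSpeed ξ ^ 5

/-- The coefficient of the derivative of order four of the other coordinate in the gradient. -/
def gradCross (k : Fin 2) (ξ : JetSpace) : CircleFun :=
  -(2 * ξ 1 k * ξ 1 k.rev * invSpeed ξ ^ 5)

/-- The terms of lower order in the gradient. -/
def gradLower (k : Fin 2) (ξ : JetSpace) : CircleFun :=
  gradRest (ξ 1 k) (ξ 2 k) (ξ 3 k) (ξ 1 k.rev) (ξ 2 k.rev) (ξ 3 k.rev) (invSpeed ξ)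

lemma gradSelf_apply (k : Fin 2) (ξ : JetSpace) (x : ParamCircle) :
    gradSelf k ξ x = 2 * ξ 1 k.rev x ^ 2 * invSpeed ξ x ^ 5 := rfl

lemma gradCross_apply (k : Fin 2) (ξ : JetSpace) (x : ParamCircle) :
    gradCross k ξ x = -(2 * ξ 1 k x * ξ 1 k.rev x * invSpeed ξ x ^ 5) := rfl

lemma gradLower_apply (k : Fin 2) (ξ : JetSpace) (x : ParamCircle) :
    gradLower k ξ x = gradRest (ξ 1 k x) (ξ 2 k x) (ξ 3 k x) (ξ 1 k.rev x) (ξ 2 k.rev x)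
      (ξ 3 k.rev x) (invSpeed ξ x) := rfl

/-- A coordinate of the `L²`-gradient of the elastic energy at `γ + u`. -/
def energyGrad (γ : ParamCircle → Plane) (k : Fin 2) (u : Sobolev 4) : HTwo :=
  mulL (gradSelf k (curveJet γ u)) (curveTop γ k u) +
    mulL (gradCross k (curveJet γ u)) (curveTop γ k.rev u) + toH (gradLower k (curveJet γ u))

/-- The functional `v ↦ ∫ h v_k`. -/
def coordDual (k : Fin 2) : HTwo →L[ℝ] StrongDual ℝ LTwo :=
  ContinuousLinearMap.precomp ℝ (coord k) ∘L pairH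

lemma coordDual_apply (k : Fin 2) (h : HTwo) (v : LTwo) :
    coordDual k h v = ∫ x, h x * coord k v x := pairH_apply h (coord k v)

/-- The differential of the elastic energy at `γ + u`. -/
def energyDiff (γ : ParamCircle → Plane) (u : Sobolev 4) : StrongDual ℝ LTwo :=
  ∑ k, coordDual k (energyGrad γ k u)

/-- The differential of the density. -/
def densityDiff (ξ η : JetSpace) : CircleFun :=
  ∑ k : Fin 2, (densityFst (ξ 1 k) (ξ 2 k) (ξ 1 k.rev) (ξ 2 k.rev) (invSpeed ξ) * η 1 k +
    densitySnd (ξ 1 k) (ξ 2 k) (ξ 1 k.rev) (ξ 2 k.rev) (invSpeed ξ) * η 2 k)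

/-- The inverse speed has derivative -r³/2 times that of |c'|², and r²|c'|² = 1 then simplifies the
length term. The density is unchanged when the coordinates are swapped, so one pair of formulas
serves both. -/
lemma hasDerivAt_density {ξ : ℝ → JetSpace} {η : JetSpace} {t : ℝ}
    (hξ : ∀ i k, HasDerivAt (fun s => ξ s i k) (η i k) t) (h : IsImmersed (ξ t)) :
    HasDerivAt (fun s => density (ξ s)) (densityDiff (ξ t) η) t := by
  have hq : HasDerivAt (fun s => speedSq (ξ s)) _ t := ((hξ 1 0).pow 2).add ((hξ 1 1).pow 2)
  have hr : HasDerivAt (fun s => invSpeed (ξ s)) _ t := hasDerivAt_invSqrt hq h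
  have hw := ((hξ 1 0).mul (hξ 2 1)).sub ((hξ 1 1).mul (hξ 2 0))
  have hd : HasDerivAt (fun s => density (ξ s)) _ t :=
    ((hw.pow 2).mul (hr.pow 5)).add (hq.mul hr)
  refine hd.congr_deriv ?_
  ext x
  have h2 := h.invSpeed_sq_mul x
  have e : invSqrt (speedSq (ξ t)) = invSpeed (ξ t) := rfl
  have e0 : (0 : Fin 2).rev = 1 := rfl
  have e1 : (1 : Fin 2).rev = 0 := rfl
  rw [e]
  have n2 : (2 : CircleFun) x = 2 := rfl
  have n5 : (5 : CircleFun) x = 5 := rfl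
  simp only [densityDiff, Fin.sum_univ_two, e0, e1, ContinuousMap.add_apply,
    ContinuousMap.mul_apply, densityFst_apply, densitySnd_apply]
  simp [n2, n5, speedSq, densityFst, densitySnd]
  generalize invSpeed (ξ t) x = r at *
  generalize ξ t 1 0 x = a1 at *
  generalize ξ t 2 0 x = a2 at *
  generalize ξ t 1 1 x = b1 at *
  generalize ξ t 2 1 x = b2 at *
  linear_combination (-(r * (a1 * η 1 0 x + b1 * η 1 1 x))) * h2

lemma coeFn_energyGrad (γ : ParamCircle → Plane) (k : Fin 2) (u : Sobolev 4) : energyGrad γ k u =ᵐ[volume] fun x =>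
    gradSelf k (curveJet γ u) x * curveTop γ k u x +
      gradCross k (curveJet γ u) x * curveTop γ k.rev u x + gradLower k (curveJet γ u) x := by
  set ξ := curveJet γ u with hξ
  filter_upwards [Lp.coeFn_add (mulL (gradSelf k ξ) (curveTop γ k u) +
      mulL (gradCross k ξ) (curveTop γ k.rev u)) (toH (gradLower k ξ)),
    Lp.coeFn_add (mulL (gradSelf k ξ) (curveTop γ k u)) (mulL (gradCross k ξ) (curveTop γ k.rev u)),
    coeFn_mulL (gradSelf k ξ) (curveTop γ k u), coeFn_mulL (gradCross k ξ) (curveTop γ k.rev u),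
    coeFn_toH (gradLower k ξ)] with x h1 h2 h3 h4 h5
  rw [energyGrad, ← hξ, h1, Pi.add_apply, h2, Pi.add_apply, h3, h4, h5]

/-! ### The first variation as a functional on L² -/

section Variation

variable {γ : ParamCircle → Plane} (hγ : IsRegularCurve (⊤ : ℕ∞) γ)

include hγ

/-- For each coordinate the integrands differ by the derivative of `densitySnd`·φ' + `flux`·φ, whose
integral over the circle vanishes. -/
lemma integral_densityDiff {u : Sobolev 4} (h : IsImmersed (curveJet γ u)) (φ : Sobolev 4) :
    integralCLM (densityDiff (curveJet γ u) (jets φ)) =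
      energyDiff γ u (Sobolev.toLTwo 4 φ) := by
  set ξ := curveJet γ u with hξ
  have pr : ∀ k : Fin 2, HasPrim (invSpeed ξ) fun x => -(invSpeed ξ x ^ 3 *
      (ξ 1 k x * ξ 2 k x + ξ 1 k.rev x * ξ 2 k.rev x)) := by
    intro k
    have := hasPrim_invSpeed hγ h
    fin_cases k
    · exact this
    · convert this using 4
      exact add_comm _ _
  have p1 : ∀ k, HasPrim (ξ 1 k) (ξ 2 k) := hasPrim_curveJet hγ u (by decide)
  have p2 : ∀ k, HasPrim (ξ 2 k) (ξ 3 k) := hasPrim_curveJet hγ u (by decide)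
  have p3 : ∀ k, HasPrim (ξ 3 k) (curveTop γ k u) := hasPrim_curveJet_three hγ u
  have q0 : ∀ k, HasPrim (jet 0 k φ) (jet 1 k φ) := fun k => hasPrim_jet_jet (by decide) k φ
  have q1 : ∀ k, HasPrim (jet 1 k φ) (jet 2 k φ) := fun k => hasPrim_jet_jet (by decide) k φ
  let D : Fin 2 → CircleFun := fun k =>
    densityFst (ξ 1 k) (ξ 2 k) (ξ 1 k.rev) (ξ 2 k.rev) (invSpeed ξ) * jet 1 k φ +
      densitySnd (ξ 1 k) (ξ 2 k) (ξ 1 k.rev) (ξ 2 k.rev) (invSpeed ξ) * jet 2 k φ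
  have hD : densityDiff ξ (jets φ) = ∑ k, D k := rfl
  rw [hD, map_sum, energyDiff, sum_apply]
  refine Finset.sum_congr rfl fun k _ => ?_
  rw [integralCLM_apply, coordDual_apply]
  have hf := hasPrim_flux (p1 k) (p2 k) (p3 k) (p1 k.rev) (p2 k.rev) (p3 k.rev) (pr k)
  have hs := hasPrim_densitySnd (p1 k) (p2 k) (p1 k.rev) (p2 k.rev) (pr k)
  have hz := ((hs.mul (q1 k)).add (hf.mul (q0 k))).integral_eq_zero
  rw [← sub_eq_zero, ← hz, ← integral_sub]
  · refine integral_congr_ae ?_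
    have e : coord k (Sobolev.toLTwo 4 φ) = toH (jet 0 k φ) := (toH_jet 0 k φ).symm
    rw [e]
    filter_upwards [coeFn_energyGrad γ k u, coeFn_toH (jet 0 k φ)] with x h1 h2
    rw [h1, h2]
    simp only [D, ContinuousMap.add_apply, ContinuousMap.mul_apply, densityFst_apply,
      densitySnd_apply, gradSelf_apply, gradCross_apply, gradLower_apply, ← hξ]
    ring
  · exact (D k).continuous.integrable_of_hasCompactSupport (HasCompactSupport.of_compactSpace _)
  · exact HTwo.integrable_mul _ _

/-- The density formula holds only for immersed curves. Immersedness is open, so it covers all small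
ε. -/
lemma hasDerivAt_elasticEnergy {u : Sobolev 4} (h : IsImmersed (curveJet γ u)) (φ : Sobolev 4) :
    HasDerivAt (fun ε : ℝ => elasticEnergy fun x => γ x + Sobolev.toLTwo 4 (u + ε • φ) x)
      (energyDiff γ u (Sobolev.toLTwo 4 φ)) 0 := by
  have hline : ∀ i k, HasDerivAt (fun ε : ℝ => curveJet γ (u + ε • φ) i k) (jets φ i k) 0 := by
    intro i k
    have h1 : ∀ ε : ℝ, curveJet γ (u + ε • φ) i k = curveJet γ u i k + ε • jets φ i k := by
      intro ε
      simp [curveJet, add_assoc]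
    simp only [h1]
    simpa using ((hasDerivAt_id (0 : ℝ)).smul_const (jets φ i k)).const_add (curveJet γ u i k)
  have h0 : IsImmersed (curveJet γ (u + (0 : ℝ) • φ)) := by simpa using h
  have hd := integralCLM.hasFDerivAt.comp_hasDerivAt (0 : ℝ) (hasDerivAt_density hline h0)
  rw [zero_smul, add_zero, integral_densityDiff hγ h] at hd
  refine hd.congr_of_eventuallyEq ?_
  have hc : Continuous fun ε : ℝ => curveJet γ (u + ε • φ) :=
    (continuous_curveJet γ).comp (by fun_prop)
  filter_upwards [(isOpen_isImmersed.preimage hc).mem_nhds h0] with ε hε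
  exact elasticEnergy_eq hγ hε

end Variation

end ElasticCurve

end

noncomputable section

namespace ElasticCurve

/-! ### Analyticity -/

section Analytic

variable {ξ : JetSpace} (h : IsImmersed ξ)

lemma analyticAt_entry (ξ : JetSpace) (i : Fin 4) (c : Fin 2) :
    AnalyticAt ℝ (fun ξ : JetSpace => ξ i c) ξ :=
  (ContinuousLinearMap.proj (R := ℝ) (φ := fun _ : Fin 2 => CircleFun) c ∘L
    ContinuousLinearMap.proj (R := ℝ) (φ := fun _ : Fin 4 => Fin 2 → CircleFun) i).analyticAt ξ

include h

lemma analyticAt_invSpeed : AnalyticAt ℝ invSpeed ξ := by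
  have hq : AnalyticAt ℝ speedSq ξ :=
    ((analyticAt_entry ξ 1 0).pow 2).add ((analyticAt_entry ξ 1 1).pow 2)
  exact (analyticAt_invSqrt h).comp hq

lemma analyticAt_density : AnalyticAt ℝ density ξ := by
  have hp := analyticAt_entry ξ
  have hr := analyticAt_invSpeed h
  unfold density elasticDensity
  repeat' first
    | exact hp _ _ | exact hr | exact analyticAt_const | apply AnalyticAt.fun_add
    | apply AnalyticAt.fun_sub | apply AnalyticAt.fun_mul | apply AnalyticAt.fun_neg
    | apply AnalyticAt.fun_pow

lemma analyticAt_gradSelf (k : Fin 2) : AnalyticAt ℝ (gradSelf k) ξ := by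
  have hp := analyticAt_entry ξ
  have hr := analyticAt_invSpeed h
  unfold gradSelf
  repeat' first
    | exact hp _ _ | exact hr | exact analyticAt_const | apply AnalyticAt.fun_add
    | apply AnalyticAt.fun_sub | apply AnalyticAt.fun_mul | apply AnalyticAt.fun_neg
    | apply AnalyticAt.fun_pow

lemma analyticAt_gradCross (k : Fin 2) : AnalyticAt ℝ (gradCross k) ξ := by
  have hp := analyticAt_entry ξ
  have hr := analyticAt_invSpeed h
  unfold gradCross
  repeat' first
    | exact hp _ _ | exact hr | exact analyticAt_const | apply AnalyticAt.fun_add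
    | apply AnalyticAt.fun_sub | apply AnalyticAt.fun_mul | apply AnalyticAt.fun_neg
    | apply AnalyticAt.fun_pow

lemma analyticAt_gradLower (k : Fin 2) : AnalyticAt ℝ (gradLower k) ξ := by
  have hp := analyticAt_entry ξ
  have hr := analyticAt_invSpeed h
  unfold gradLower gradRest
  repeat' first
    | exact hp _ _ | exact hr | exact analyticAt_const | apply AnalyticAt.fun_add
    | apply AnalyticAt.fun_sub | apply AnalyticAt.fun_mul | apply AnalyticAt.fun_neg
    | apply AnalyticAt.fun_pow

end Analytic

lemma analyticAt_curveJet (γ : ParamCircle → Plane) (u : Sobolev 4) :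
    AnalyticAt ℝ (curveJet γ) u := analyticAt_const.add (jets.analyticAt u)

lemma analyticAt_curveTop (γ : ParamCircle → Plane) (c : Fin 2) (u : Sobolev 4) :
    AnalyticAt ℝ (curveTop γ c) u :=
  analyticAt_const.add ((coord c ∘L Sobolev.der 4).analyticAt u)

lemma _root_.AnalyticAt.mulL {V : Type*} [NormedAddCommGroup V] [NormedSpace ℝ V]
    {f : V → CircleFun} {g : V → HTwo} {u : V} (hf : AnalyticAt ℝ f u) (hg : AnalyticAt ℝ g u) :
    AnalyticAt ℝ (fun v => ElasticCurve.mulL (f v) (g v)) u :=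
  (ElasticCurve.mulL.analyticAt_bilinear (f u, g u)).comp₂ hf hg

/-- The coefficients are analytic in the jets, the fourth derivative is affine in u, and the two are
joined by the bounded bilinear map `mulL`. -/
lemma analyticAt_energyGrad {γ : ParamCircle → Plane} {u : Sobolev 4}
    (h : IsImmersed (curveJet γ u)) (k : Fin 2) : AnalyticAt ℝ (energyGrad γ k) u := by
  have hJ := analyticAt_curveJet γ u
  have h1 := ((analyticAt_gradSelf h k).comp hJ).mulL (analyticAt_curveTop γ k u)
  have h2 := ((analyticAt_gradCross h k).comp hJ).mulL (analyticAt_curveTop γ k.rev u)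
  have h3 := (toH.analyticAt _).comp ((analyticAt_gradLower h k).comp hJ)
  exact (h1.add h2).add h3

/-- The restriction of functionals to normal fields. -/
def restrictNormal (γ : ParamCircle → Plane) :
    StrongDual ℝ LTwo →L[ℝ] StrongDual ℝ (LTwoNormal γ) :=
  ContinuousLinearMap.precomp ℝ (LTwoNormal γ).subtypeL

/-- The first variation of the elastic energy. -/
def firstVariation (γ : ParamCircle → Plane) (ψ : SobolevNormal γ 4) :
    StrongDual ℝ (LTwoNormal γ) :=
  restrictNormal γ (energyDiff γ ψ)

lemma analyticAt_energyDiff {γ : ParamCircle → Plane} {u : Sobolev 4}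
    (h : IsImmersed (curveJet γ u)) : AnalyticAt ℝ (energyDiff γ) u := by
  have h1 : ∀ k, AnalyticAt ℝ (fun u => coordDual k (energyGrad γ k u)) u := fun k =>
    ((coordDual k).analyticAt _).comp (analyticAt_energyGrad h k)
  have h2 : energyDiff γ = fun u => coordDual 0 (energyGrad γ 0 u) +
      coordDual 1 (energyGrad γ 1 u) := funext fun u => by rw [energyDiff, Fin.sum_univ_two]
  rw [h2]
  exact (h1 0).add (h1 1)

lemma analyticAt_firstVariation {γ : ParamCircle → Plane} {ψ : SobolevNormal γ 4}
    (h : IsImmersed (curveJet γ ψ)) : AnalyticAt ℝ (firstVariation γ) ψ :=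
  (ContinuousLinearMap.analyticAt (F := StrongDual ℝ (LTwoNormal γ)) (restrictNormal γ) _).comp
    (AnalyticAt.comp (g := energyDiff γ) (f := (SobolevNormal γ 4).subtypeL) (x := ψ)
      (analyticAt_energyDiff h) ((SobolevNormal γ 4).subtypeL.analyticAt ψ))

/-- Composing with i turns g into the derivative of f, so this is symmetry of second derivatives for
f. -/
lemma apply_comm_of_hasFDerivAt {V W : Type*} [NormedAddCommGroup V] [NormedSpace ℝ V]
    [NormedAddCommGroup W] [NormedSpace ℝ W] {f : V → ℝ} {g : V → StrongDual ℝ W} {i : V →L[ℝ] W}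
    {D : V →L[ℝ] StrongDual ℝ W} {x : V} (hf : ∀ᶠ y in nhds x, HasFDerivAt f (g y ∘L i) y)
    (hg : HasFDerivAt g D x) (v w : V) : D v (i w) = D w (i v) := by
  have h : HasFDerivAt (fun y => g y ∘L i) (ContinuousLinearMap.precomp ℝ i ∘L D) x :=
    (ContinuousLinearMap.precomp ℝ i : StrongDual ℝ W →L[ℝ] StrongDual ℝ V).hasFDerivAt.comp x hg
  exact second_derivative_symmetric_of_eventually hf h v w

/-! ### E, δE and δ²E(0) on normal fields -/

section Energy

variable {γ : ParamCircle → Plane} (hγ : IsRegularCurve (⊤ : ℕ∞) γ)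

lemma isOpen_isImmersed_normal (γ : ParamCircle → Plane) :
    IsOpen {ψ : SobolevNormal γ 4 | IsImmersed (curveJet γ ψ)} :=
  isOpen_isImmersed.preimage ((continuous_curveJet γ).comp continuous_subtype_val)

include hγ

lemma analyticAt_normalEnergy {ψ : SobolevNormal γ 4} (h : IsImmersed (curveJet γ ψ)) :
    AnalyticAt ℝ (normalEnergy γ) ψ := by
  have hJ : AnalyticAt ℝ (fun ψ : SobolevNormal γ 4 => curveJet γ ψ) ψ :=
    AnalyticAt.comp (g := curveJet γ) (f := (SobolevNormal γ 4).subtypeL) (x := ψ)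
      (analyticAt_curveJet γ ψ) ((SobolevNormal γ 4).subtypeL.analyticAt ψ)
  have h1 := (integralCLM.analyticAt _).comp (AnalyticAt.comp (g := density)
    (f := fun ψ : SobolevNormal γ 4 => curveJet γ ψ) (x := ψ) (analyticAt_density h) hJ)
  refine h1.congr ?_
  filter_upwards [(isOpen_isImmersed_normal γ).mem_nhds h] with χ hχ
  exact (elasticEnergy_eq hγ hχ).symm

lemma isFirstVariation_firstVariation {ψ : SobolevNormal γ 4} (h : IsImmersed (curveJet γ ψ)) :
    IsFirstVariation γ ψ (firstVariation γ ψ) := fun φ =>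
  hasDerivAt_elasticEnergy hγ h φ

/-- Analyticity provides a Fréchet derivative, and the directional derivatives identify it. -/
lemma hasFDerivAt_normalEnergy {ψ : SobolevNormal γ 4} (h : IsImmersed (curveJet γ ψ)) :
    HasFDerivAt (normalEnergy γ) (firstVariation γ ψ ∘L SobolevNormal.incl γ 4) ψ := by
  have h1 := (analyticAt_normalEnergy hγ h).differentiableAt.hasFDerivAt
  have h2 : fderiv ℝ (normalEnergy γ) ψ = firstVariation γ ψ ∘L SobolevNormal.incl γ 4 := by
    ext φ
    have hline : HasDerivAt (fun ε : ℝ => ψ + ε • φ) φ 0 := by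
      simpa using ((hasDerivAt_id (0 : ℝ)).smul_const φ).const_add ψ
    have h3 : HasFDerivAt (normalEnergy γ) (fderiv ℝ (normalEnergy γ) ψ)
        (ψ + (0 : ℝ) • φ) := by simpa using h1
    have h4 : HasDerivAt (fun ε : ℝ => normalEnergy γ (ψ + ε • φ))
        (fderiv ℝ (normalEnergy γ) ψ φ) 0 :=
      HasFDerivAt.comp_hasDerivAt (f := fun ε : ℝ => ψ + ε • φ) (l := normalEnergy γ) 0 h3 hline
    exact h4.unique (isFirstVariation_firstVariation hγ h φ)
  rwa [h2] at h1

lemma isSecondVariationAtZero {D : SobolevNormal γ 4 →L[ℝ] StrongDual ℝ (LTwoNormal γ)}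
    (hD : HasFDerivAt (firstVariation γ) D 0) : IsSecondVariationAtZero γ D := by
  have h0 : IsImmersed (curveJet γ (0 : SobolevNormal γ 4)) := isImmersed_curveJet_zero hγ
  have hnhds := (isOpen_isImmersed_normal γ).mem_nhds h0
  have hsymm := apply_comm_of_hasFDerivAt
    (Filter.mem_of_superset hnhds fun ψ hψ => hasFDerivAt_normalEnergy hγ hψ) hD
  intro φ ζ
  have hline : HasDerivAt (fun η : ℝ => η • ζ) ζ 0 := by
    simpa using (hasDerivAt_id (0 : ℝ)).smul_const ζ
  have hev : ∀ᶠ η : ℝ in nhds 0, IsImmersed (curveJet γ (η • ζ : SobolevNormal γ 4)) := by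
    have hc : Filter.Tendsto (fun η : ℝ => η • ζ) (nhds 0) (nhds 0) := by
      simpa using hline.continuousAt.tendsto
    exact hc.eventually hnhds
  have hd : ∀ᶠ η : ℝ in nhds 0, HasDerivAt (fun ε : ℝ => normalEnergy γ (ε • φ + η • ζ))
      (firstVariation γ (η • ζ) (SobolevNormal.incl γ 4 φ)) 0 := by
    filter_upwards [hev] with η hη
    simpa only [add_comm] using isFirstVariation_firstVariation hγ hη φ
  refine ⟨hd.mono fun η hη => hη.differentiableAt, ?_⟩
  -- Differentiating δE along ζ yields D ζ tested on φ, whereas the second variation requires D φ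
  -- tested on ζ. Symmetry exchanges the two.
  have h1 : HasDerivAt (fun η : ℝ => firstVariation γ (η • ζ) (SobolevNormal.incl γ 4 φ))
      (D ζ (SobolevNormal.incl γ 4 φ)) 0 := by
    have h2 : HasFDerivAt (firstVariation γ) D ((fun η : ℝ => η • ζ) 0) := by simpa using hD
    have h3 := h2.comp_hasDerivAt (0 : ℝ) hline
    exact (ContinuousLinearMap.apply ℝ ℝ (SobolevNormal.incl γ 4 φ)).hasFDerivAt.comp_hasDerivAt
      (0 : ℝ) h3
  have h4 : D ζ (SobolevNormal.incl γ 4 φ) = D φ (SobolevNormal.incl γ 4 ζ) := hsymm ζ φ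
  rw [← h4]
  exact h1.congr_of_eventuallyEq (hd.mono fun η hη => hη.deriv)

end Energy

end ElasticCurve

end

noncomputable section

namespace ElasticCurve

/-! ### The second variation -/

lemma mulL_mulL (a b : CircleFun) (h : HTwo) : mulL a (mulL b h) = mulL (a * b) h := by
  refine Lp.ext ?_
  filter_upwards [coeFn_mulL a (mulL b h), coeFn_mulL b h, coeFn_mulL (a * b) h] with x h1 h2 h3
  rw [h1, h2, h3, ContinuousMap.mul_apply, mul_assoc]

lemma mulL_one (h : HTwo) : mulL 1 h = h := by
  refine Lp.ext ?_
  filter_upwards [coeFn_mulL 1 h] with x h1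
  rw [h1, ContinuousMap.one_apply, one_mul]

/-- The derivative of order four of a coordinate. -/
def topCoord (c : Fin 2) : Sobolev 4 →L[ℝ] HTwo := coord c ∘L Sobolev.der 4

/-- The part of highest order of the linearized gradient. -/
def gradPrincipal (ξ : JetSpace) (k : Fin 2) : Sobolev 4 →L[ℝ] HTwo :=
  mulL (gradSelf k ξ) ∘L topCoord k + mulL (gradCross k ξ) ∘L topCoord k.rev

lemma hasFDerivAt_mulL {V : Type*} [NormedAddCommGroup V] [NormedSpace ℝ V]
    {f : V → CircleFun} {g : V → HTwo} {f' : V →L[ℝ] CircleFun} {g' : V →L[ℝ] HTwo} {u : V}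
    (hf : HasFDerivAt f f' u) (hg : HasFDerivAt g g' u) :
    HasFDerivAt (fun v => mulL (f v) (g v)) (mulL (f u) ∘L g' + mulL.flip (g u) ∘L f') u := by
  refine (mulL.hasFDerivAt_of_bilinear hf hg).congr_fderiv ?_
  ext1 v
  rfl

/-- By the product rule the derivative falls either on the fourth-order term, giving
`gradPrincipal`, or on functions of the jets. The latter part factors through `jets` and is thus
compact. -/
lemma exists_hasFDerivAt_energyGrad {γ : ParamCircle → Plane} {u : Sobolev 4}
    (h : IsImmersed (curveJet γ u)) (k : Fin 2) : ∃ M : JetSpace →L[ℝ] HTwo,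
      HasFDerivAt (energyGrad γ k) (gradPrincipal (curveJet γ u) k + M ∘L jets) u := by
  have hJ : HasFDerivAt (curveJet γ) jets u := jets.hasFDerivAt.const_add _
  have ht : ∀ c, HasFDerivAt (curveTop γ c) (topCoord c) u := fun c =>
    (topCoord c).hasFDerivAt.const_add _
  have hc : ∀ {G : JetSpace → CircleFun}, AnalyticAt ℝ G (curveJet γ u) →
      HasFDerivAt (fun v => G (curveJet γ v)) (fderiv ℝ G (curveJet γ u) ∘L jets) u :=
    fun hG => hG.differentiableAt.hasFDerivAt.comp u hJ
  have h1 := hasFDerivAt_mulL (hc (analyticAt_gradSelf h k)) (ht k)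
  have h2 := hasFDerivAt_mulL (hc (analyticAt_gradCross h k)) (ht k.rev)
  have h3 : HasFDerivAt (fun v => toH (gradLower k (curveJet γ v))) _ u :=
    toH.hasFDerivAt.comp u (hc (analyticAt_gradLower h k))
  refine ⟨mulL.flip (curveTop γ k u) ∘L fderiv ℝ (gradSelf k) (curveJet γ u) +
    mulL.flip (curveTop γ k.rev u) ∘L fderiv ℝ (gradCross k) (curveJet γ u) +
    toH ∘L fderiv ℝ (gradLower k) (curveJet γ u),
    ((h1.add h2).add h3).congr_fderiv ?_⟩
  ext1 v
  simp only [gradPrincipal, add_apply, ContinuousLinearMap.comp_apply]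
  abel

lemma isCompactOperator_comp_jets {W : Type*} [NormedAddCommGroup W] [NormedSpace ℝ W]
    (M : JetSpace →L[ℝ] W) : IsCompactOperator (M ∘L jets) :=
  isCompactOperator_jets.clm_comp M

/-! ### Comparison of δ²E(0) with id + (∂_s^⊥)⁴ -/

section Fredholm

variable {γ : ParamCircle → Plane} (hγ : IsRegularCurve (⊤ : ℕ∞) γ)

/-- The functional `v ↦ 2 ∫ h ⟨n, v⟩ ds` on all fields. -/
def normalDual (γ : ParamCircle → Plane) : HTwo →L[ℝ] StrongDual ℝ LTwo :=
  ∑ k, coordDual k ∘L mulL (2 * speedC γ * nrmC γ k)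

/-- The part of the highest order of `normalTop`. -/
def normalPrincipal (γ : ParamCircle → Plane) : Sobolev 4 →L[ℝ] HTwo :=
  ∑ c, mulL (toC (normalCoeff γ 4 4 c)) ∘L topCoord c

/-- Only derivatives of order less than four remain, and these depend compactly on the field. -/
lemma isCompactOperator_normalTop_sub (γ : ParamCircle → Plane) :
    IsCompactOperator (normalTop γ - normalPrincipal γ) := by
  have h : normalTop γ - normalPrincipal γ =
      ∑ i : Fin 4, ∑ c, (mulL (toC (normalCoeff γ 4 i c)) ∘L toH) ∘L jet i c := by
    have h1 : ∀ (i : Fin 4) (c : Fin 2), coord c ∘L Sobolev.der i.castSucc = toH ∘L jet i c :=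
      fun i c => by ext1 u; exact (toH_jet i c u).symm
    rw [normalTop, Fin.sum_univ_castSucc, normalPrincipal]
    simp only [h1, ContinuousLinearMap.comp_assoc]
    exact add_sub_cancel_right _ _
  rw [h]
  exact isCompactOperator_sum _ _ fun i _ => isCompactOperator_sum _ _ fun c _ =>
    (isCompactOperator_jet i c).clm_comp (mulL (toC (normalCoeff γ 4 i c)) ∘L toH)

include hγ

/-- The leading parts agree because 2|γ'| n_k · |γ'|⁻⁴ n_c is the coefficient of the fourth
derivative in the gradient, once the velocity is written as |γ'| times the rotated normal. The
factor |γ'| turns dx into ds. -/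
lemma normalDual_normalPrincipal : normalDual γ ∘L normalPrincipal γ =
    ∑ k, coordDual k ∘L gradPrincipal (curveJet γ 0) k := by
  set ξ := curveJet γ 0 with hξ
  have hr : ∀ x, invSpeed ξ x = (speed γ x)⁻¹ := by
    intro x
    rw [(isImmersed_curveJet_zero hγ).invSpeed_apply, speedSq_apply, curveJet_apply hγ,
      curveJet_apply hγ, map_zero, map_zero]
    simp [coordDeriv, vel, speed]
  have hv : ∀ c x, ξ 1 c x = vel γ c x := by
    intro c x
    rw [hξ, curveJet_apply hγ, map_zero]
    simp [coordDeriv, vel]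
  have hself : ∀ k, 2 * speedC γ * nrmC γ k * toC (normalCoeff γ 4 4 k) = gradSelf k ξ := by
    intro k
    ext x
    have h2 : (2 : CircleFun) x = 2 := rfl
    have h0 := (speed_pos hγ x).ne'
    rw [gradSelf_apply, hr, hv]
    simp only [ContinuousMap.mul_apply, h2, speedC_apply hγ, nrmC_apply hγ,
      toC_apply (isSmooth_normalCoeff hγ _ _ _).continuous, normalCoeff_self]
    obtain ⟨e0, e1⟩ := vel_eq_nrm hγ x
    fin_cases k
    · change _ = 2 * vel γ 1 x ^ 2 * _
      rw [e1]
      simp only [Fin.zero_eta]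
      field_simp
    · change _ = 2 * vel γ 0 x ^ 2 * _
      rw [e0]
      simp only [Fin.mk_one]
      field_simp
  have hcross : ∀ k : Fin 2, 2 * speedC γ * nrmC γ k * toC (normalCoeff γ 4 4 k.rev) =
      gradCross k ξ := by
    intro k
    ext x
    have h2 : (2 : CircleFun) x = 2 := rfl
    have h0 := (speed_pos hγ x).ne'
    rw [gradCross_apply, hr, hv, hv]
    simp only [ContinuousMap.mul_apply, h2, speedC_apply hγ, nrmC_apply hγ,
      toC_apply (isSmooth_normalCoeff hγ _ _ _).continuous, normalCoeff_self]
    obtain ⟨e0, e1⟩ := vel_eq_nrm hγ x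
    fin_cases k
    · change 2 * speed γ x * nrm γ 0 x * (_ * nrm γ 1 x) = -(2 * vel γ 0 x * vel γ 1 x * _)
      rw [e0, e1]
      field_simp
    · change 2 * speed γ x * nrm γ 1 x * (_ * nrm γ 0 x) = -(2 * vel γ 1 x * vel γ 0 x * _)
      rw [e0, e1]
      field_simp
  have hk : ∀ k, mulL (2 * speedC γ * nrmC γ k) ∘L normalPrincipal γ = gradPrincipal ξ k := by
    intro k
    ext1 u
    simp only [normalPrincipal, Fin.sum_univ_two, ContinuousLinearMap.comp_apply,
      add_apply, map_add, mulL_mulL, gradPrincipal, ← hself, ← hcross]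
    fin_cases k
    · rfl
    · exact add_comm _ _
  rw [normalDual, ContinuousLinearMap.finsetSum_comp]
  refine Finset.sum_congr rfl fun k _ => ?_
  rw [ContinuousLinearMap.comp_assoc, hk]

lemma restrictNormal_normalDual [CompleteSpace (LTwoNormal γ)] (h : HTwo) :
    restrictNormal γ (normalDual γ h) =
      InnerProductSpace.toDual ℝ (LTwoNormal γ) (normalVec hγ (mulL (2 * speedC γ) h)) := by
  ext v
  rw [InnerProductSpace.toDual_apply_apply, Submodule.coe_inner, L2.inner_def, coe_normalVec]
  change (normalDual γ h) (v : LTwo) = _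
  rw [normalDual, Fin.sum_univ_two, add_apply, ContinuousLinearMap.comp_apply,
    ContinuousLinearMap.comp_apply, add_apply, coordDual_apply,
    coordDual_apply, ← integral_add (HTwo.integrable_mul _ _) (HTwo.integrable_mul _ _)]
  refine integral_congr_ae ?_
  filter_upwards [coeFn_mulL (2 * speedC γ * nrmC γ 0) h, coeFn_mulL (2 * speedC γ * nrmC γ 1) h,
    coeFn_mulL (2 * speedC γ) h, coeFn_smulField (nrmC γ) (mulL (2 * speedC γ) h),
    coeFn_coord 0 (v : LTwo), coeFn_coord 1 (v : LTwo)] with x h1 h2 h3 h4 h5 h6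
  rw [h1, h2, h4, h5, h6, PiLp.inner_apply, Fin.sum_univ_two]
  simp [field, h3]
  ring

/-- The map is a composition of three bijections: multiplication by twice the speed, the
identification of scalar functions with normal fields, and the Riesz isomorphism. -/
lemma restrictNormal_normalDual_bijective :
    Function.Bijective (restrictNormal γ ∘L normalDual γ) := by
  have := completeSpace_LTwoNormal hγ
  have hS : ∀ h, (restrictNormal γ ∘L normalDual γ) h =
      InnerProductSpace.toDual ℝ (LTwoNormal γ) (normalVec hγ (mulL (2 * speedC γ) h)) :=
    restrictNormal_normalDual hγ
  let b : CircleFun := toC fun x => 2⁻¹ * (speed γ x)⁻¹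
  have hc : Continuous fun x => 2⁻¹ * (speed γ x)⁻¹ :=
    continuous_const.mul (isSmooth_speed_inv hγ).continuous
  have hb : 2 * speedC γ * b = 1 := by
    ext x
    have h2 : (2 : CircleFun) x = 2 := rfl
    have h0 := (speed_pos hγ x).ne'
    rw [ContinuousMap.mul_apply, ContinuousMap.mul_apply, h2, speedC_apply hγ,
      toC_apply hc, ContinuousMap.one_apply]
    field_simp
  constructor
  · intro h h' heq
    rw [hS, hS] at heq
    have h1 := normalVec_injective hγ ((InnerProductSpace.toDual ℝ (LTwoNormal γ)).injective heq)
    have h2 := congrArg (mulL b) h1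
    rwa [mulL_mulL, mulL_mulL, mul_comm b, hb, mulL_one, mulL_one] at h2
  · intro l
    set w := (InnerProductSpace.toDual ℝ (LTwoNormal γ)).symm l with hw
    refine ⟨mulL b (dotL (nrmC γ) (w : LTwo)), ?_⟩
    rw [hS, mulL_mulL, hb, mulL_one]
    have h1 : normalVec hγ (dotL (nrmC γ) (w : LTwo)) = w :=
      Subtype.ext (smulField_dotL hγ w.2)
    rw [h1, hw, LinearIsometryEquiv.apply_symm_apply]

/-- The normal component of `id + (∂_s^⊥)⁴`. -/
def normalOp (γ : ParamCircle → Plane) : SobolevNormal γ 4 →L[ℝ] HTwo :=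
  (toH ∘L normalJet γ 0 + normalTop γ) ∘L (SobolevNormal γ 4).subtypeL

lemma normalOp_bijective : Function.Bijective (normalOp γ) := by
  have h := idAddFour_bijective hγ
  have hcomp : ∀ φ, idAddFour hγ φ = normalVec hγ (normalOp γ φ) := fun φ => rfl
  refine ⟨fun φ φ' heq => h.1 (by rw [hcomp, hcomp, heq]), fun f => ?_⟩
  obtain ⟨φ, hφ⟩ := h.2 (normalVec hγ f)
  exact ⟨φ, normalVec_injective hγ (by rw [← hφ, hcomp])⟩

/-- The derivative of δE at 0 and the isomorphism `S ∘L normalOp γ` have the same fourth-order part.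
They differ by a compact operator, so the index is zero. -/
lemma exists_hasFDerivAt_firstVariation :
    ∃ D : SobolevNormal γ 4 →L[ℝ] StrongDual ℝ (LTwoNormal γ),
      HasFDerivAt (firstVariation γ) D 0 ∧ IsFredholmIndexZero D := by
  have h0 := isImmersed_curveJet_zero hγ
  choose M hM using fun k => exists_hasFDerivAt_energyGrad h0 k
  let P : Sobolev 4 →L[ℝ] StrongDual ℝ LTwo :=
    ∑ k, coordDual k ∘L (gradPrincipal (curveJet γ 0) k + M k ∘L jets)
  have hP : HasFDerivAt (energyDiff γ) P 0 := by
    have h1 : ∀ k, HasFDerivAt (fun u => coordDual k (energyGrad γ k u))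
        (coordDual k ∘L (gradPrincipal (curveJet γ 0) k + M k ∘L jets)) 0 := fun k =>
      (coordDual k).hasFDerivAt.comp 0 (hM k)
    exact HasFDerivAt.fun_sum fun k _ => h1 k
  let ι : SobolevNormal γ 4 →L[ℝ] Sobolev 4 := (SobolevNormal γ 4).subtypeL
  have hD : HasFDerivAt (firstVariation γ) (restrictNormal γ ∘L P ∘L ι) 0 := by
    have h1 : HasFDerivAt (energyDiff γ) P (ι 0) := by rwa [map_zero]
    have h2 : HasFDerivAt (fun ψ => energyDiff γ (ι ψ)) (P ∘L ι) 0 :=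
      h1.comp (0 : SobolevNormal γ 4) ι.hasFDerivAt
    exact (ContinuousLinearMap.hasFDerivAt (F := StrongDual ℝ (LTwoNormal γ))
      (restrictNormal γ)).comp (0 : SobolevNormal γ 4) h2
  refine ⟨_, hD, ?_⟩
  let S := restrictNormal γ ∘L normalDual γ
  have hbij : Function.Bijective (S ∘L normalOp γ) :=
    (restrictNormal_normalDual_bijective hγ).comp (normalOp_bijective hγ)
  have := completeSpace_LTwoNormal hγ
  have := completeSpace_SobolevNormal hγ 4
  let e : SobolevNormal γ 4 ≃L[ℝ] StrongDual ℝ (LTwoNormal γ) :=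
    ContinuousLinearEquiv.ofBijective (S ∘L normalOp γ) (LinearMap.ker_eq_bot.2 hbij.1)
      (LinearMap.range_eq_top.2 hbij.2)
  -- Q collects the lower-order terms of the linearized gradient minus the lower-order terms that
  -- the isomorphism carries: the zeroth-order summand and the non-principal part of the fourth
  -- derivative.
  let Q : Sobolev 4 →L[ℝ] StrongDual ℝ LTwo := ∑ k, coordDual k ∘L (M k ∘L jets) -
    (normalDual γ ∘L toH) ∘L normalJet γ 0 - normalDual γ ∘L (normalTop γ - normalPrincipal γ)
  have hQ : IsCompactOperator Q := by
    have h1 : IsCompactOperator (∑ k, coordDual k ∘L (M k ∘L jets) :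
        Sobolev 4 →L[ℝ] StrongDual ℝ LTwo) :=
      isCompactOperator_sum _ _ fun k _ =>
        (isCompactOperator_comp_jets (M k)).clm_comp (coordDual k)
    exact (h1.sub ((isCompactOperator_normalJet γ 0).clm_comp (normalDual γ ∘L toH))).sub
      ((isCompactOperator_normalTop_sub γ).clm_comp (normalDual γ))
  let K : SobolevNormal γ 4 →L[ℝ] StrongDual ℝ (LTwoNormal γ) := restrictNormal γ ∘L (Q ∘L ι)
  have hK : IsCompactOperator K := (hQ.comp_clm ι).clm_comp (restrictNormal γ)
  have hsum : restrictNormal γ ∘L P ∘L ι =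
      (e : SobolevNormal γ 4 →L[ℝ] StrongDual ℝ (LTwoNormal γ)) + K := by
    have hPQ : P = normalDual γ ∘L (toH ∘L normalJet γ 0 + normalTop γ) + Q := by
      have h1 : P = normalDual γ ∘L normalPrincipal γ + ∑ k, coordDual k ∘L (M k ∘L jets) := by
        rw [normalDual_normalPrincipal hγ, ← Finset.sum_add_distrib]
        exact Finset.sum_congr rfl fun k _ => ContinuousLinearMap.comp_add _ _ _
      rw [h1]
      simp only [Q, ContinuousLinearMap.comp_add, ContinuousLinearMap.comp_sub,
        ContinuousLinearMap.comp_assoc]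
      abel
    rw [hPQ]
    ext1 φ
    exact map_add (restrictNormal γ) _ _
  rw [hsum]
  exact isFredholmIndexZero_add_compact e K hK

end Fredholm

end ElasticCurve

end

theorem mainTheorem9 (γ : ElasticCurve.ParamCircle → ElasticCurve.Plane)
    (hγ : ElasticCurve.IsRegularCurve (⊤ : ℕ∞) γ) :
    -- small radii exist
    (∃ ρ : ℝ, 0 < ρ ∧ ElasticCurve.IsAdmissibleRadius γ ρ) ∧
    -- `E` and `δE` are analytic on the ball of radius `ρ`
    (∀ ρ : ℝ, 0 < ρ → ElasticCurve.IsAdmissibleRadius γ ρ →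
      AnalyticOnNhd ℝ (ElasticCurve.normalEnergy γ)
        (Metric.ball (0 : ElasticCurve.SobolevNormal γ 4) ρ) ∧
      ∃ dE : ElasticCurve.SobolevNormal γ 4 → StrongDual ℝ (ElasticCurve.LTwoNormal γ),
        (∀ ψ ∈ Metric.ball (0 : ElasticCurve.SobolevNormal γ 4) ρ,
          ElasticCurve.IsFirstVariation γ ψ (dE ψ)) ∧
        AnalyticOnNhd ℝ dE (Metric.ball (0 : ElasticCurve.SobolevNormal γ 4) ρ)) ∧
    -- `δ²E(0)` is Fredholm of index zero
    (∃ D : ElasticCurve.SobolevNormal γ 4 →L[ℝ] StrongDual ℝ (ElasticCurve.LTwoNormal γ),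
      ElasticCurve.IsSecondVariationAtZero γ D ∧ ElasticCurve.IsFredholmIndexZero D) ∧
    -- `id + (∂_s^⊥)⁴` is invertible from `H^{4,⊥}_γ` to `L^{2,⊥}_γ`
    (∃ T : ElasticCurve.SobolevNormal γ 4 ≃L[ℝ] ElasticCurve.LTwoNormal γ,
      ∀ φ : ElasticCurve.SobolevNormal γ 4,
        ∀ᵐ x, (T φ : ElasticCurve.LTwo) x =
          (ElasticCurve.SobolevNormal.incl γ 4 φ : ElasticCurve.LTwo) x +
          (ElasticCurve.normalArcDeriv γ)^[4]
            (fun y => (ElasticCurve.SobolevNormal.incl γ 4 φ : ElasticCurve.LTwo) y) x) := by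
  have himm : ∀ ρ : ℝ, ElasticCurve.IsAdmissibleRadius γ ρ →
      ∀ ψ ∈ Metric.ball (0 : ElasticCurve.SobolevNormal γ 4) ρ,
        ElasticCurve.IsImmersed (ElasticCurve.curveJet γ ψ) := fun ρ h ψ hψ =>
    h.isImmersed hγ (mem_ball_zero_iff.1 hψ).le
  obtain ⟨D, hD, hF⟩ := ElasticCurve.exists_hasFDerivAt_firstVariation hγ
  exact ⟨ElasticCurve.exists_isAdmissibleRadius hγ, fun ρ _ h =>
    ⟨fun ψ hψ => ElasticCurve.analyticAt_normalEnergy hγ (himm ρ h ψ hψ),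
      ElasticCurve.firstVariation γ,
      fun ψ hψ => ElasticCurve.isFirstVariation_firstVariation hγ (himm ρ h ψ hψ),
      fun ψ hψ => ElasticCurve.analyticAt_firstVariation (himm ρ h ψ hψ)⟩,
    ⟨D, ElasticCurve.isSecondVariationAtZero hγ hD, hF⟩,
    ElasticCurve.idAddFourEquiv hγ, ElasticCurve.idAddFourEquiv_ae_eq hγ⟩
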